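/- Let $\mathfrak g$ be a finite-dimensional simple Lie algebra over $\mathbb C$, let $G$ be the corresponding algebraic group of adjoint type, and let $\kappa'$ be an invariant symmetric bilinear form on $\mathfrak g$. Let $\hat{\mathfrak g}_{\kappa'}$ be the affine Kac--Moody algebra at level $\kappa'$, i.e. the central extension $$0\to \mathbb C\mathbf 1\to \hat{\mathfrak g}_{\kappa'}\to \mathfrak g\otimes\mathbb C((t))\to 0$$ given by the two-cocycle $(x\otimes f,\,y\otimes g)\mapsto -\kappa'(x,y)\,\mathrm{Res}_{t=0}\, f\,dg$. Consider the full subcategory of the category of $\hat{\mathfrak g}_{\kappa'}$-modules $M$ formed by those for which (i) $\mathbf 1$ acts as the identity; (ii) $M$ is discrete: every vector is annihilated by $\mathfrak g\otimes t^N\mathbb C[[t]]$ for some $N\ge 0$; (iii) $M$ is $G(\mathbb C[[t]])$-integrable: the action of $\mathfrak g\otimes\mathbb C[[t]]$ is the differential of an algebraic action of the group scheme $G(\mathbb C[[t]])$ on $M$. Let $\kappa_{Kil}$ be the Killing form of $\mathfrak g$. The level $\kappa'$ is called positive if $\kappa'=c\,\kappa_{Kil}$ with $c+\tfrac12\in\mathbb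 Q^{>0}$, and irrational if $\kappa'=c\,\kappa_{Kil}$ with $c\in\mathbb C\setminus\mathbb Q$. Let $$\mathbb V_{\mathfrak g,\kappa'}=\mathrm{Ind}^{\hat{\mathfrak g}_{\kappa'}}_{\mathfrak g\otimes\mathbb C[[t]]\oplus\mathbb C\mathbf 1}(\mathbb C)$$ be the vacuum Weyl module, where $\mathfrak g\otimes\mathbb C[[t]]$ acts on $\mathbb C$ by zero and $\mathbf 1$ acts as the identity. **Proposition.** If $\kappa'$ is positive or irrational, then $\mathbb V_{\mathfrak g,\kappa'}$ is a projective object of the category of $G(\mathbb C[[t]])$-integrable $\hat{\mathfrak g}_{\kappa'}$-modules; that is, it belongs to this category, and for every surjective morphism $p\colon M\to N$ in the category and every morphism $f\colon \mathbb V_{\mathfrak g,\kappa'}\to N$ there is a morphism $h\colon \mathbb V_{\mathfrak g,\kappa'}\to M$ with $p\circ h=f$. -/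

import Mathlib

open scoped TensorProduct PowerSeries LaurentSeries DualNumber

universe u v w

noncomputable section

namespace AffineKM

/-! ### The residue pairing on Laurent series -/

lemma laurent_derivative_coeff (f : ℂ⸨X⸩) (n : ℤ) :
    (LaurentSeries.derivative ℂ f).coeff n = ((n : ℂ) + 1) * f.coeff (n + 1) := by
  rw [LaurentSeries.derivative_apply, LaurentSeries.hasseDeriv_coeff]
  simp

lemma euler_coeff (f : ℂ⸨X⸩) (n : ℤ) :
    (HahnSeries.single (1 : ℤ) (1 : ℂ) * LaurentSeries.derivative ℂ f).coeff n
      = (n : ℂ) * f.coeff n := by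
  have h := HahnSeries.coeff_single_mul_add (r := (1 : ℂ))
    (x := LaurentSeries.derivative ℂ f) (a := n - 1) (b := (1 : ℤ))
  rw [sub_add_cancel] at h
  rw [h, laurent_derivative_coeff]
  simp

lemma laurent_derivative_mul (f g : ℂ⸨X⸩) :
    LaurentSeries.derivative ℂ (f * g)
      = LaurentSeries.derivative ℂ f * g + f * LaurentSeries.derivative ℂ g := by
  set s : ℂ⸨X⸩ := HahnSeries.single (1 : ℤ) (1 : ℂ) with hs
  have hs0 : s ≠ 0 := by simp [hs]
  apply mul_left_cancel₀ hs0
  have e : s * (LaurentSeries.derivative ℂ f * g + f * LaurentSeries.derivative ℂ g)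
      = (s * LaurentSeries.derivative ℂ f) * g + f * (s * LaurentSeries.derivative ℂ g) := by ring
  rw [e]
  ext n
  have supp (k : ℂ⸨X⸩) : (s * LaurentSeries.derivative ℂ k).support ⊆ k.support := by
    intro m hm hk
    exact hm (by rw [hs, euler_coeff, hk, mul_zero])
  rw [HahnSeries.coeff_add, hs, euler_coeff, ← hs, HahnSeries.coeff_mul,
    HahnSeries.coeff_mul_left' f.isPWO_support (supp f),
    HahnSeries.coeff_mul_right' g.isPWO_support (supp g), ← Finset.sum_add_distrib,
    Finset.mul_sum]
  refine Finset.sum_congr rfl fun ij hij => ?_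
  rw [Finset.mem_antidiagonal] at hij
  rw [hs, euler_coeff, euler_coeff, ← hij.2.2]
  push_cast
  ring

/-- The algebra `ℂ((t))` of formal Laurent series, with its coefficientwise `ℂ`-algebra structure.
(A type synonym, because `ℂ⸨X⸩` carries two `ℂ`-algebra instances in the library which are equal
but not by definition.) -/
def Laurent : Type := ℂ⸨X⸩

instance : CommRing Laurent := inferInstanceAs (CommRing ℂ⸨X⸩)

instance : Algebra ℂ Laurent := (HahnSeries.instAlgebra : Algebra ℂ ℂ⸨X⸩)

/-- The coefficient of `t ^ n`. -/
def Laurent.coeff (f : Laurent) (n : ℤ) : ℂ := HahnSeries.coeff (show ℂ⸨X⸩ from f) n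

/-- The derivative `d/dt`. -/
def Laurent.deriv (f : Laurent) : Laurent :=
  LaurentSeries.derivative ℂ (show ℂ⸨X⸩ from f)

/-- The inclusion `ℂ[[t]] → ℂ((t))`. -/
def Laurent.ofPowerSeries : ℂ⟦X⟧ →ₐ[ℂ] Laurent where
  toRingHom := HahnSeries.ofPowerSeries ℤ ℂ
  commutes' c := HahnSeries.ofPowerSeries_C c

lemma Laurent.coeff_add (f g : Laurent) (n : ℤ) : (f + g).coeff n = f.coeff n + g.coeff n := rfl

lemma Laurent.coeff_sub (f g : Laurent) (n : ℤ) : (f - g).coeff n = f.coeff n - g.coeff n :=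
  HahnSeries.coeff_sub (x := (show ℂ⸨X⸩ from f)) (y := (show ℂ⸨X⸩ from g)) (a := n)

lemma Laurent.coeff_smul (c : ℂ) (f : Laurent) (n : ℤ) : (c • f).coeff n = c * f.coeff n := rfl

lemma Laurent.coeff_deriv (f : Laurent) (n : ℤ) :
    f.deriv.coeff n = ((n : ℂ) + 1) * f.coeff (n + 1) := laurent_derivative_coeff f n

lemma Laurent.deriv_mul (f g : Laurent) : (f * g).deriv = f.deriv * g + f * g.deriv :=
  laurent_derivative_mul f g

lemma Laurent.deriv_add (f g : Laurent) : (f + g).deriv = f.deriv + g.deriv :=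
  map_add (LaurentSeries.derivative (V := ℂ) ℂ) f g

lemma Laurent.deriv_smul (c : ℂ) (f : Laurent) : (c • f).deriv = c • f.deriv :=
  map_smul (LaurentSeries.derivative (V := ℂ) ℂ) c f

/-- The bilinear form `(f, g) ↦ Res_{t = 0} f dg` on `ℂ((t))`. -/
def residueForm : LinearMap.BilinForm ℂ Laurent :=
  LinearMap.mk₂ ℂ (fun f g => (f * g.deriv).coeff (-1))
    (fun f f' g => by rw [add_mul, Laurent.coeff_add])
    (fun c f g => by rw [Algebra.smul_mul_assoc, Laurent.coeff_smul, smul_eq_mul])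
    (fun f g g' => by rw [Laurent.deriv_add, mul_add, Laurent.coeff_add])
    (fun c f g => by
      rw [Laurent.deriv_smul, Algebra.mul_smul_comm, Laurent.coeff_smul, smul_eq_mul])

lemma residueForm_apply (f g : Laurent) : residueForm f g = (f * g.deriv).coeff (-1) := rfl

lemma residueForm_skew (f g : Laurent) : residueForm f g = - residueForm g f := by
  have h : (f * g).deriv.coeff (-1) = 0 := by
    rw [Laurent.coeff_deriv]; simp
  rw [Laurent.deriv_mul, Laurent.coeff_add, mul_comm f.deriv] at h
  rw [residueForm_apply, residueForm_apply]
  linear_combination h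

lemma residueForm_cyclic (f g h : Laurent) :
    residueForm f (g * h) = residueForm (f * g) h - residueForm g (f * h) := by
  rw [residueForm_skew f (g * h), eq_sub_iff_add_eq, neg_add_eq_iff_eq_add, residueForm_apply,
    residueForm_apply, residueForm_apply, Laurent.deriv_mul, ← Laurent.coeff_add]
  congr 1
  ring

/-! ### Levels and the affine Kac-Moody algebra -/

/-- An invariant symmetric bilinear form on a complex Lie algebra. -/
structure InvariantForm (𝔤 : Type u) [LieRing 𝔤] [LieAlgebra ℂ 𝔤] where
  form : LinearMap.BilinForm ℂ 𝔤
  symm : form.IsSymm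
  invariant : form.lieInvariant 𝔤

section Affine

variable {𝔤 : Type u} [LieRing 𝔤] [LieAlgebra ℂ 𝔤]

/-- The level is `c` times the Killing form, with `c + 1/2` a positive rational number. -/
def InvariantForm.IsPositive (κ : InvariantForm 𝔤) : Prop :=
  ∃ c : ℂ, κ.form = c • killingForm ℂ 𝔤 ∧ ∃ q : ℚ, 0 < q ∧ c + 1 / 2 = (q : ℂ)

/-- The level is `c` times the Killing form, with `c` a complex number that is not rational. -/
def InvariantForm.IsIrrational (κ : InvariantForm 𝔤) : Prop :=
  ∃ c : ℂ, κ.form = c • killingForm ℂ 𝔤 ∧ ∀ q : ℚ, c ≠ (q : ℂ)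

variable (𝔤) in
/-- The formal loop algebra `𝔤 ⊗ ℂ((t))`; the bracket is `ℂ((t))`-bilinear. -/
abbrev Loop : Type u := Laurent ⊗[ℂ] 𝔤

variable (𝔤) in
/-- The subalgebra `𝔤 ⊗ ℂ[[t]]` of arcs, as a Lie algebra in its own right. -/
abbrev Arc : Type u := ℂ⟦X⟧ ⊗[ℂ] 𝔤

/-- The bilinear form `(x ⊗ f, y ⊗ g) ↦ -κ(x, y) Res f dg`. -/
def cocycleForm (κ : InvariantForm 𝔤) : LinearMap.BilinForm ℂ (Loop 𝔤) :=
  -(LinearMap.BilinForm.tmul residueForm κ.form)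

@[simp] lemma cocycleForm_tmul (κ : InvariantForm 𝔤) (f g : Laurent) (x y : 𝔤) :
    cocycleForm κ (f ⊗ₜ x) (g ⊗ₜ y) = -(κ.form x y * residueForm f g) := by
  simp [cocycleForm]

lemma cocycleForm_skew (κ : InvariantForm 𝔤) (a b : Loop 𝔤) :
    cocycleForm κ a b = - cocycleForm κ b a := by
  induction a using TensorProduct.induction_on with
  | zero => simp
  | add a₁ a₂ h₁ h₂ => rw [map_add, map_add, LinearMap.add_apply, h₁, h₂]; ring
  | tmul f x =>
    induction b using TensorProduct.induction_on with
    | zero => simp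
    | add b₁ b₂ h₁ h₂ => rw [map_add, map_add, LinearMap.add_apply, h₁, h₂]; ring
    | tmul g y =>
      rw [cocycleForm_tmul, cocycleForm_tmul, residueForm_skew f g, κ.symm.eq x y]
      simp

lemma cocycleForm_cocycle (κ : InvariantForm 𝔤) (a b c : Loop 𝔤) :
    cocycleForm κ a ⁅b, c⁆ = cocycleForm κ ⁅a, b⁆ c + cocycleForm κ b ⁅a, c⁆ := by
  induction a using TensorProduct.induction_on with
  | zero => simp
  | add a₁ a₂ h₁ h₂ =>
    simp only [map_add, LinearMap.add_apply, add_lie, h₁, h₂]; ring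
  | tmul f x =>
    induction b using TensorProduct.induction_on with
    | zero => simp
    | add b₁ b₂ h₁ h₂ =>
      simp only [map_add, LinearMap.add_apply, add_lie, lie_add, h₁, h₂]; ring
    | tmul g y =>
      induction c using TensorProduct.induction_on with
      | zero => simp
      | add c₁ c₂ h₁ h₂ =>
        simp only [map_add, lie_add, h₁, h₂]; ring
      | tmul h z =>
        simp only [LieAlgebra.ExtendScalars.bracket_tmul, cocycleForm_tmul]
        have e₁ : κ.form x ⁅y, z⁆ = κ.form ⁅x, y⁆ z := by
          rw [← lie_skew x y, LinearMap.BilinForm.neg_left, κ.invariant y x z, neg_neg]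
        have e₂ : κ.form y ⁅x, z⁆ = - κ.form ⁅x, y⁆ z := by
          rw [κ.invariant x y z, neg_neg]
        rw [e₁, e₂, residueForm_cyclic]
        ring

open LieModule in
/-- The form `cocycleForm κ` as a `2`-cocycle of the loop algebra with values in `ℂ`. -/
def cocycle (κ : InvariantForm 𝔤) :
    Cohomology.twoCocycle ℂ (Loop 𝔤) (TrivialLieModule ℂ (Loop 𝔤) ℂ) :=
  ⟨⟨(cocycleForm κ).compr₂ (TrivialLieModule.equiv ℂ (Loop 𝔤) ℂ).symm.toLinearMap, by
      rw [Cohomology.mem_twoCochain_iff]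
      intro a
      have h : cocycleForm κ a a = 0 := by
        have := cocycleForm_skew κ a a
        linear_combination this / 2
      simp [h]⟩, by
    rw [Cohomology.mem_twoCocycle_iff_of_trivial]
    intro a b c
    exact cocycleForm_cocycle κ a b c⟩

/-- The affine Kac-Moody algebra `𝔤̂_κ`: the central extension of the loop algebra `𝔤 ⊗ ℂ((t))`
by `ℂ 𝟏`, given by the cocycle `-κ(x, y) Res f dg`. -/
abbrev Affine (κ : InvariantForm 𝔤) : Type u := LieAlgebra.ofTwoCocycle (cocycle κ)

/-- The element `a + s 𝟏` of `𝔤̂_κ`. -/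
def Affine.mk (κ : InvariantForm 𝔤) (a : Loop 𝔤) (s : ℂ) : Affine κ :=
  LieAlgebra.ofProd (cocycle κ) (a, (TrivialLieModule.equiv ℂ (Loop 𝔤) ℂ).symm s)

lemma Affine.mk_lie_mk (κ : InvariantForm 𝔤) (a b : Loop 𝔤) (s r : ℂ) :
    ⁅Affine.mk κ a s, Affine.mk κ b r⁆ = Affine.mk κ ⁅a, b⁆ (cocycleForm κ a b) := by
  simp only [Affine.mk, LieAlgebra.bracket_ofTwoCocycle, Equiv.symm_apply_apply, trivial_lie_zero,
    add_zero, sub_zero]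
  rfl

/-- The central element `𝟏`. -/
def Affine.one (κ : InvariantForm 𝔤) : Affine κ := Affine.mk κ 0 1

/-- The inclusion of `𝔤 ⊗ ℂ[[t]]` into the loop algebra. -/
def arcToLoop : Arc 𝔤 →ₗ[ℂ] Loop 𝔤 :=
  LinearMap.rTensor 𝔤 Laurent.ofPowerSeries.toLinearMap

/-- The inclusion of `𝔤 ⊗ ℂ[[t]]` into `𝔤̂_κ`. -/
def Affine.ofArc (κ : InvariantForm 𝔤) (ξ : Arc 𝔤) : Affine κ := Affine.mk κ (arcToLoop ξ) 0

/-! ### The vacuum Weyl module -/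

/-- The left ideal of `U(𝔤̂_κ)` generated by `𝔤 ⊗ ℂ[[t]]` and `𝟏 - 1`. -/
def vacuumIdeal (κ : InvariantForm 𝔤) :
    Submodule (UniversalEnvelopingAlgebra ℂ (Affine κ)) (UniversalEnvelopingAlgebra ℂ (Affine κ)) :=
  Submodule.span _
    (Set.range (fun ξ : Arc 𝔤 => UniversalEnvelopingAlgebra.ι ℂ (Affine.ofArc κ ξ)) ∪
      {UniversalEnvelopingAlgebra.ι ℂ (Affine.one κ) - 1})

/-- The vacuum Weyl module: the `𝔤̂_κ`-module induced from the one-dimensional module of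
`𝔤 ⊗ ℂ[[t]] ⊕ ℂ 𝟏` on which `𝔤 ⊗ ℂ[[t]]` acts by zero and `𝟏` acts as the identity.
It is the quotient of `U(𝔤̂_κ)` by the left ideal generated by the kernel of that character. -/
def VacuumWeyl (κ : InvariantForm 𝔤) : Type u :=
  UniversalEnvelopingAlgebra ℂ (Affine κ) ⧸ vacuumIdeal κ

instance (κ : InvariantForm 𝔤) : AddCommGroup (VacuumWeyl κ) :=
  inferInstanceAs (AddCommGroup (UniversalEnvelopingAlgebra ℂ (Affine κ) ⧸ vacuumIdeal κ))

instance (κ : InvariantForm 𝔤) : Module (UniversalEnvelopingAlgebra ℂ (Affine κ)) (VacuumWeyl κ) :=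
  inferInstanceAs (Module (UniversalEnvelopingAlgebra ℂ (Affine κ))
    (UniversalEnvelopingAlgebra ℂ (Affine κ) ⧸ vacuumIdeal κ))

instance (κ : InvariantForm 𝔤) : Module ℂ (VacuumWeyl κ) :=
  inferInstanceAs (Module ℂ (UniversalEnvelopingAlgebra ℂ (Affine κ) ⧸ vacuumIdeal κ))

instance (κ : InvariantForm 𝔤) :
    IsScalarTower ℂ (UniversalEnvelopingAlgebra ℂ (Affine κ)) (VacuumWeyl κ) :=
  inferInstanceAs (IsScalarTower ℂ (UniversalEnvelopingAlgebra ℂ (Affine κ))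
    (UniversalEnvelopingAlgebra ℂ (Affine κ) ⧸ vacuumIdeal κ))

instance (κ : InvariantForm 𝔤) : LieRingModule (Affine κ) (VacuumWeyl κ) where
  bracket a m := UniversalEnvelopingAlgebra.ι ℂ a • m
  add_lie a b m := by rw [map_add, add_smul]
  lie_add a m n := smul_add _ m n
  leibniz_lie a b m := by
    let := LieRing.ofAssociativeRing (A := UniversalEnvelopingAlgebra ℂ (Affine κ))
    rw [(UniversalEnvelopingAlgebra.ι ℂ).map_lie a b, LieRing.of_associative_ring_bracket,
      sub_smul, mul_smul, mul_smul, sub_add_cancel]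

instance (κ : InvariantForm 𝔤) : LieModule ℂ (Affine κ) (VacuumWeyl κ) where
  smul_lie c a m := by
    change UniversalEnvelopingAlgebra.ι ℂ (c • a) • m = c • (UniversalEnvelopingAlgebra.ι ℂ a • m)
    rw [map_smul, smul_assoc]
  lie_smul c a m := by
    change UniversalEnvelopingAlgebra.ι ℂ a • (c • m) = c • (UniversalEnvelopingAlgebra.ι ℂ a • m)
    rw [← algebraMap_smul (UniversalEnvelopingAlgebra ℂ (Affine κ)) c m, smul_smul,
      ← Algebra.commutes, mul_smul, algebraMap_smul]

end Affine

/-! ### The adjoint group and its group of arcs -/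

/-- The group of inner automorphisms of a Lie algebra `L` over a field `K` (of characteristic
zero): the group generated by all `exp (ad x)` with `ad x` nilpotent. For `K` algebraically closed
and `L` semisimple it is the group of `K`-points of the identity component of `Aut L`. -/
def innerAut (K : Type v) (L : Type u) [Field K] [LieRing L] [LieAlgebra K L] :
    Subgroup (L ≃ₗ[K] L) :=
  Subgroup.closure {ψ | ∃ (x : L) (n : ℕ), LieAlgebra.ad K L x ^ n = 0 ∧
    ∀ y, ψ y = ∑ i ∈ Finset.range n, ((i.factorial : K)⁻¹) • (LieAlgebra.ad K L x ^ i) y}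

/-- `ψ` is the base change of `φ` along `f : A → B`. -/
def IsBaseChangeAlong {A B : Type} [CommRing A] [Algebra ℂ A] [CommRing B] [Algebra ℂ B]
    {V : Type u} [AddCommGroup V] [Module ℂ V] (f : A →ₐ[ℂ] B)
    (φ : A ⊗[ℂ] V →ₗ[A] A ⊗[ℂ] V) (ψ : B ⊗[ℂ] V →ₗ[B] B ⊗[ℂ] V) : Prop :=
  ∀ z, LinearMap.rTensor V f.toLinearMap (φ z) = ψ (LinearMap.rTensor V f.toLinearMap z)

section Group

variable (𝔤 : Type u) [LieRing 𝔤] [LieAlgebra ℂ 𝔤]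

/-- The group `G(A)` of `A`-points of the algebraic group `G` of adjoint type with Lie algebra `𝔤`,
that is, of the identity component `G = Aut(𝔤)⁰` of the algebraic group of automorphisms of `𝔤`.
A point of `Aut(𝔤)` over `A` is an `A`-linear automorphism of the Lie algebra `𝔤 ⊗ A`, and it
lies in the open and closed subgroup `Aut(𝔤)⁰` if and only if all its geometric points do. -/
def adjointGroup (A : Type) [CommRing A] [Algebra ℂ A] :
    Subgroup ((A ⊗[ℂ] 𝔤) ≃ₗ[A] (A ⊗[ℂ] 𝔤)) where
  carrier := {φ | (∀ x y, φ ⁅x, y⁆ = ⁅φ x, φ y⁆) ∧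
    ∀ (K : Type) [Field K] [IsAlgClosed K] [Algebra ℂ K] (f : A →ₐ[ℂ] K),
      ∃ ψ ∈ innerAut K (K ⊗[ℂ] 𝔤), IsBaseChangeAlong f φ.toLinearMap ψ.toLinearMap}
  one_mem' := ⟨fun _ _ => rfl, fun _ _ _ _ _ => ⟨1, one_mem _, fun _ => rfl⟩⟩
  mul_mem' := by
    rintro φ φ' ⟨h, hb⟩ ⟨h', hb'⟩
    refine ⟨fun x y => ?_, fun K _ _ _ f => ?_⟩
    · simp only [LinearEquiv.mul_apply, h', h]
    · obtain ⟨ψ, hψ, hc⟩ := hb K f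
      obtain ⟨ψ', hψ', hc'⟩ := hb' K f
      refine ⟨ψ * ψ', mul_mem hψ hψ', fun z => ?_⟩
      exact (hc (φ' z)).trans (congrArg ψ (hc' z))
  inv_mem' := by
    rintro φ ⟨h, hb⟩
    refine ⟨fun x y => ?_, fun K _ _ _ f => ?_⟩
    · apply φ.injective
      rw [h]
      change φ (φ.symm _) = ⁅φ (φ.symm _), φ (φ.symm _)⁆
      simp only [LinearEquiv.apply_symm_apply]
    · obtain ⟨ψ, hψ, hc⟩ := hb K f
      refine ⟨ψ⁻¹, inv_mem hψ, fun z => ?_⟩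
      apply ψ.injective
      have h1 := hc (φ.symm z)
      change LinearMap.rTensor 𝔤 f.toLinearMap (φ (φ.symm z)) = _ at h1
      rw [LinearEquiv.apply_symm_apply] at h1
      change ψ (LinearMap.rTensor 𝔤 f.toLinearMap (φ.symm z)) =
        ψ (ψ.symm (LinearMap.rTensor 𝔤 f.toLinearMap z))
      rw [LinearEquiv.apply_symm_apply]
      exact h1.symm

/-- The group of `R`-points of the arc group scheme `G(ℂ[[t]])`, that is, `G(R[[t]])`. -/
abbrev arcGroup (R : Type) [CommRing R] [Algebra ℂ R] :
    Subgroup ((R⟦X⟧ ⊗[ℂ] 𝔤) ≃ₗ[R⟦X⟧] (R⟦X⟧ ⊗[ℂ] 𝔤)) :=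
  adjointGroup 𝔤 R⟦X⟧

/-- An (algebraic) action of the group scheme `G(ℂ[[t]])` on a complex vector space `M`:
an `R`-linear action of `G(R[[t]])` on `R ⊗ M` for each commutative `ℂ`-algebra `R`, natural
in `R`. -/
structure ArcGroupAction (M : Type v) [AddCommGroup M] [Module ℂ M] where
  act : ∀ (R : Type) [CommRing R] [Algebra ℂ R], arcGroup 𝔤 R →* Module.End R (R ⊗[ℂ] M)
  natural : ∀ {R S : Type} [CommRing R] [Algebra ℂ R] [CommRing S] [Algebra ℂ S]
    (f : R →ₐ[ℂ] S) (γ : arcGroup 𝔤 R) (δ : arcGroup 𝔤 S),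
    IsBaseChangeAlong (PowerSeries.mapAlgHom f) γ.1.toLinearMap δ.1.toLinearMap →
      IsBaseChangeAlong f (act R γ) (act S δ)

end Group

section Modules

variable {𝔤 : Type u} [LieRing 𝔤] [LieAlgebra ℂ 𝔤]

/-- The point `γ` of `G(ℂ[ε][[t]])` is `1 + ε ad ξ`, the tangent vector `ξ ∈ 𝔤 ⊗ ℂ[[t]]` at the
identity. -/
def IsTangentPoint (ξ : Arc 𝔤) (γ : arcGroup 𝔤 ℂ[ε]) : Prop :=
  ∀ y : ℂ[ε]⟦X⟧ ⊗[ℂ] 𝔤, γ.1 y = y + (PowerSeries.C DualNumber.eps : ℂ[ε]⟦X⟧) •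
    ⁅LinearMap.rTensor 𝔤 (PowerSeries.mapAlgHom (Algebra.ofId ℂ ℂ[ε])).toLinearMap ξ, y⁆

/-- The objects of the category of `G(ℂ[[t]])`-integrable `𝔤̂_κ`-modules. -/
structure IsIntegrable (κ : InvariantForm 𝔤) (M : Type v) [AddCommGroup M] [Module ℂ M]
    [LieRingModule (Affine κ) M] [LieModule ℂ (Affine κ) M] : Prop where
  /-- `𝟏` acts as the identity. -/
  one_lie : ∀ m : M, ⁅Affine.one κ, m⁆ = m
  /-- `M` is discrete: each vector is annihilated by `𝔤 ⊗ t ^ N ℂ[[t]]` for some `N`. -/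
  discrete : ∀ m : M, ∃ N : ℕ, ∀ ξ : Arc 𝔤,
    ⁅Affine.ofArc κ ((PowerSeries.X ^ N : ℂ⟦X⟧) • ξ), m⁆ = 0
  /-- The action of `𝔤 ⊗ ℂ[[t]]` is the differential of an action of the group `G(ℂ[[t]])`. -/
  exponentiates : ∃ a : ArcGroupAction 𝔤 M,
    ∀ (ξ : Arc 𝔤) (γ : arcGroup 𝔤 ℂ[ε]), IsTangentPoint ξ γ →
      ∀ m : M, a.act ℂ[ε] γ (1 ⊗ₜ m) =
        1 ⊗ₜ m + (DualNumber.eps : ℂ[ε]) ⊗ₜ ⁅Affine.ofArc κ ξ, m⁆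

/-- `P` is a projective object of the category of `G(ℂ[[t]])`-integrable `𝔤̂_κ`-modules (a full
subcategory of that of `𝔤̂_κ`-modules): it belongs to the category, and morphisms from `P` lift
along all surjective morphisms of the category. -/
def IsProjectiveObject (κ : InvariantForm 𝔤) (P : Type v) [AddCommGroup P] [Module ℂ P]
    [LieRingModule (Affine κ) P] [LieModule ℂ (Affine κ) P] : Prop :=
  IsIntegrable κ P ∧
  ∀ (M N : Type w) [AddCommGroup M] [Module ℂ M] [LieRingModule (Affine κ) M]
    [LieModule ℂ (Affine κ) M] [AddCommGroup N] [Module ℂ N] [LieRingModule (Affine κ) N]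
    [LieModule ℂ (Affine κ) N], IsIntegrable κ M → IsIntegrable κ N →
    ∀ p : M →ₗ⁅ℂ, Affine κ⁆ N, Function.Surjective p →
      ∀ f : P →ₗ⁅ℂ, Affine κ⁆ N, ∃ h : P →ₗ⁅ℂ, Affine κ⁆ M, p.comp h = f

end Modules

end AffineKM

end

/-! Lifting. By the universal property (`exists_vacuumWeyl_lift`), a morphism out of the vacuum
module amounts to a vector killed by `𝔤 ⊗ ℂ[[t]]`. It must be shown that such a vector `u` of `N`
lifts along `p` to such a vector of `M` (`ModeRep.exists_vacuum_lift`). The tool is the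
Segal-Sugawara operator `T`. It commutes with morphisms, satisfies `[T, x t^n] = -2n(c + 1/2) x t^n`
for `n ≥ 0`, and is the Casimir operator of `𝔤` on vectors killed by `𝔤 ⊗ tℂ[[t]]`. Casimir
eigenvalues on finite-dimensional modules are nonnegative rationals (`casimir_eigenvalue`), so the
generalized eigenvalues of `T` on an integrable module have the form `r + 2j(c + 1/2)` with `r ≥ 0`
rational and `j` natural (`ModeRep.isGood_of_locallyNilpotent`). Since `T u = 0`, any lift of `u`
may be replaced by its component `v` in the generalized kernel of `T`. For `n ≥ 1`, `x t^n` sends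
`v` to the generalized eigenvalue `-2n(c + 1/2)`, which at a positive or irrational level is not of
the above form (`level_condition`). Hence `v` is killed by `𝔤 ⊗ tℂ[[t]]`, and the Casimir operator
is nilpotent on a finite-dimensional `𝔤`-stable space containing `v`. This forces `𝔤` to act by zero
there (`lie_eq_zero_of_casimir_nilpotent`). Of the group action on `M` only one consequence is used:
`x t^k` acts locally nilpotently when `ad x` is nilpotent (`locallyNilpotent_of_isIntegrable`),
because the orbit of a vector under a one-parameter unipotent group is polynomial in the parameter.
Such `x` span `𝔤` (`exists_basis_adNilpotent`), and local finiteness follows by counting letters in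
words.

Integrability of the vacuum module. A point `γ` of `G(R[[t]])` acts on `𝔤 ⊗ R((t))` and changes the
cocycle by the coboundary of a functional (`loopCocycle_loopAut`) that vanishes on power series
(`anomaly_eq_zero`). Twisting the action on `R ⊗ V` by `γ` and this functional preserves both the
commutation relations and the vacuum conditions, so the universal property yields the operator of
`γ`. The group law, naturality and the differential all follow from uniqueness: of the orbit map
(`orbit_unique`), and of the functional, which its coboundary determines because the loop algebra is
perfect (`anomaly_unique`). -/

set_option linter.unusedSectionVars false
set_option linter.style.haveILetI false

noncomputable section

namespace AffineKM

open Module LieAlgebra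

/-! ### The Casimir tensor of the Killing form -/

section Casimir

variable {𝔤 : Type u} [LieRing 𝔤] [LieAlgebra ℂ 𝔤] [FiniteDimensional ℂ 𝔤] [IsKilling ℂ 𝔤]
  {ι : Type} [Fintype ι] [DecidableEq ι] (b : Basis ι ℂ 𝔤)

/-- The basis dual to `b` for the Killing form. -/
def killingDual : Basis ι ℂ 𝔤 :=
  (killingForm ℂ 𝔤).dualBasis (IsKilling.killingForm_nondegenerate ℂ 𝔤) b

omit [IsKilling ℂ 𝔤] [FiniteDimensional ℂ 𝔤] in
lemma killingForm_comm (x y : 𝔤) : killingForm ℂ 𝔤 x y = killingForm ℂ 𝔤 y x :=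
  LieModule.traceForm_comm ℂ 𝔤 𝔤 x y

omit [IsKilling ℂ 𝔤] [FiniteDimensional ℂ 𝔤] in
lemma killingForm_lie (x y z : 𝔤) : killingForm ℂ 𝔤 ⁅x, y⁆ z = killingForm ℂ 𝔤 x ⁅y, z⁆ :=
  LieModule.traceForm_apply_lie_apply ℂ 𝔤 𝔤 x y z

lemma killingForm_dual_left (i j : ι) :
    killingForm ℂ 𝔤 (killingDual b i) (b j) = if j = i then 1 else 0 :=
  LinearMap.BilinForm.apply_dualBasis_left _ b i j

lemma killingForm_dual_right (i j : ι) :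
    killingForm ℂ 𝔤 (b i) (killingDual b j) = if i = j then 1 else 0 := by
  rw [killingForm_comm, killingForm_dual_left]

lemma killingDual_repr (z : 𝔤) (j : ι) :
    (killingDual b).repr z j = killingForm ℂ 𝔤 z (b j) := by
  have h : killingForm ℂ 𝔤 (∑ i, (killingDual b).repr z i • killingDual b i) (b j)
      = (killingDual b).repr z j := by
    simp only [map_sum, map_smul, LinearMap.sum_apply, LinearMap.smul_apply, killingForm_dual_left]
    simp
  rwa [Basis.sum_repr, eq_comm] at h

lemma repr_eq_killingForm (z : 𝔤) (j : ι) :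
    b.repr z j = killingForm ℂ 𝔤 (killingDual b j) z := by
  have h : killingForm ℂ 𝔤 (killingDual b j) (∑ i, b.repr z i • b i) = b.repr z j := by
    simp only [map_sum, map_smul, killingForm_dual_left]
    simp
  rwa [Basis.sum_repr, eq_comm] at h

lemma eq_sum_killingDual (z : 𝔤) : z = ∑ j, killingForm ℂ 𝔤 z (b j) • killingDual b j := by
  conv_lhs => rw [← (killingDual b).sum_repr z]
  refine Finset.sum_congr rfl fun j _ => ?_
  rw [killingDual_repr]

lemma eq_sum_killing (z : 𝔤) : z = ∑ j, killingForm ℂ 𝔤 z (killingDual b j) • b j := by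
  conv_lhs => rw [← b.sum_repr z]
  refine Finset.sum_congr rfl fun j _ => ?_
  rw [repr_eq_killingForm, killingForm_comm]

variable {P : Type w} [AddCommGroup P] [Module ℂ P]

/-- Both sides expand into one double sum whose coefficients agree by invariance of the Killing
form. An arbitrary bilinear `F` lets the two tensor factors act through different modes. -/
lemma casimir_invariant (F : 𝔤 →ₗ[ℂ] 𝔤 →ₗ[ℂ] P) (y : 𝔤) :
    ∑ i, F (b i) ⁅killingDual b i, y⁆ = -∑ i, F ⁅b i, y⁆ (killingDual b i) := by
  have h1 : ∀ i, F (b i) ⁅killingDual b i, y⁆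
      = ∑ j, killingForm ℂ 𝔤 ⁅killingDual b i, y⁆ (b j) • F (b i) (killingDual b j) := by
    intro i
    conv_lhs => rw [eq_sum_killingDual b ⁅killingDual b i, y⁆]
    simp
  have h2 : ∀ j, F ⁅b j, y⁆ (killingDual b j)
      = ∑ i, killingForm ℂ 𝔤 ⁅b j, y⁆ (killingDual b i) • F (b i) (killingDual b j) := by
    intro j
    conv_lhs => rw [eq_sum_killing b ⁅b j, y⁆]
    simp
  simp_rw [h1, h2]
  rw [Finset.sum_comm, ← Finset.sum_neg_distrib]
  refine Finset.sum_congr rfl fun j _ => ?_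
  rw [← Finset.sum_neg_distrib]
  refine Finset.sum_congr rfl fun i _ => ?_
  rw [← neg_smul]
  congr 1
  rw [killingForm_lie, killingForm_comm, ← lie_skew, map_neg, LinearMap.neg_apply]

lemma casimir_symm (F : 𝔤 →ₗ[ℂ] 𝔤 →ₗ[ℂ] P) :
    ∑ i, F (b i) (killingDual b i) = ∑ i, F (killingDual b i) (b i) := by
  have h1 : ∀ i, F (b i) (killingDual b i)
      = ∑ j, killingForm ℂ 𝔤 (b i) (b j) • F (killingDual b j) (killingDual b i) := by
    intro i
    conv_lhs => rw [eq_sum_killingDual b (b i)]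
    simp
  have h2 : ∀ i, F (killingDual b i) (b i)
      = ∑ j, killingForm ℂ 𝔤 (b i) (b j) • F (killingDual b i) (killingDual b j) := by
    intro i
    conv_lhs => rw [eq_sum_killingDual b (b i)]
    simp
  simp_rw [h1, h2]
  rw [Finset.sum_comm]
  refine Finset.sum_congr rfl fun j _ => Finset.sum_congr rfl fun i _ => ?_
  rw [killingForm_comm]

/-- Pairing the left side with `z` computes the trace of `ad y ∘ ad z` in the basis `b`, which is
the Killing form again; nondegeneracy finishes. This normalization puts the critical level at `c =
-1/2`. -/
lemma casimir_adjoint (y : 𝔤) : ∑ i, ⁅b i, ⁅killingDual b i, y⁆⁆ = y := by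
  have hnd := IsKilling.killingForm_nondegenerate ℂ 𝔤
  have key : ∀ z, killingForm ℂ 𝔤 (∑ i, ⁅b i, ⁅killingDual b i, y⁆⁆) z
      = killingForm ℂ 𝔤 y z := by
    intro z
    rw [killingForm_apply_apply ℂ 𝔤 y z, LinearMap.trace_eq_matrix_trace ℂ b, Matrix.trace,
      map_sum, LinearMap.sum_apply]
    refine Finset.sum_congr rfl fun i _ => ?_
    simp only [Matrix.diag_apply, LinearMap.toMatrix_apply, LinearMap.comp_apply, ad_apply,
      repr_eq_killingForm]
    rw [← lie_skew (b i) ⁅killingDual b i, y⁆, map_neg, LinearMap.neg_apply, killingForm_lie,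
      killingForm_lie, ← lie_skew (b i) z, lie_neg, map_neg, neg_neg]
  have := hnd.1
  rw [← sub_eq_zero]
  apply this
  intro z
  rw [map_sub, LinearMap.sub_apply, key, sub_self]

end Casimir

/-! ### Simple Lie algebras are spanned by ad-nilpotent elements -/

section Nilpotent

/-- The automorphism `exp (ad f)` carries `e` to `e - h - f`, and automorphisms preserve
ad-nilpotency. The purpose is to place `h` in the span of ad-nilpotent elements. -/
lemma adNilpotent_exp {𝔤 : Type u} [LieRing 𝔤] [LieAlgebra ℂ 𝔤] {h e f : 𝔤}
    (t : IsSl2Triple h e f) (he : IsNilpotent (ad ℂ 𝔤 e)) (hf : IsNilpotent (ad ℂ 𝔤 f)) :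
    IsNilpotent (ad ℂ 𝔤 (e - h - f)) := by
  let _ : LieAlgebra ℚ 𝔤 := { toModule := Module.compHom 𝔤 (algebraMap ℚ ℂ), lie_smul := fun q x y => lie_smul (q : ℂ) x y }
  have hc : (LieDerivation.ad ℂ 𝔤 f).toLinearMap = ad ℂ 𝔤 f := by
    exact LieDerivation.coe_ad_apply_eq_ad_apply f
  have hD : IsNilpotent (LieDerivation.ad ℂ 𝔤 f).toLinearMap := by
    rw [hc]; exact hf
  let E := LieDerivation.exp (LieDerivation.ad ℂ 𝔤 f) hD
  have hE : E e = e - h - f := by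
    rw [LieDerivation.exp_map_apply]
    have h1 : ⁅f, e⁆ = -h := by rw [← lie_skew, t.lie_e_f]
    have h2 : ⁅f, h⁆ = (2 : ℂ) • f := by
      rw [← lie_skew, t.lie_lie_smul_f ℂ, neg_neg]
    obtain ⟨n, hn⟩ := hD
    -- The exponent is padded so that the exponential sum splits into three explicit terms and a
    -- tail killed by `(ad f)^3 e = 0`.
    have hn' : (LieDerivation.ad ℂ 𝔤 f).toLinearMap ^ (n + 3) = 0 := by rw [pow_add, hn, zero_mul]
    rw [IsNilpotent.exp_eq_sum hn', LinearMap.sum_apply]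
    have e1 : (LieDerivation.ad ℂ 𝔤 f).toLinearMap e = -h := by rw [hc]; exact h1
    have e2 : (LieDerivation.ad ℂ 𝔤 f).toLinearMap h = (2 : ℂ) • f := by rw [hc]; exact h2
    have e3 : (LieDerivation.ad ℂ 𝔤 f).toLinearMap f = 0 := by rw [hc]; exact lie_self f
    have p2 : ((LieDerivation.ad ℂ 𝔤 f).toLinearMap ^ 2) e = -((2 : ℂ) • f) := by
      rw [pow_two, Module.End.mul_apply, e1, map_neg, e2]
    have p3 : ∀ k, ((LieDerivation.ad ℂ 𝔤 f).toLinearMap ^ (k + 3)) e = 0 := by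
      intro k
      rw [pow_add, pow_succ' _ 2, Module.End.mul_apply, Module.End.mul_apply, p2, map_neg, map_smul,
        e3, smul_zero, neg_zero, map_zero]
    rw [add_comm n 3, Finset.sum_range_add]
    simp only [Finset.sum_range_succ, Finset.sum_range_zero, LinearMap.smul_apply, pow_zero,
      pow_one, p2, e1, add_comm 3, p3]
    simp only [Nat.factorial, Module.End.one_apply, smul_zero, Finset.sum_const_zero]
    have hq : ∀ (q : ℚ) (x : 𝔤), q • x = (q : ℂ) • x := fun _ _ => rfl
    simp only [hq]
    push_cast
    module
  rw [← hE, ← LieAlgebra.conj_ad_apply]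
  exact (he.map (LinearEquiv.conjRingEquiv E.toLinearEquiv))

variable (𝔤 : Type u) [LieRing 𝔤] [LieAlgebra ℂ 𝔤] [FiniteDimensional ℂ 𝔤] [IsKilling ℂ 𝔤]

/-- Root vectors are ad-nilpotent, coroots lie in the span by `adNilpotent_exp`, and coroots span
the Cartan subalgebra; the root space decomposition gives the rest. -/
lemma span_adNilpotent_eq_top :
    Submodule.span ℂ {x : 𝔤 | IsNilpotent (ad ℂ 𝔤 x)} = ⊤ := by
  obtain ⟨z, hz⟩ := LieAlgebra.exists_isCartanSubalgebra_engel ℂ 𝔤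
  set H := LieSubalgebra.engel ℂ z
  set S := Submodule.span ℂ {x : 𝔤 | IsNilpotent (ad ℂ 𝔤 x)}
  have hroot : ∀ α : LieModule.Weight ℂ H 𝔤, α.IsNonZero → ∀ x ∈ rootSpace H α, x ∈ S :=
    fun α hα x hx => Submodule.subset_span
      (LieAlgebra.isNilpotent_ad_of_mem_rootSpace H (fun h => hα h) hx)
  have hcor : ∀ α : LieModule.Weight ℂ H 𝔤, α.IsNonZero → (IsKilling.coroot α : 𝔤) ∈ S := by
    intro α hα
    obtain ⟨h, e, f, t, he, hf⟩ := IsKilling.exists_isSl2Triple_of_weight_isNonZero hα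
    have hne : (⇑α : H → ℂ) ≠ 0 := fun h => hα h
    have he' := LieAlgebra.isNilpotent_ad_of_mem_rootSpace H hne he
    have hf' := LieAlgebra.isNilpotent_ad_of_mem_rootSpace H (neg_ne_zero.mpr hne) hf
    rw [← t.h_eq_coroot hα he hf]
    have h3 : e - h - f ∈ S := Submodule.subset_span (adNilpotent_exp t he' hf')
    have h1 : e ∈ S := Submodule.subset_span he'
    have h2 : f ∈ S := Submodule.subset_span hf'
    have : h = e - f - (e - h - f) := by abel
    rw [this]
    exact S.sub_mem (S.sub_mem h1 h2) h3
  have hH : ∀ x ∈ H, x ∈ S := by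
    intro x hx
    have hle : (H.toLieSubmodule : Submodule ℂ 𝔤) ≤ S := by
      rw [← IsKilling.biSup_corootSubmodule_eq_cartan H]
      simp only [LieSubmodule.iSup_toSubmodule, iSup_le_iff]
      intro α hα y hy
      obtain ⟨y', hy', rfl⟩ := (LieSubmodule.mem_map _).mp hy
      have hy'' : ∀ z : H, z ∈ corootSpace α → (z : 𝔤) ∈ S := by
        intro z hz'
        rw [← LieSubmodule.mem_toSubmodule, IsKilling.coe_corootSpace_eq_span_singleton] at hz'
        obtain ⟨a, rfl⟩ := Submodule.mem_span_singleton.mp hz'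
        exact S.smul_mem a (hcor α hα)
      exact hy'' y' hy'
    exact hle hx
  rw [eq_top_iff]
  have htop := LieModule.iSup_genWeightSpace_eq_top' ℂ H 𝔤
  rw [← LieSubmodule.toSubmodule_inj, LieSubmodule.iSup_toSubmodule,
    LieSubmodule.top_toSubmodule] at htop
  rw [← htop, iSup_le_iff]
  intro α x hx
  by_cases hα : α.IsZero
  · apply hH
    have : x ∈ rootSpace H (0 : H → ℂ) := by rw [← show (⇑α : H → ℂ) = 0 from hα]; exact hx
    rw [LieAlgebra.rootSpace_zero_eq] at this
    exact this
  · exact hroot α hα x hx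

lemma exists_basis_adNilpotent :
    ∃ (n : ℕ) (b : Basis (Fin n) ℂ 𝔤), ∀ i, IsNilpotent (ad ℂ 𝔤 (b i)) := by
  obtain ⟨s, hs, hspan, hli⟩ :=
    exists_linearIndependent ℂ {x : 𝔤 | IsNilpotent (ad ℂ 𝔤 x)}
  have htop : ⊤ ≤ Submodule.span ℂ (Set.range ((↑) : s → 𝔤)) := by
    rw [Subtype.range_coe, hspan, span_adNilpotent_eq_top]
  let B : Basis s ℂ 𝔤 := Basis.mk hli htop
  have : Finite s := Module.Finite.finite_basis B
  obtain ⟨n, ⟨e⟩⟩ := Finite.exists_equiv_fin s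
  refine ⟨n, B.reindex e, fun i => ?_⟩
  rw [Basis.reindex_apply, Basis.mk_apply]
  exact hs (e.symm i).2

end Nilpotent

/-! ### The Casimir operator on finite-dimensional modules -/

section FiniteDimensionalModules

lemma hasEigenvalue_of_maxGenEigenspace_ne_bot {W : Type w} [AddCommGroup W] [Module ℂ W]
    (f : End ℂ W) (μ : ℂ) (h : f.maxGenEigenspace μ ≠ ⊥) : f.HasEigenvalue μ := by
  rw [End.hasEigenvalue_iff]
  intro h0
  apply h
  rw [Submodule.eq_bot_iff]
  intro x hx
  obtain ⟨k, hk⟩ := End.mem_maxGenEigenspace f μ x |>.mp hx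
  have hinj : Function.Injective (f - μ • (1 : End ℂ W)) := by
    rw [← LinearMap.ker_eq_bot, ← End.eigenspace_def, h0]
  have : Function.Injective ((f - μ • (1 : End ℂ W)) ^ k) := by
    rw [End.coe_pow]; exact hinj.iterate k
  exact this (by rw [hk, map_zero])

lemma isNilpotent_of_eigenvalues_eq_zero {W : Type w} [AddCommGroup W] [Module ℂ W]
    [FiniteDimensional ℂ W] (f : End ℂ W) (hf : ∀ μ, f.HasEigenvalue μ → μ = 0) :
    IsNilpotent f := by
  have htop : f.maxGenEigenspace 0 = ⊤ := by
    rw [eq_top_iff, ← f.iSup_maxGenEigenspace_eq_top]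
    refine iSup_le fun μ => ?_
    by_cases h : f.maxGenEigenspace μ = ⊥
    · rw [h]; exact bot_le
    · rw [hf μ (hasEigenvalue_of_maxGenEigenspace_ne_bot f μ h)]
  refine ⟨End.maxGenEigenspaceIndex f 0, ?_⟩
  ext x
  have hx : x ∈ f.maxGenEigenspace 0 := htop ▸ Submodule.mem_top
  rw [End.maxGenEigenspace_eq, End.mem_genEigenspace_nat, zero_smul, sub_zero,
    LinearMap.mem_ker] at hx
  exact hx

/-- On the generalized eigenspace of `μ`, with `N = f - μ`, one has `f² = μ² + N(N + 2μ)`, so the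
trace of `f²` is the sum of `μ²` times the dimensions. For integral `μ` all terms are natural
numbers, and the sum vanishes only if each term does. -/
lemma trace_sq_of_integral_eigenvalues {W : Type w} [AddCommGroup W] [Module ℂ W]
    [FiniteDimensional ℂ W] (f : End ℂ W) (hf : ∀ μ, f.HasEigenvalue μ → ∃ n : ℤ, μ = n) :
    ∃ n : ℕ, LinearMap.trace ℂ W (f * f) = n ∧ (n = 0 → ∀ μ, f.HasEigenvalue μ → μ = 0) := by
  classical
  have hint : DirectSum.IsInternal f.maxGenEigenspace :=
    DirectSum.isInternal_submodule_of_iSupIndep_of_iSup_eq_top f.independent_maxGenEigenspace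
      f.iSup_maxGenEigenspace_eq_top
  have hfin : {μ | f.maxGenEigenspace μ ≠ ⊥}.Finite :=
    WellFoundedGT.finite_ne_bot_of_iSupIndep f.independent_maxGenEigenspace
  have hmaps : ∀ μ, Set.MapsTo (f * f) (f.maxGenEigenspace μ) (f.maxGenEigenspace μ) :=
    fun μ => f.mapsTo_maxGenEigenspace_of_comm (Commute.refl f |>.mul_right (Commute.refl f)) μ
  have hmap1 : ∀ μ, Set.MapsTo f (f.maxGenEigenspace μ) (f.maxGenEigenspace μ) :=
    fun μ => f.mapsTo_maxGenEigenspace_of_comm (Commute.refl f) μ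
  have hmap2 : ∀ μ, Set.MapsTo (f - algebraMap ℂ (End ℂ W) μ) (f.maxGenEigenspace μ)
      (f.maxGenEigenspace μ) := fun μ => f.mapsTo_maxGenEigenspace_of_comm
        ((Commute.refl f).sub_right (Algebra.commutes μ f).symm) μ
  have hev : ∀ μ, f.maxGenEigenspace μ ≠ ⊥ → f.HasEigenvalue μ := fun μ =>
    hasEigenvalue_of_maxGenEigenspace_ne_bot f μ
  have htr : ∀ μ, LinearMap.trace ℂ _ ((f * f).restrict (hmaps μ))
      = μ ^ 2 * finrank ℂ (f.maxGenEigenspace μ) := by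
    intro μ
    have hn := f.isNilpotent_restrict_maxGenEigenspace_sub_algebraMap μ
    set N : End ℂ (f.maxGenEigenspace μ) :=
      (f - algebraMap ℂ (End ℂ W) μ).restrict (hmap2 μ) with hN
    have hNn : IsNilpotent N := hn
    have e : (f * f).restrict (hmaps μ) = μ ^ 2 • (1 : End ℂ (f.maxGenEigenspace μ))
        + N * (N + (2 * μ) • 1) := by
      ext x
      have h1 : ∀ y, ((N y : f.maxGenEigenspace μ) : W) = f y - μ • (y : W) := fun y => rfl
      simp only [LinearMap.add_apply, LinearMap.smul_apply, End.mul_apply, End.one_apply,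
        Submodule.coe_add, Submodule.coe_smul, map_add, map_smul, h1, map_sub]
      change f (f x) = _
      module
    have hnil : IsNilpotent (N * (N + (2 * μ) • 1)) :=
      Commute.isNilpotent_mul_right ((Commute.refl N).add_right
        ((Commute.one_right N).smul_right _)) hNn
    rw [e, map_add, map_smul, LinearMap.trace_one,
      (LinearMap.isNilpotent_trace_of_isNilpotent hnil).eq_zero, smul_eq_mul, add_zero]
  choose! k hk using hf
  refine ⟨∑ μ ∈ hfin.toFinset, (k μ).natAbs ^ 2 * finrank ℂ (f.maxGenEigenspace μ), ?_, ?_⟩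
  · rw [LinearMap.trace_eq_sum_trace_restrict' hint hfin hmaps, Nat.cast_sum]
    refine Finset.sum_congr rfl fun μ hμ => ?_
    rw [htr]
    rw [Set.Finite.mem_toFinset] at hμ
    have h1 := hk μ (hev μ hμ)
    push_cast
    congr 1
    have h2 : ((k μ).natAbs : ℂ) ^ 2 = ((k μ : ℤ) : ℂ) ^ 2 := by
      rw [← Int.cast_natCast (R := ℂ) (k μ).natAbs, ← Int.cast_pow, Int.natAbs_sq, Int.cast_pow]
    rw [h2, ← h1]
  · intro h0 μ hμ
    have hne : f.maxGenEigenspace μ ≠ ⊥ := by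
      intro hb
      obtain ⟨x, hx, hx0⟩ := hμ.exists_hasEigenvector
      apply hx0
      have : x ∈ f.maxGenEigenspace μ := by
        rw [End.mem_maxGenEigenspace]
        refine ⟨1, ?_⟩
        rw [pow_one, LinearMap.sub_apply, End.mem_eigenspace_iff.mp hx]
        simp
      rwa [hb, Submodule.mem_bot] at this
    have := (Finset.sum_eq_zero_iff.mp h0) μ (by simpa using hne)
    rw [mul_eq_zero] at this
    rcases this with h | h
    · rw [hk μ hμ]
      simpa using h
    · exact absurd (Submodule.finrank_eq_zero.mp h) hne

variable {𝔤 : Type u} [LieRing 𝔤] [LieAlgebra ℂ 𝔤]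
  {W : Type w} [AddCommGroup W] [Module ℂ W] [LieRingModule 𝔤 W] [LieModule ℂ 𝔤 W]

/-- Applying `e` raises the eigenvalue by `2`, and only finitely many eigenvalues exist. The last
nonzero raised vector is primitive, so its weight `μ + 2n` is a natural number. -/
lemma sl2_eigenvalue_integral [FiniteDimensional ℂ W] {h e f : 𝔤} (t : IsSl2Triple h e f)
    (μ : ℂ) (hμ : (LieModule.toEnd ℂ 𝔤 W h).HasEigenvalue μ) : ∃ n : ℤ, μ = n := by
  obtain ⟨m, hm⟩ := hμ.exists_hasEigenvector
  have hm1 : ⁅h, m⁆ = μ • m := hm.apply_eq_smul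
  have hex : ∃ n : ℕ, ((LieModule.toEnd ℂ 𝔤 W e) ^ n) m = 0 := by
    by_contra! contra
    have hs : (Set.range fun n : ℕ => μ + 2 * (n : ℂ)).Infinite := by
      rw [Set.infinite_range_iff (fun n m => by simp)]; infer_instance
    refine hs (Set.Finite.subset (End.finite_hasEigenvalue (LieModule.toEnd ℂ 𝔤 W h)) ?_)
    rintro _ ⟨n, rfl⟩
    exact End.hasEigenvalue_of_hasEigenvector
      (End.hasEigenvector_iff.mpr ⟨End.mem_eigenspace_iff.mpr (t.lie_h_pow_toEnd_e hm1 n),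
        contra n⟩)
  obtain ⟨n, hn₁, hn₂⟩ := Nat.exists_not_and_succ_of_not_zero_of_exists
    (p := fun n => ((LieModule.toEnd ℂ 𝔤 W e) ^ n) m = 0) hm.2 hex
  have P : t.HasPrimitiveVectorWith (((LieModule.toEnd ℂ 𝔤 W e) ^ n) m) (μ + 2 * n) :=
    ⟨hn₁, t.lie_h_pow_toEnd_e hm1 n, by rw [IsSl2Triple.lie_e_pow_toEnd_e, hn₂]⟩
  obtain ⟨k, hk⟩ := P.exists_nat
  refine ⟨k - 2 * n, ?_⟩
  push_cast
  rw [← hk]; ring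

variable [FiniteDimensional ℂ 𝔤] [IsSimple ℂ 𝔤] {ι : Type} [Fintype ι] [DecidableEq ι]
  (b : Basis ι ℂ 𝔤)

/-- A nonzero root supplies a triple; without roots the Cartan subalgebra would be all of `𝔤`,
making `𝔤` abelian. -/
lemma exists_sl2Triple (𝔤 : Type u) [LieRing 𝔤] [LieAlgebra ℂ 𝔤] [FiniteDimensional ℂ 𝔤]
    [IsSimple ℂ 𝔤] : ∃ h e f : 𝔤, IsSl2Triple h e f := by
  obtain ⟨z, hz⟩ := LieAlgebra.exists_isCartanSubalgebra_engel ℂ 𝔤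
  set H := LieSubalgebra.engel ℂ z
  by_contra hno
  have hzero : ∀ α : LieModule.Weight ℂ H 𝔤, α.IsZero := by
    intro α
    by_contra hα
    obtain ⟨h, e, f, t, -⟩ := IsKilling.exists_isSl2Triple_of_weight_isNonZero hα
    exact hno ⟨h, e, f, t⟩
  have htop := LieModule.iSup_genWeightSpace_eq_top' ℂ H 𝔤
  have hH : ∀ x : 𝔤, x ∈ H := by
    intro x
    have hx : x ∈ (⊤ : LieSubmodule ℂ H 𝔤) := LieSubmodule.mem_top x
    rw [← htop] at hx
    have hle : ⨆ χ : LieModule.Weight ℂ H 𝔤, LieModule.genWeightSpace 𝔤 χ ≤ H.toLieSubmodule := by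
      refine iSup_le fun α y hy => ?_
      have : y ∈ rootSpace H (0 : H → ℂ) := by
        rw [← show (⇑α : H → ℂ) = 0 from hzero α]; exact hy
      rwa [LieAlgebra.rootSpace_zero_eq] at this
    exact hle hx
  apply IsSimple.non_abelian (R := ℂ) (L := 𝔤)
  refine ⟨fun x y => ?_⟩
  have := trivial_lie_zero H H ⟨x, hH x⟩ ⟨y, hH y⟩
  exact congrArg Subtype.val this

/-- Schur's lemma for forms: `φ` represents the trace form relative to the Killing form, and for an
eigenvalue `μ` of `φ` the elements on which the two forms are proportional with factor `μ` form a
nonzero ideal. -/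
lemma traceForm_eq_smul_killingForm [FiniteDimensional ℂ W] :
    ∃ μ : ℂ, ∀ x y : 𝔤, LieModule.traceForm ℂ 𝔤 W x y = μ * killingForm ℂ 𝔤 x y := by
  set b := Module.finBasis ℂ 𝔤
  have : Nontrivial 𝔤 := by
    rw [← not_subsingleton_iff_nontrivial]
    intro hs
    exact IsSimple.non_abelian (R := ℂ) (L := 𝔤) ⟨fun x y => Subsingleton.elim _ _⟩
  let φ : End ℂ 𝔤 := ∑ i, (LieModule.traceForm ℂ 𝔤 W (b i)).smulRight (killingDual b i)
  have hφ : ∀ x y, killingForm ℂ 𝔤 (φ x) y = LieModule.traceForm ℂ 𝔤 W x y := by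
    intro x y
    conv_rhs => rw [← b.sum_repr y]
    simp only [φ, LinearMap.sum_apply, LinearMap.smulRight_apply, map_sum, map_smul,
      LinearMap.smul_apply, ← repr_eq_killingForm, smul_eq_mul]
    refine Finset.sum_congr rfl fun i _ => ?_
    rw [LieModule.traceForm_comm, mul_comm]
  obtain ⟨μ, hμ⟩ := End.exists_eigenvalue φ
  obtain ⟨x₀, hx₀⟩ := hμ.exists_hasEigenvector
  let I : LieIdeal ℂ 𝔤 :=
    { carrier := {x | ∀ y, LieModule.traceForm ℂ 𝔤 W x y = μ * killingForm ℂ 𝔤 x y}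
      add_mem' := by
        intro x x' hx hx' y
        rw [map_add, LinearMap.add_apply, hx, hx', map_add, LinearMap.add_apply, mul_add]
      zero_mem' := by intro y; simp
      smul_mem' := by
        intro c x hx y
        rw [map_smul, LinearMap.smul_apply, hx, map_smul, LinearMap.smul_apply, smul_eq_mul,
          smul_eq_mul]
        ring
      lie_mem := by
        intro z x hx y
        rw [← lie_skew, map_neg, map_neg, LinearMap.neg_apply, LinearMap.neg_apply,
          LieModule.traceForm_apply_lie_apply, hx, killingForm_lie, mul_neg] }
  have hI : I = ⊤ := by
    refine (IsSimple.eq_bot_or_eq_top I).resolve_left fun h => hx₀.2 ?_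
    have : x₀ ∈ I := by
      intro y
      rw [← hφ, hx₀.apply_eq_smul, map_smul, LinearMap.smul_apply, smul_eq_mul]
    rwa [h, LieSubmodule.mem_bot] at this
  refine ⟨μ, fun x => ?_⟩
  have : x ∈ I := hI ▸ LieSubmodule.mem_top x
  exact this

variable (W) in
/-- The Casimir operator of the Killing form on a module. -/
def casimir : End ℂ W :=
  ∑ i, LieModule.toEnd ℂ 𝔤 W (b i) * LieModule.toEnd ℂ 𝔤 W (killingDual b i)

lemma trace_casimir [FiniteDimensional ℂ W] {μ : ℂ}
    (hμ : ∀ x y : 𝔤, LieModule.traceForm ℂ 𝔤 W x y = μ * killingForm ℂ 𝔤 x y) :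
    LinearMap.trace ℂ W (casimir W b) = μ * Fintype.card ι := by
  have : ∀ i, LinearMap.trace ℂ W (LieModule.toEnd ℂ 𝔤 W (b i) *
      LieModule.toEnd ℂ 𝔤 W (killingDual b i)) = μ := by
    intro i
    have := hμ (b i) (killingDual b i)
    rw [killingForm_dual_right, if_pos rfl, mul_one, LieModule.traceForm_apply_apply] at this
    exact this
  simp only [casimir, map_sum, this, Finset.sum_const, Finset.card_univ, nsmul_eq_mul]
  ring

/-- Both forms are evaluated at `(h, h)`, where they are traces of squares of operators with
integral eigenvalues. The adjoint value is nonzero because `e` has eigenvalue `2`. -/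
lemma traceForm_ratio [FiniteDimensional ℂ W] {μ : ℂ}
    (hμ : ∀ x y : 𝔤, LieModule.traceForm ℂ 𝔤 W x y = μ * killingForm ℂ 𝔤 x y) :
    ∃ r : ℚ, 0 ≤ r ∧ μ = r := by
  obtain ⟨h, e, f, t⟩ := exists_sl2Triple 𝔤
  obtain ⟨n, hn, -⟩ := trace_sq_of_integral_eigenvalues _ (sl2_eigenvalue_integral (W := W) t)
  obtain ⟨k, hk, hk0⟩ := trace_sq_of_integral_eigenvalues _ (sl2_eigenvalue_integral (W := 𝔤) t)
  have hkne : k ≠ 0 := by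
    intro h0
    have := hk0 h0 2 (End.hasEigenvalue_of_hasEigenvector (x := e) (End.hasEigenvector_iff.mpr
      ⟨End.mem_eigenspace_iff.mpr (t.lie_h_e_smul ℂ), t.e_ne_zero⟩))
    norm_num at this
  have h1 : (n : ℂ) = μ * k := by
    rw [← hn, ← hk]
    exact hμ h h
  refine ⟨(n : ℚ) / k, by positivity, ?_⟩
  have hk' : (k : ℂ) ≠ 0 := by exact_mod_cast hkne
  push_cast
  rw [h1]
  field_simp

/-- Traces give `lam · dim W = μ · dim 𝔤`. Only sign and rationality matter later, so no highest
weight formula is needed. -/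
lemma casimir_eigenvalue [FiniteDimensional ℂ W] [Nontrivial W] {lam : ℂ}
    (hn : IsNilpotent (casimir W b - algebraMap ℂ (End ℂ W) lam)) :
    ∃ r : ℚ, 0 ≤ r ∧ lam = r := by
  obtain ⟨μ, hμ⟩ := traceForm_eq_smul_killingForm (𝔤 := 𝔤) (W := W)
  obtain ⟨r, hr, rfl⟩ := traceForm_ratio hμ
  have h0 := (LinearMap.isNilpotent_trace_of_isNilpotent hn).eq_zero
  rw [map_sub, trace_casimir b hμ, Algebra.algebraMap_eq_smul_one, map_smul, LinearMap.trace_one,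
    sub_eq_zero] at h0
  have hd : (finrank ℂ W : ℂ) ≠ 0 := by exact_mod_cast (finrank_pos (R := ℂ) (M := W)).ne'
  refine ⟨r * Fintype.card ι / finrank ℂ W, by positivity, ?_⟩
  push_cast
  rw [h0, smul_eq_mul]
  field_simp

lemma lie_eq_span_brackets (𝔤 : Type u) [LieRing 𝔤] [LieAlgebra ℂ 𝔤] [IsSimple ℂ 𝔤] :
    Submodule.span ℂ {z : 𝔤 | ∃ x y : 𝔤, ⁅x, y⁆ = z} = ⊤ := by
  let I : LieIdeal ℂ 𝔤 := ⁅(⊤ : LieIdeal ℂ 𝔤), (⊤ : LieIdeal ℂ 𝔤)⁆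
  have hI : I = ⊤ := by
    refine (IsSimple.eq_bot_or_eq_top I).resolve_left fun h => ?_
    apply IsSimple.non_abelian (R := ℂ) (L := 𝔤)
    refine ⟨fun x y => ?_⟩
    have : ⁅x, y⁆ ∈ I := LieSubmodule.lie_mem_lie (LieSubmodule.mem_top x) (LieSubmodule.mem_top y)
    rwa [h, LieSubmodule.mem_bot] at this
  have h2 := congrArg LieSubmodule.toSubmodule hI
  rw [LieSubmodule.lieIdeal_oper_eq_linear_span', LieSubmodule.top_toSubmodule] at h2
  rw [← h2]
  congr 1
  ext z
  simp

/-- A nilpotent Casimir operator has trace zero, hence `μ = 0` and the trace of `h²` on `W`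
vanishes, so `h` has no nonzero eigenvalue. Arguing with the nilpotent `h` instead of decomposing
`W` makes complete reducibility unnecessary. -/
lemma lie_eq_zero_of_casimir_nilpotent [FiniteDimensional ℂ W] (hn : IsNilpotent (casimir W b))
    (x : 𝔤) (m : W) : ⁅x, m⁆ = 0 := by
  obtain ⟨μ, hμ⟩ := traceForm_eq_smul_killingForm (𝔤 := 𝔤) (W := W)
  have h0 := (LinearMap.isNilpotent_trace_of_isNilpotent hn).eq_zero
  obtain ⟨h, e, f, t⟩ := exists_sl2Triple 𝔤
  have hne : Nonempty ι := by
    by_contra hemp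
    rw [not_nonempty_iff] at hemp
    apply t.h_ne_zero
    rw [← b.sum_repr h]
    simp
  rw [trace_casimir b hμ, mul_eq_zero] at h0
  have hcard : (Fintype.card ι : ℂ) ≠ 0 := by exact_mod_cast Fintype.card_ne_zero
  have hμ0 := h0.resolve_right hcard
  obtain ⟨n, hn', hn0⟩ := trace_sq_of_integral_eigenvalues _ (sl2_eigenvalue_integral (W := W) t)
  have hn1 : n = 0 := by
    have : (n : ℂ) = 0 := by
      rw [← hn']
      have := hμ h h
      rw [hμ0, zero_mul] at this
      exact this
    exact_mod_cast this
  -- `h` acts nilpotently, hence so does `ad h`, hence `e` acts by zero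
  have hnil : IsNilpotent (LieModule.toEnd ℂ 𝔤 W h) :=
    isNilpotent_of_eigenvalues_eq_zero _ (hn0 hn1)
  have he : LieModule.toEnd ℂ 𝔤 W e = 0 := by
    set H := LieModule.toEnd ℂ 𝔤 W h
    set E := LieModule.toEnd ℂ 𝔤 W e
    -- From `[h, e] = 2e` follows `H^k E = E (H + 2)^k`. When `H^k = 0` the left side vanishes while
    -- `H + 2` is invertible, so `E = 0`.
    have hHE : H * E = E * (H + 2) := by
      have h2 : LieModule.toEnd ℂ 𝔤 W ⁅h, e⁆ = H * E - E * H := by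
        ext w; simp [H, E]
      have h3 : LieModule.toEnd ℂ 𝔤 W ⁅h, e⁆ = E * 2 := by
        rw [t.lie_h_e_smul ℂ, map_smul, mul_two, two_smul]
      rw [mul_add, ← h3, h2]; abel
    have hpow : ∀ k : ℕ, H ^ k * E = E * (H + 2) ^ k := by
      intro k
      induction k with
      | zero => simp
      | succ k ih => rw [pow_succ, mul_assoc, hHE, ← mul_assoc, ih, mul_assoc, ← pow_succ]
    obtain ⟨k, hk⟩ := hnil
    have hunit : IsUnit (H + 2) := by
      have h2 : IsUnit (2 : End ℂ W) := by
        have := (IsUnit.mk0 (2 : ℂ) two_ne_zero).map (algebraMap ℂ (End ℂ W))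
        rwa [map_ofNat] at this
      exact IsNilpotent.isUnit_add_right_of_commute ⟨k, hk⟩ h2 (by
        rw [← Nat.cast_ofNat]; exact Nat.commute_cast _ _)
    have := hpow k
    rw [hk, zero_mul] at this
    exact ((hunit.pow k).mul_left_eq_zero.mp this.symm)
  -- The kernel of the representation is an ideal containing `e ≠ 0`, hence everything.
  let I : LieIdeal ℂ 𝔤 :=
    { LinearMap.ker (LieModule.toEnd ℂ 𝔤 W : 𝔤 →ₗ[ℂ] End ℂ W) with
      lie_mem := by
        intro z y hy
        have hy0 : LieModule.toEnd ℂ 𝔤 W y = 0 := hy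
        change LieModule.toEnd ℂ 𝔤 W ⁅z, y⁆ = 0
        ext w
        have h1 : ∀ w : W, ⁅y, w⁆ = 0 := fun w => congrArg (fun φ : End ℂ W => φ w) hy0
        simp [h1] }
  have hI : I = ⊤ := by
    refine (IsSimple.eq_bot_or_eq_top I).resolve_left fun h => t.e_ne_zero ?_
    have : e ∈ I := he
    rwa [h, LieSubmodule.mem_bot] at this
  have : x ∈ I := hI ▸ LieSubmodule.mem_top x
  have hx : LieModule.toEnd ℂ 𝔤 W x = 0 := this
  exact congrArg (fun φ : End ℂ W => φ m) hx

end FiniteDimensionalModules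

/-! ### Nonnegative rational spectrum of the Casimir operator -/

section CasimirPolynomial

variable {𝔤 : Type u} [LieRing 𝔤] [LieAlgebra ℂ 𝔤]
  {W : Type w} [AddCommGroup W] [Module ℂ W] [LieRingModule 𝔤 W] [LieModule ℂ 𝔤 W]
  [FiniteDimensional ℂ 𝔤] [IsSimple ℂ 𝔤] {ι : Type} [Fintype ι] [DecidableEq ι]
  (b : Basis ι ℂ 𝔤)

lemma casimir_lie (y : 𝔤) (m : W) : casimir W b ⁅y, m⁆ = ⁅y, casimir W b m⁆ := by
  let F : 𝔤 →ₗ[ℂ] 𝔤 →ₗ[ℂ] W := LinearMap.mk₂ ℂ (fun x z => ⁅x, ⁅z, m⁆⁆)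
    (by intros; simp) (by intros; simp) (by intros; simp) (by intros; simp)
  have h := casimir_invariant b F y
  simp only [F, LinearMap.mk₂_apply] at h
  have e1 : ∀ m : W, casimir W b m = ∑ i, ⁅b i, ⁅killingDual b i, m⁆⁆ := by
    intro m; simp [casimir]
  rw [e1, e1, lie_sum, ← sub_eq_zero, ← Finset.sum_sub_distrib]
  rw [eq_neg_iff_add_eq_zero, ← Finset.sum_add_distrib] at h
  rw [← h]
  refine Finset.sum_congr rfl fun i _ => ?_
  rw [lie_lie, lie_lie (b i) y, lie_sub]
  abel

/-- The minimal polynomial works: each root is an eigenvalue, its generalized eigenspace is a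
`𝔤`-submodule because the Casimir operator is central, and `casimir_eigenvalue` applies to that
submodule. -/
lemma exists_polynomial_casimir [FiniteDimensional ℂ W] :
    ∃ P : Polynomial ℂ, P ≠ 0 ∧ (∀ z, P.IsRoot z → ∃ r : ℚ, 0 ≤ r ∧ z = r) ∧
      Polynomial.aeval (casimir W b) P = 0 := by
  refine ⟨minpoly ℂ (casimir W b), minpoly.ne_zero (Algebra.IsIntegral.isIntegral _), ?_,
    minpoly.aeval _ _⟩
  intro z hz
  have hev : (casimir W b).HasEigenvalue z := End.hasEigenvalue_of_isRoot hz
  let N : LieSubmodule ℂ 𝔤 W :=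
    { (casimir W b).maxGenEigenspace z with
      lie_mem := by
        intro x m hm
        refine End.mapsTo_maxGenEigenspace_of_comm (f := casimir W b)
          (g := LieModule.toEnd ℂ 𝔤 W x) ?_ z hm
        ext m
        exact casimir_lie b x m }
  have hN : ∀ m : W, m ∈ N ↔ m ∈ (casimir W b).maxGenEigenspace z := fun m => Iff.rfl
  obtain ⟨m, hm⟩ := hev.exists_hasEigenvector
  have hmN : m ∈ N := by
    rw [hN, End.mem_maxGenEigenspace]
    refine ⟨1, ?_⟩
    rw [pow_one, LinearMap.sub_apply, End.mem_eigenspace_iff.mp hm.1]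
    simp
  have : Nontrivial N := ⟨⟨⟨m, hmN⟩, 0, fun h => hm.2 (congrArg Subtype.val h)⟩⟩
  apply casimir_eigenvalue b (W := N)
  have hcoe : ∀ k : ℕ, ∀ x : N,
      ((((casimir N b - algebraMap ℂ (End ℂ N) z) ^ k) x : N) : W)
        = ((casimir W b - z • 1) ^ k) (x : W) := by
    intro k
    induction k with
    | zero => intro x; simp
    | succ k ih =>
      intro x
      rw [pow_succ, pow_succ, End.mul_apply, End.mul_apply, ih]
      congr 1
      simp [casimir]
  refine ⟨End.maxGenEigenspaceIndex (casimir W b) z, ?_⟩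
  ext x
  have hx : (x : W) ∈ (casimir W b).maxGenEigenspace z := x.2
  rw [End.maxGenEigenspace_eq, End.mem_genEigenspace_nat, LinearMap.mem_ker] at hx
  rw [hcoe, hx]
  simp

end CasimirPolynomial

/-! ### Words in locally nilpotent operators -/

section Words

variable {M : Type w} [AddCommGroup M] [Module ℂ M]

/-- The prefix `p` is quantified inside the induction because the `cons` case moves a letter into
it. -/
lemma word_perm {ι : Type} (w : List ι → M) (U : Submodule ℂ M) (n : ℕ)
    (hswap : ∀ (l₁ l₂ : List ι) (i j : ι), (l₁ ++ i :: j :: l₂).length = n →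
      w (l₁ ++ i :: j :: l₂) - w (l₁ ++ j :: i :: l₂) ∈ U)
    {l l' : List ι} (h : l.Perm l') :
    ∀ p : List ι, (p ++ l).length = n → w (p ++ l) - w (p ++ l') ∈ U := by
  induction h with
  | nil => intro p _; simp
  | cons x _ ih =>
    intro p hp
    have := ih (p ++ [x]) (by simpa using hp)
    simpa using this
  | swap x y l => intro p hp; exact hswap p l y x hp
  | trans h₁ h₂ ih₁ ih₂ =>
    intro p hp
    have h1 := ih₁ p hp
    have h2 := ih₂ p (by rw [← hp]; simp [h₁.length_eq])
    have := U.add_mem h1 h2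
    rwa [sub_add_sub_cancel] at this

/-- Pigeonhole: a word of length greater than `∑ N i` contains some letter `i` at least `N i` times.
Modulo `U` these copies can be moved to the end, where `hend` applies. -/
lemma word_mem {ι : Type} [Fintype ι] [DecidableEq ι] (w : List ι → M) (U : Submodule ℂ M) (n : ℕ)
    (hswap : ∀ (l₁ l₂ : List ι) (i j : ι), (l₁ ++ i :: j :: l₂).length = n →
      w (l₁ ++ i :: j :: l₂) - w (l₁ ++ j :: i :: l₂) ∈ U)
    (N : ι → ℕ) (hend : ∀ l i, w (l ++ List.replicate (N i) i) ∈ U) (hn : ∑ i, N i < n)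
    (l : List ι) (hl : l.length = n) : w l ∈ U := by
  obtain ⟨i, hi⟩ : ∃ i, N i ≤ l.count i := by
    by_contra! hlt
    have h1 : l.length = ∑ i, l.count i := by
      rw [← Multiset.coe_card, ← Multiset.sum_count_eq_card (s := Finset.univ) (m := (l : Multiset ι))
        (fun a _ => Finset.mem_univ a)]
      simp
    have h2 : ∑ i, l.count i ≤ ∑ i, N i := Finset.sum_le_sum fun i _ => (hlt i).le
    omega
  have hsub : (List.replicate (N i) i).Sublist l := List.replicate_sublist_iff.mpr hi
  obtain ⟨l', hl'⟩ := hsub.exists_perm_append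
  have hp := word_perm w U n hswap (hl'.trans List.perm_append_comm) [] (by simpa using hl)
  have := U.add_mem hp (hend l' i)
  simpa using this

/-- Swapping adjacent letters of a word costs a combination of shorter words, by the bracket
relation. By `word_mem`, words of length `∑ N i + 1` therefore lie in the span of the shorter ones,
so this span is stable. -/
lemma exists_finiteDimensional_stable {𝔤 : Type u} [LieRing 𝔤] [LieAlgebra ℂ 𝔤] {d : ℕ}
    (b : Basis (Fin d) ℂ 𝔤) (X : 𝔤 →ₗ[ℂ] End ℂ M)
    (hX : ∀ x y, X ⁅x, y⁆ = X x * X y - X y * X x) (m : M)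
    (hm : ∀ i, ∃ N : ℕ, (X (b i) ^ N) m = 0) :
    ∃ W : Submodule ℂ M, FiniteDimensional ℂ W ∧ m ∈ W ∧ ∀ x, ∀ v ∈ W, X x v ∈ W := by
  choose N hN using hm
  let word : List (Fin d) → M := fun l => (l.map fun i => X (b i)).prod m
  let U : ℕ → Submodule ℂ M := fun k => Submodule.span ℂ (word '' {l | l.length ≤ k})
  have hmem : ∀ k l, l.length ≤ k → word l ∈ U k := fun k l hl =>
    Submodule.subset_span ⟨l, hl, rfl⟩
  have hmono : ∀ k, U k ≤ U (k + 1) := fun k =>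
    Submodule.span_mono (Set.image_mono fun l (hl : l.length ≤ k) => Nat.le_succ_of_le hl)
  set n := ∑ i, N i
  have hword : ∀ l : List (Fin d), l.length = n + 1 → word l ∈ U n := by
    refine word_mem word (U n) (n + 1) ?_ N ?_ (Nat.lt_succ_self n)
    · intro l₁ l₂ i j hlen
      have e : word (l₁ ++ i :: j :: l₂) - word (l₁ ++ j :: i :: l₂)
          = ∑ k, b.repr ⁅b i, b j⁆ k • word (l₁ ++ k :: l₂) := by
        have h1 : X (b i) * X (b j) - X (b j) * X (b i)
            = ∑ k, b.repr ⁅b i, b j⁆ k • X (b k) := by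
          rw [← hX]
          conv_lhs => rw [← b.sum_repr ⁅b i, b j⁆]
          simp only [map_sum, map_smul]
        have h2 : word (l₁ ++ i :: j :: l₂) - word (l₁ ++ j :: i :: l₂)
            = ((l₁.map fun i => X (b i)).prod * (X (b i) * X (b j) - X (b j) * X (b i)) *
              (l₂.map fun i => X (b i)).prod) m := by
          simp only [word, List.map_append, List.map_cons, List.prod_append, List.prod_cons,
            mul_sub, sub_mul, LinearMap.sub_apply, mul_assoc]
        rw [h2, h1, Finset.mul_sum, Finset.sum_mul, LinearMap.sum_apply]
        refine Finset.sum_congr rfl fun k _ => ?_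
        simp [word, mul_assoc]
      rw [e]
      refine Submodule.sum_mem _ fun k _ => Submodule.smul_mem _ _ (hmem _ _ ?_)
      simp at hlen ⊢
      omega
    · intro l i
      have : word (l ++ List.replicate (N i) i) = 0 := by
        simp [word, hN]
      rw [this]
      exact zero_mem _
  have hU : U (n + 1) ≤ U n := by
    refine Submodule.span_le.mpr ?_
    rintro _ ⟨l, hl, rfl⟩
    rcases Nat.lt_or_ge l.length (n + 1) with h | h
    · exact hmem _ _ (Nat.lt_succ_iff.mp h)
    · exact hword l (le_antisymm hl h)
  refine ⟨U n, ?_, ?_, ?_⟩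
  · refine FiniteDimensional.span_of_finite ℂ (Set.Finite.image _ ?_)
    exact List.finite_length_le (Fin d) n
  · exact hmem n [] (Nat.zero_le _)
  · intro x v hv
    have hb : ∀ i, ∀ v ∈ U n, X (b i) v ∈ U n := by
      intro i v hv
      apply hU
      refine (Submodule.span_le (p := (U (n + 1)).comap (X (b i)))).mpr ?_ hv
      rintro _ ⟨l, hl, rfl⟩
      have : X (b i) (word l) = word (i :: l) := by simp [word]
      change X (b i) (word l) ∈ U (n + 1)
      rw [this]
      exact hmem _ _ (by simpa using hl)
    rw [← b.sum_repr x, map_sum, LinearMap.sum_apply]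
    refine Submodule.sum_mem _ fun i _ => ?_
    rw [map_smul, LinearMap.smul_apply]
    exact Submodule.smul_mem _ _ (hb i v hv)

end Words

/-! ### The Segal-Sugawara operator -/

/-- A smooth representation of the affine algebra at level `c` times the Killing form, given by the
action `mode n x` of the elements `x ⊗ t ^ n`. -/
structure ModeRep (𝔤 : Type u) [LieRing 𝔤] [LieAlgebra ℂ 𝔤] (c : ℂ) (M : Type w) [AddCommGroup M]
    [Module ℂ M] where
  mode : ℤ → 𝔤 →ₗ[ℂ] End ℂ M
  comm : ∀ m n x y, mode m x * mode n y - mode n y * mode m x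
    = mode (m + n) ⁅x, y⁆ + (if m + n = 0 then (m : ℂ) * (c * killingForm ℂ 𝔤 x y) else 0) • 1
  smooth : ∀ v, ∃ N : ℕ, ∀ n : ℤ, N ≤ n → ∀ x, mode n x v = 0

namespace ModeRep

variable {𝔤 : Type u} [LieRing 𝔤] [LieAlgebra ℂ 𝔤] [FiniteDimensional ℂ 𝔤] [IsKilling ℂ 𝔤]
  {ι : Type} [Fintype ι] [DecidableEq ι] (b : Basis ι ℂ 𝔤) {c : ℂ}
  {M : Type w} [AddCommGroup M] [Module ℂ M] (X : ModeRep 𝔤 c M)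

/-- Telescoping with step `n` leaves `n` terms at each end. In the commutator of `T` with `y t^n`
the low end yields the scalar and the high end dies on each vector. -/
lemma sum_range_telescope {G : Type*} [AddCommGroup G] (a : ℤ → G) (n K : ℕ) :
    ∑ k ∈ Finset.range K, (a (k + 1) - a (k + 1 - n))
      = ∑ j ∈ Finset.range n, (a (K - j) - a (-j)) := by
  induction K with
  | zero => simp
  | succ K ih =>
    rw [Finset.sum_range_succ, ih, eq_comm, ← sub_eq_iff_eq_add', ← Finset.sum_sub_distrib]
    have h : ∀ j ∈ Finset.range n, a ((K + 1 : ℕ) - j) - a (-j) - (a (K - j) - a (-j))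
        = (fun j : ℕ => -a (K + 1 - j)) (j + 1) - (fun j : ℕ => -a (K + 1 - j)) j := by
      intro j _
      push_cast
      rw [show (K : ℤ) + 1 - (j + 1) = K - j by ring]
      abel
    rw [Finset.sum_congr rfl h, Finset.sum_range_sub (fun j : ℕ => -a (K + 1 - j)) n]
    simp
    abel

/-- The operator `∑ᵢ (bᵢ ⊗ t ^ p) ([bᵢ', y] ⊗ t ^ q)`. -/
def quad (p q : ℤ) (y : 𝔤) : End ℂ M := ∑ i, X.mode p (b i) * X.mode q ⁅killingDual b i, y⁆

/-- The operator `∑ᵢ (bᵢ ⊗ t ^ (-k)) (bᵢ' ⊗ t ^ k)`. -/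
def diag (k : ℤ) : End ℂ M := ∑ i, X.mode (-k) (b i) * X.mode k (killingDual b i)

/-- The product of two modes as a bilinear map. -/
def modeMul (p q : ℤ) : 𝔤 →ₗ[ℂ] 𝔤 →ₗ[ℂ] End ℂ M :=
  (LinearMap.mul ℂ (End ℂ M)).compl₁₂ (X.mode p) (X.mode q)

lemma modeMul_apply (p q : ℤ) (x y : 𝔤) : X.modeMul p q x y = X.mode p x * X.mode q y := rfl

lemma quad_eq (p q : ℤ) (y : 𝔤) :
    X.quad b p q y = -∑ i, X.mode p ⁅b i, y⁆ * X.mode q (killingDual b i) := by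
  have := casimir_invariant b (X.modeMul p q) y
  simpa only [quad, modeMul_apply] using this

lemma quad_eq' (p q : ℤ) (y : 𝔤) :
    X.quad b p q y = -∑ i, X.mode p ⁅killingDual b i, y⁆ * X.mode q (b i) := by
  rw [quad_eq]
  let F : 𝔤 →ₗ[ℂ] 𝔤 →ₗ[ℂ] End ℂ M :=
    LinearMap.mk₂ ℂ (fun x z => X.mode p ⁅x, y⁆ * X.mode q z)
      (by intros; simp [add_mul]) (by intros; simp) (by intros; simp [mul_add]) (by intros; simp)
  have := casimir_symm b F
  simp only [F, LinearMap.mk₂_apply] at this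
  rw [this]

/-- Invariance turns the sum into commutators, which give `∑ [bᵢ, [bᵢ', y]]` in degree `p + q`; this
is `y` by `casimir_adjoint`. The condition `p + q ≠ 0` removes the central term. -/
lemma quad_add_quad {p q : ℤ} (hpq : p + q ≠ 0) (y : 𝔤) :
    X.quad b p q y + X.quad b q p y = X.mode (p + q) y := by
  rw [X.quad_eq' b q p, quad, ← sub_eq_add_neg, ← Finset.sum_sub_distrib]
  simp only [X.comm, if_neg hpq, zero_smul, add_zero]
  rw [← map_sum, casimir_adjoint]

/-- The Leibniz rule gives the two quadratic terms. Since `k, n ≥ 0`, a central term can come only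
from the left factor, at `k = n`, where the expansion in the dual basis reassembles `y`. -/
lemma diag_comm {k n : ℤ} (hk : 0 ≤ k) (hn : 0 ≤ n) (y : 𝔤) :
    X.diag b k * X.mode n y - X.mode n y * X.diag b k
      = X.quad b (-k) (k + n) y - X.quad b (n - k) k y
        - (if k = n then (n : ℂ) * c else 0) • X.mode n y := by
  have h1 : ∀ i, X.mode (-k) (b i) * X.mode k (killingDual b i) * X.mode n y
      - X.mode n y * (X.mode (-k) (b i) * X.mode k (killingDual b i))
      = X.mode (-k) (b i) * X.mode (k + n) ⁅killingDual b i, y⁆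
        + X.mode (n - k) ⁅b i, y⁆ * X.mode k (killingDual b i)
        - (if k = n then (n : ℂ) * c else 0) •
          (killingForm ℂ 𝔤 y (b i) • X.mode k (killingDual b i)) := by
    intro i
    have e1 := X.comm k n (killingDual b i) y
    have e2 := X.comm (-k) n (b i) y
    have z1 : (if k + n = 0 then (k : ℂ) * (c * killingForm ℂ 𝔤 (killingDual b i) y) else 0) = 0 := by
      split_ifs with h
      · have : k = 0 := by omega
        rw [this]; simp
      · rfl
    rw [z1, zero_smul, add_zero] at e1
    have z2 : (if -k + n = 0 then ((-k : ℤ) : ℂ) * (c * killingForm ℂ 𝔤 (b i) y) else 0)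
        = -((if k = n then (n : ℂ) * c else 0) * killingForm ℂ 𝔤 y (b i)) := by
      by_cases h : k = n
      · rw [if_pos (by omega), if_pos h, killingForm_comm, h]; push_cast; ring
      · rw [if_neg (by omega), if_neg h]; ring
    rw [z2, show -k + n = n - k by ring] at e2
    have : X.mode (-k) (b i) * X.mode k (killingDual b i) * X.mode n y
      - X.mode n y * (X.mode (-k) (b i) * X.mode k (killingDual b i))
      = X.mode (-k) (b i) * (X.mode k (killingDual b i) * X.mode n y
          - X.mode n y * X.mode k (killingDual b i))
        + (X.mode (-k) (b i) * X.mode n y - X.mode n y * X.mode (-k) (b i))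
          * X.mode k (killingDual b i) := by
      noncomm_ring
    rw [this, e1, e2, add_mul, smul_mul_assoc, one_mul, neg_smul, smul_smul]
    abel
  rw [diag, Finset.sum_mul, Finset.mul_sum, ← Finset.sum_sub_distrib,
    Finset.sum_congr rfl fun i _ => h1 i, Finset.sum_sub_distrib, Finset.sum_add_distrib,
    X.quad_eq b (n - k) k, sub_neg_eq_add, ← Finset.smul_sum]
  congr 1
  by_cases h : k = n
  · rw [h]
    congr 1
    conv_rhs => rw [eq_sum_killingDual b y]
    simp only [map_sum, map_smul]
  · simp [h]

/-- The truncation of the Segal-Sugawara operator. -/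
def sugawaraTrunc (K : ℕ) : End ℂ M :=
  X.diag b 0 + (2 : ℂ) • ∑ k ∈ Finset.range K, X.diag b (k + 1)

/-- Symmetrizing under `j ↦ n - j` pairs the terms as in `quad_add_quad`. The range stops before `j
= n`, hence the correction `quad n 0`. -/
lemma sum_quad (n : ℕ) (hn : n ≠ 0) (y : 𝔤) :
    (2 : ℂ) • ∑ j ∈ Finset.range n, X.quad b j (n - j) y
      = ((n : ℂ) + 1) • X.mode n y - (2 : ℂ) • X.quad b n 0 y := by
  have h1 : ∑ j ∈ Finset.range (n + 1), X.quad b j (n - j) y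
      = ∑ j ∈ Finset.range (n + 1), X.quad b (n - j) j y := by
    rw [← Finset.sum_range_reflect]
    refine Finset.sum_congr rfl fun j hj => ?_
    have hj' : j ≤ n := Nat.lt_succ_iff.mp (Finset.mem_range.mp hj)
    have : ((n + 1 - 1 - j : ℕ) : ℤ) = n - j := by omega
    rw [this]; congr 1; omega
  have h2 : ∑ j ∈ Finset.range (n + 1), X.quad b j (n - j) y
      + ∑ j ∈ Finset.range (n + 1), X.quad b (n - j) j y = ((n : ℂ) + 1) • X.mode n y := by
    rw [← Finset.sum_add_distrib, Finset.sum_congr rfl fun (j : ℕ) _ =>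
      X.quad_add_quad b (p := j) (q := n - j) (by simpa using hn) y]
    have : ∀ j : ℕ, (j : ℤ) + (n - j) = n := fun j => by ring
    simp only [this, Finset.sum_const, Finset.card_range]
    rw [← Nat.cast_smul_eq_nsmul ℂ]
    push_cast
    rfl
  rw [← h1, ← two_smul ℂ, Finset.sum_range_succ, smul_add] at h2
  rw [← h2]
  simp

/-- The two quadratic terms of `diag_comm` are shifts of one another by `n`, so the sum over `k`
telescopes. The low end combined with `diag 0` contributes `-n`, the central terms contribute
`-2nc`, and the remaining sum is the high end. -/
lemma sugawaraTrunc_comm (K n : ℕ) (hK : n ≤ K) (hn : n ≠ 0) (y : 𝔤) :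
    X.sugawaraTrunc b K * X.mode n y - X.mode n y * X.sugawaraTrunc b K
      = -(2 * n * (c + 1 / 2)) • X.mode n y
        + (2 : ℂ) • ∑ j ∈ Finset.range n, X.quad b (-(K - j)) (K - j + n) y := by
  have h1 : X.sugawaraTrunc b K * X.mode n y - X.mode n y * X.sugawaraTrunc b K
      = (X.diag b 0 * X.mode n y - X.mode n y * X.diag b 0)
        + (2 : ℂ) • ∑ k ∈ Finset.range K,
          (X.diag b (k + 1) * X.mode n y - X.mode n y * X.diag b (k + 1)) := by
    rw [sugawaraTrunc, add_mul, mul_add, smul_mul_assoc, mul_smul_comm, Finset.sum_mul,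
      Finset.mul_sum, Finset.sum_sub_distrib, smul_sub]
    abel
  rw [h1, X.diag_comm b le_rfl (by positivity),
    Finset.sum_congr rfl fun (k : ℕ) _ => X.diag_comm b (k := k + 1) (n := n) (by positivity)
      (by positivity) y, Finset.sum_sub_distrib]
  have h2 : ∑ k ∈ Finset.range K, (if (k : ℤ) + 1 = n then ((n : ℤ) : ℂ) * c else 0) • X.mode n y
      = ((n : ℂ) * c) • X.mode n y := by
    rw [Finset.sum_eq_single (n - 1)]
    · rw [if_pos (by omega)]; simp
    · intro k _ hk
      rw [if_neg (by omega), zero_smul]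
    · intro h
      exact absurd (Finset.mem_range.mpr (by omega)) h
  rw [h2]
  have h3 := sum_range_telescope (fun i : ℤ => X.quad b (-i) (i + n) y) n K
  have h4 : ∀ k : ℕ, X.quad b (-((k : ℤ) + 1 - n)) ((k : ℤ) + 1 - n + n) y
      = X.quad b (n - (k + 1)) (k + 1) y := by
    intro k; congr 1 <;> ring
  simp only [h4] at h3
  rw [h3, Finset.sum_sub_distrib]
  have h5 : ∀ j : ℕ, X.quad b (- -(j : ℤ)) (-(j : ℤ) + n) y = X.quad b j (n - j) y := by
    intro j; congr 1 <;> ring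
  simp only [h5]
  rw [smul_sub, smul_sub, X.sum_quad b n hn, if_neg (by omega)]
  have h6 := X.quad_add_quad b (p := 0) (q := n) (by simpa using hn) y
  simp only [neg_zero, zero_add, sub_zero, zero_smul] at h6 ⊢
  rw [← h6]
  module

lemma sugawaraTrunc_comm_zero (K : ℕ) (y : 𝔤) :
    X.sugawaraTrunc b K * X.mode 0 y = X.mode 0 y * X.sugawaraTrunc b K := by
  have h : ∀ k : ℕ, X.diag b k * X.mode 0 y = X.mode 0 y * X.diag b k := by
    intro k
    rw [← sub_eq_zero, X.diag_comm b (by positivity) le_rfl]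
    simp
  have h0 := h 0
  simp only [Nat.cast_zero] at h0
  rw [sugawaraTrunc, add_mul, mul_add, smul_mul_assoc, mul_smul_comm, Finset.sum_mul,
    Finset.mul_sum, h0]
  congr 2
  refine Finset.sum_congr rfl fun k _ => ?_
  have := h (k + 1)
  push_cast at this
  exact this

lemma sugawaraTrunc_stable {v : M} {N K : ℕ} (hN : ∀ n : ℤ, N ≤ n → ∀ x, X.mode n x v = 0)
    (hK : N ≤ K) : X.sugawaraTrunc b K v = X.sugawaraTrunc b N v := by
  induction K, hK using Nat.le_induction with
  | base => rfl
  | succ K hK ih =>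
    rw [← ih]
    simp only [sugawaraTrunc, Finset.sum_range_succ, smul_add, LinearMap.add_apply,
      LinearMap.smul_apply]
    have : X.diag b (K + 1) v = 0 := by
      simp only [diag, LinearMap.sum_apply, End.mul_apply]
      refine Finset.sum_eq_zero fun i _ => ?_
      rw [hN _ (by omega), map_zero]
    rw [this, smul_zero, add_zero]

/-- The Segal-Sugawara operator. -/
def sugawara : End ℂ M where
  toFun v := X.sugawaraTrunc b (X.smooth v).choose v
  map_add' v w := by
    set K := (X.smooth v).choose + (X.smooth w).choose + (X.smooth (v + w)).choose
    rw [← X.sugawaraTrunc_stable b (X.smooth v).choose_spec (K := K) (by omega),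
      ← X.sugawaraTrunc_stable b (X.smooth w).choose_spec (K := K) (by omega),
      ← X.sugawaraTrunc_stable b (X.smooth (v + w)).choose_spec (K := K) (by omega), map_add]
  map_smul' a v := by
    set K := (X.smooth v).choose + (X.smooth (a • v)).choose
    rw [← X.sugawaraTrunc_stable b (X.smooth v).choose_spec (K := K) (by omega),
      ← X.sugawaraTrunc_stable b (X.smooth (a • v)).choose_spec (K := K) (by omega), map_smul]
    rfl

lemma exists_sugawara_eq (v : M) : ∃ N : ℕ, (∀ n : ℤ, N ≤ n → ∀ x, X.mode n x v = 0) ∧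
    ∀ K, N ≤ K → X.sugawara b v = X.sugawaraTrunc b K v :=
  ⟨_, (X.smooth v).choose_spec, fun _ hK =>
    (X.sugawaraTrunc_stable b (X.smooth v).choose_spec hK).symm⟩

lemma sugawara_mode (n : ℕ) (y : 𝔤) (v : M) :
    X.sugawara b (X.mode n y v)
      = X.mode n y (X.sugawara b v) - (2 * n * (c + 1 / 2)) • X.mode n y v := by
  obtain ⟨N₁, hN₁, h₁⟩ := X.exists_sugawara_eq b v
  obtain ⟨N₂, -, h₂⟩ := X.exists_sugawara_eq b (X.mode n y v)
  -- The cutoff serves both vectors at once; the summand `n` secures the condition `n ≤ K` of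
  -- `sugawaraTrunc_comm`.
  set K := N₁ + N₂ + n
  rw [h₁ K (by omega), h₂ K (by omega)]
  rcases Nat.eq_zero_or_pos n with rfl | hn
  · have := congrArg (fun φ : End ℂ M => φ v) (X.sugawaraTrunc_comm_zero b K y)
    simp only [End.mul_apply] at this
    simp [this]
  · have := congrArg (fun φ : End ℂ M => φ v) (X.sugawaraTrunc_comm b K n (by omega) hn.ne' y)
    simp only [End.mul_apply, LinearMap.sub_apply, LinearMap.add_apply, LinearMap.smul_apply,
      LinearMap.sum_apply] at this
    have hz : ∑ j ∈ Finset.range n, X.quad b (-(K - j)) (K - j + n) y v = 0 := by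
      refine Finset.sum_eq_zero fun j hj => ?_
      rw [Finset.mem_range] at hj
      simp only [quad, LinearMap.sum_apply, End.mul_apply]
      refine Finset.sum_eq_zero fun i _ => ?_
      rw [hN₁ _ (by omega), map_zero]
    rw [hz, smul_zero, add_zero, sub_eq_iff_eq_add] at this
    rw [this, neg_smul]
    abel

lemma sugawara_map {M' : Type w} [AddCommGroup M'] [Module ℂ M'] (X' : ModeRep 𝔤 c M')
    (p : M →ₗ[ℂ] M') (hp : ∀ n x v, p (X.mode n x v) = X'.mode n x (p v)) (v : M) :
    p (X.sugawara b v) = X'.sugawara b (p v) := by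
  obtain ⟨N₁, -, h₁⟩ := X.exists_sugawara_eq b v
  obtain ⟨N₂, -, h₂⟩ := X'.exists_sugawara_eq b (p v)
  rw [h₁ (N₁ + N₂) (by omega), h₂ (N₁ + N₂) (by omega)]
  simp only [sugawaraTrunc, diag, LinearMap.add_apply, LinearMap.smul_apply, LinearMap.sum_apply,
    End.mul_apply, map_add, map_smul, map_sum, hp]

/-- This is the link with finite-dimensional theory: `diag 0` is the Casimir operator of the zero
modes, and all other terms have an annihilating right factor. -/
lemma sugawara_eq_diag_zero {v : M} (hv : ∀ n : ℤ, 1 ≤ n → ∀ x, X.mode n x v = 0) :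
    X.sugawara b v = X.diag b 0 v := by
  obtain ⟨N, -, h⟩ := X.exists_sugawara_eq b v
  rw [h N le_rfl, sugawaraTrunc, LinearMap.add_apply]
  have : (∑ k ∈ Finset.range N, X.diag b (k + 1)) v = 0 := by
    simp only [diag, LinearMap.sum_apply, End.mul_apply]
    refine Finset.sum_eq_zero fun k _ => Finset.sum_eq_zero fun i _ => ?_
    rw [hv _ (by omega), map_zero]
  rw [LinearMap.smul_apply, this, smul_zero, add_zero]

end ModeRep

/-! ### Spectrum of the Segal-Sugawara operator and lifting of vacuum vectors -/

lemma aeval_intertwine {A B : Type*} [AddCommGroup A] [Module ℂ A] [AddCommGroup B] [Module ℂ B]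
    (φ : A →ₗ[ℂ] B) (S : End ℂ A) (T : End ℂ B) (h : ∀ a, φ (S a) = T (φ a)) (P : Polynomial ℂ)
    (a : A) : φ (Polynomial.aeval S P a) = Polynomial.aeval T P (φ a) := by
  have hpow : ∀ (n : ℕ) a, φ ((S ^ n) a) = (T ^ n) (φ a) := by
    intro n
    induction n with
    | zero => intro a; simp
    | succ n ih => intro a; rw [pow_succ, pow_succ, End.mul_apply, End.mul_apply, ih, h]
  induction P using Polynomial.induction_on' with
  | add p q hp hq => simp [hp, hq]
  | monomial n c => simp [Polynomial.aeval_monomial, hpow]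

namespace ModeRep

variable {𝔤 : Type u} [LieRing 𝔤] [LieAlgebra ℂ 𝔤] [FiniteDimensional ℂ 𝔤] [IsSimple ℂ 𝔤]
  {d : ℕ} (b : Basis (Fin d) ℂ 𝔤) {c : ℂ}
  {M : Type w} [AddCommGroup M] [Module ℂ M] (X : ModeRep 𝔤 c M)

/-- The vectors annihilated by the modes `x ⊗ t ^ n` with `n ≥ k`. -/
def killed (k : ℕ) : Submodule ℂ M where
  carrier := {v | ∀ n : ℤ, k ≤ n → ∀ x, X.mode n x v = 0}
  add_mem' hv hw n hn x := by rw [map_add, hv n hn, hw n hn, add_zero]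
  zero_mem' n hn x := map_zero _
  smul_mem' a v hv n hn x := by rw [map_smul, hv n hn, smul_zero]

/-- The commutator has degree at least `k`, hence kills `v`; `1 ≤ k` keeps this degree positive, so
no central term appears. -/
lemma mode_mem_killed {k : ℕ} {v : M} (hk : 1 ≤ k) (hv : v ∈ X.killed k) (n : ℕ) (x : 𝔤) :
    X.mode n x v ∈ X.killed k := by
  intro m hm y
  have h := congrArg (fun φ : End ℂ M => φ v) (X.comm m n y x)
  simp only [LinearMap.sub_apply, End.mul_apply, LinearMap.add_apply] at h
  rw [hv m hm, map_zero, sub_zero, hv (m + n) (by omega), if_neg (by omega), zero_smul,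
    LinearMap.zero_apply, add_zero] at h
  exact h

/-- `v` is annihilated by a nonzero polynomial in the Segal-Sugawara operator all of whose roots are
of the form `r + 2 j (c + 1 / 2)`, with `r ≥ 0` rational and `j` a natural number. -/
def IsGood (v : M) : Prop :=
  ∃ P : Polynomial ℂ, P ≠ 0 ∧
    (∀ z, P.IsRoot z → ∃ (r : ℚ) (j : ℕ), 0 ≤ r ∧ z = r + 2 * j * (c + 1 / 2)) ∧
    Polynomial.aeval (X.sugawara b) P v = 0

lemma mode_zero_lie (x y : 𝔤) :
    X.mode 0 ⁅x, y⁆ = X.mode 0 x * X.mode 0 y - X.mode 0 y * X.mode 0 x := by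
  rw [X.comm]; simp

/-- The commutation relation reads `x_n T = (T + 2n(c + 1/2)) x_n`, and it extends from `T` to
polynomials in `T`. -/
lemma sugawara_intertwine (n : ℕ) (y : 𝔤) (P : Polynomial ℂ) (v : M) :
    X.mode n y (Polynomial.aeval (X.sugawara b) P v)
      = Polynomial.aeval (X.sugawara b) (P.comp (Polynomial.X + Polynomial.C (2 * n * (c + 1 / 2))))
        (X.mode n y v) := by
  rw [Polynomial.aeval_comp]
  refine aeval_intertwine (X.mode n y) _ _ (fun a => ?_) P v
  rw [map_add, Polynomial.aeval_X, Polynomial.aeval_C, LinearMap.add_apply,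
    Module.algebraMap_end_apply, X.sugawara_mode b, sub_add_cancel]

lemma aeval_mem_killed {k : ℕ} {v : M} (hv : v ∈ X.killed k) (P : Polynomial ℂ) :
    Polynomial.aeval (X.sugawara b) P v ∈ X.killed k := by
  intro n hn x
  lift n to ℕ using by omega
  rw [X.sugawara_intertwine b, hv n hn, map_zero]

variable (hloc : ∀ (i : Fin d) (k : ℕ) (v : M), ∃ N : ℕ, (X.mode k (b i) ^ N) v = 0)

/-- The action of `𝔤` by zero modes on a stable subspace. -/
abbrev zeroModeLieRingModule (W : Submodule ℂ M) (hW : ∀ x, ∀ v ∈ W, X.mode 0 x v ∈ W) :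
    LieRingModule 𝔤 W where
  bracket x v := ⟨X.mode 0 x v, hW x v v.2⟩
  add_lie x y v := Subtype.ext (by simp)
  lie_add x v v' := Subtype.ext (by simp)
  leibniz_lie x y v := Subtype.ext (by
    have := congrArg (fun φ : End ℂ M => φ v) (X.mode_zero_lie x y)
    simp only [LinearMap.sub_apply, End.mul_apply] at this
    simp [this])

lemma zeroModeLieModule (W : Submodule ℂ M) (hW : ∀ x, ∀ v ∈ W, X.mode 0 x v ∈ W) :
    letI := X.zeroModeLieRingModule W hW
    LieModule ℂ 𝔤 W :=
  letI := X.zeroModeLieRingModule W hW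
  { smul_lie := fun a x v => Subtype.ext (by
      change X.mode 0 (a • x) v = a • X.mode 0 x v
      simp)
    lie_smul := fun a x v => Subtype.ext (by
      change X.mode 0 x (a • (v : M)) = a • X.mode 0 x v
      simp) }

lemma casimir_coe (W : Submodule ℂ M) (hW : ∀ x, ∀ v ∈ W, X.mode 0 x v ∈ W)
    (hW1 : W ≤ X.killed 1) (v : W) :
    letI := X.zeroModeLieRingModule W hW
    haveI := X.zeroModeLieModule W hW
    W.subtype (casimir W b v) = X.sugawara b (W.subtype v) := by
  letI := X.zeroModeLieRingModule W hW
  haveI := X.zeroModeLieModule W hW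
  have h1 : X.sugawara b (v : M) = X.diag b 0 v :=
    X.sugawara_eq_diag_zero b fun n hn x => hW1 v.2 n (by exact_mod_cast hn) x
  have h2 : ∀ (x : 𝔤) (v : W), ((⁅x, v⁆ : W) : M) = X.mode 0 x v := fun x v => rfl
  simp only [Submodule.subtype_apply, h1, casimir, diag, LinearMap.sum_apply, End.mul_apply,
    LieModule.toEnd_apply_apply, Submodule.coe_sum, h2, neg_zero]

include hloc

lemma exists_zeroMode_stable {v : M} (hv : v ∈ X.killed 1) :
    ∃ W : Submodule ℂ M, FiniteDimensional ℂ W ∧ v ∈ W ∧ W ≤ X.killed 1 ∧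
      ∀ x, ∀ v ∈ W, X.mode 0 x v ∈ W := by
  obtain ⟨W, hW, hvW, hst⟩ := exists_finiteDimensional_stable b (X.mode 0) X.mode_zero_lie v
    (fun i => hloc i 0 v)
  refine ⟨W ⊓ X.killed 1, Submodule.finiteDimensional_of_le inf_le_left, ⟨hvW, hv⟩, inf_le_right,
    fun x u hu => ⟨hst x u hu.1, ?_⟩⟩
  exact X.mode_mem_killed le_rfl hu.2 0 x

/-- The base of the induction: `T` is the Casimir operator on a finite-dimensional stable space, so
only `j = 0` occurs. -/
lemma isGood_of_mem_killed_one {v : M} (hv : v ∈ X.killed 1) : X.IsGood b v := by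
  obtain ⟨W, hfd, hvW, hW1, hst⟩ := X.exists_zeroMode_stable b hloc hv
  letI := X.zeroModeLieRingModule W hst
  haveI := X.zeroModeLieModule W hst
  obtain ⟨P, hP0, hP, hPc⟩ := exists_polynomial_casimir (W := W) b
  refine ⟨P, hP0, fun z hz => ?_, ?_⟩
  · obtain ⟨r, hr, rfl⟩ := hP z hz
    exact ⟨r, 0, hr, by simp⟩
  · have := aeval_intertwine W.subtype (casimir W b) (X.sugawara b)
      (X.casimir_coe b W hst hW1) P ⟨v, hvW⟩
    rw [hPc] at this
    exact this.symm

/-- On vectors killed by the modes above `k`, the modes of degree `k` commute, since their brackets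
have degree `2k > k`. Then `word_mem` applies with `U = ⊥`. -/
lemma word_eq_zero {k : ℕ} (hk : 1 ≤ k) {v : M} (hv : v ∈ X.killed (k + 1)) :
    ∃ r : ℕ, ∀ l : List (Fin d), l.length = r → (l.map fun i => X.mode k (b i)).prod v = 0 := by
  choose N hN using fun i => hloc i k v
  refine ⟨∑ i, N i + 1, fun l hl => ?_⟩
  have := word_mem (fun l : List (Fin d) => (l.map fun i => X.mode k (b i)).prod v) ⊥
    (∑ i, N i + 1) ?_ N ?_ (Nat.lt_succ_self _) l hl
  · simpa using this
  · intro l₁ l₂ i j _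
    have hmem : ∀ l : List (Fin d), (l.map fun i => X.mode k (b i)).prod v ∈ X.killed (k + 1) := by
      intro l
      induction l with
      | nil => simpa using hv
      | cons i l ih =>
        rw [List.map_cons, List.prod_cons, End.mul_apply]
        exact X.mode_mem_killed (by omega) ih k (b i)
    set u := (l₂.map fun i => X.mode k (b i)).prod v with hu
    have hc : X.mode k (b i) (X.mode k (b j) u) = X.mode k (b j) (X.mode k (b i) u) := by
      have h := congrArg (fun φ : End ℂ M => φ u) (X.comm k k (b i) (b j))
      simp only [LinearMap.sub_apply, End.mul_apply, LinearMap.add_apply] at h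
      rw [hmem l₂ (k + k) (by push_cast; omega), if_neg (by omega), zero_smul,
        LinearMap.zero_apply, add_zero, sub_eq_zero] at h
      exact h
    simp only [List.map_append, List.map_cons, List.prod_append, List.prod_cons, End.mul_apply,
      ← hu, hc, sub_self, Submodule.mem_bot]
  · intro l i
    simp [hN]

/-- Induction on the length of words in degree-`k` modes that kill `v`. The vectors `x_k v` are good
by induction; shifting and multiplying their polynomials gives `Q` with `Q(T) v` killed by degree
`k` as well. That vector is good by hypothesis, and its polynomial times `Q` kills `v`. The shift
turns `j` into `j + k`. -/
lemma isGood_step {k : ℕ} (hk : 1 ≤ k) (hgood : ∀ v ∈ X.killed k, X.IsGood b v) :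
    ∀ v ∈ X.killed (k + 1), X.IsGood b v := by
  suffices h : ∀ (r : ℕ), ∀ v ∈ X.killed (k + 1),
      (∀ l : List (Fin d), l.length = r → (l.map fun i => X.mode k (b i)).prod v = 0) →
      X.IsGood b v by
    intro v hv
    obtain ⟨r, hr⟩ := X.word_eq_zero b hloc hk hv
    exact h r v hv hr
  intro r
  induction r with
  | zero =>
    intro v _ h
    have hv0 : v = 0 := by simpa using h [] rfl
    refine ⟨1, one_ne_zero, fun z hz => ?_, by rw [hv0, map_zero]⟩
    simp [Polynomial.IsRoot] at hz
  | succ r ih =>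
    intro v hv h
    have hi : ∀ i, X.IsGood b (X.mode k (b i) v) := by
      intro i
      refine ih _ (X.mode_mem_killed (by omega) hv k (b i)) fun l hl => ?_
      have := h (l ++ [i]) (by simp [hl])
      simpa using this
    choose P hP0 hPr hPv using hi
    set s : ℂ := 2 * k * (c + 1 / 2)
    have hcomp : ∀ i, ((P i).comp (Polynomial.X - Polynomial.C s)).comp
        (Polynomial.X + Polynomial.C s) = P i := by
      intro i
      rw [Polynomial.comp_assoc]
      simp
    set Q := ∏ i, (P i).comp (Polynomial.X - Polynomial.C s) with hQ
    have hQ0 : Q ≠ 0 := by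
      rw [hQ, Finset.prod_ne_zero_iff]
      intro i _ h0
      apply hP0 i
      rw [← hcomp i, h0, Polynomial.zero_comp]
    have hQr : ∀ z, Q.IsRoot z → ∃ (r : ℚ) (j : ℕ), 0 ≤ r ∧ z = r + 2 * j * (c + 1 / 2) := by
      intro z hz
      rw [Polynomial.IsRoot, hQ, Polynomial.eval_prod, Finset.prod_eq_zero_iff] at hz
      obtain ⟨i, -, hi⟩ := hz
      rw [Polynomial.eval_comp] at hi
      obtain ⟨r, j, hr, hj⟩ := hPr i _ hi
      refine ⟨r, j + k, hr, ?_⟩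
      simp only [Polynomial.eval_sub, Polynomial.eval_X, Polynomial.eval_C] at hj
      rw [sub_eq_iff_eq_add] at hj
      rw [hj]
      push_cast
      ring
    -- Moving `x_k` past `Q(T)` shifts `Q` by `s`, after which `P i` is a factor and kills `x_k v`
    -- for `x = b i`.
    have hu : Polynomial.aeval (X.sugawara b) Q v ∈ X.killed k := by
      intro n hn x
      rcases hn.eq_or_lt with rfl | hlt
      · rw [← b.sum_repr x, map_sum, LinearMap.sum_apply]
        refine Finset.sum_eq_zero fun i _ => ?_
        rw [map_smul, LinearMap.smul_apply, X.sugawara_intertwine b]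
        have : Q.comp (Polynomial.X + Polynomial.C s) = (∏ j ∈ Finset.univ.erase i,
            (P j)) * P i := by
          rw [hQ, Polynomial.prod_comp, Finset.prod_erase_mul _ _ (Finset.mem_univ i)]
          exact Finset.prod_congr rfl fun j _ => hcomp j
        rw [this, map_mul, End.mul_apply, hPv, map_zero, smul_zero]
      · exact X.aeval_mem_killed b hv Q n (by push_cast; omega) x
    obtain ⟨R, hR0, hRr, hRu⟩ := hgood _ hu
    refine ⟨R * Q, mul_ne_zero hR0 hQ0, fun z hz => ?_, ?_⟩
    · rcases Polynomial.root_mul.mp hz with h | h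
      · exact hRr z h
      · exact hQr z h
    · rw [map_mul, End.mul_apply, hRu]

lemma isGood_of_locallyNilpotent (v : M) : X.IsGood b v := by
  have h : ∀ k : ℕ, 1 ≤ k → ∀ v ∈ X.killed k, X.IsGood b v := by
    intro k hk
    induction k, hk using Nat.le_induction with
    | base => exact fun v hv => X.isGood_of_mem_killed_one b hloc hv
    | succ k hk ih => exact X.isGood_step b hloc hk ih
  obtain ⟨N, hN⟩ := X.smooth v
  exact h (N + 1) (by omega) v fun n hn x => hN n (by push_cast at hn; omega) x

/-- A lift is projected to the generalized kernel of `T`. There `hc` excludes any nonzero value of a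
positive mode, and nilpotency of the Casimir operator excludes any nonzero value of a zero mode. -/
theorem exists_vacuum_lift
    (hc : ∀ (r : ℚ) (j k : ℕ), 0 ≤ r → 1 ≤ k →
      (r : ℂ) + 2 * j * (c + 1 / 2) ≠ -(2 * k * (c + 1 / 2)))
    {M' : Type w} [AddCommGroup M'] [Module ℂ M'] (X' : ModeRep 𝔤 c M')
    (p : M →ₗ[ℂ] M') (hp : ∀ n x v, p (X.mode n x v) = X'.mode n x (p v))
    (hsurj : Function.Surjective p) {u : M'} (hu : u ∈ X'.killed 0) :
    ∃ v ∈ X.killed 0, p v = u := by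
  have hTu : X'.sugawara b u = 0 := by
    rw [X'.sugawara_eq_diag_zero b fun n hn x => hu n (by omega) x]
    simp only [diag, LinearMap.sum_apply, End.mul_apply]
    exact Finset.sum_eq_zero fun i _ => by rw [hu 0 le_rfl, map_zero]
  obtain ⟨v₀, rfl⟩ := hsurj u
  obtain ⟨P, hP0, -, hPv⟩ := X.isGood_of_locallyNilpotent b hloc v₀
  -- Write `P = X^a Q` with `Q(0) ≠ 0`. Then `Q(T)/Q(0)` maps `v₀` into the kernel of `T^a` without
  -- changing its image under `p`, because `T` kills that image.
  obtain ⟨Q, hQ, hQd⟩ := Polynomial.exists_eq_pow_rootMultiplicity_mul_and_not_dvd P hP0 0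
  set a := P.rootMultiplicity 0
  rw [Polynomial.dvd_iff_isRoot, Polynomial.IsRoot] at hQd
  rw [map_zero, sub_zero] at hQ
  set v := (Q.eval 0)⁻¹ • Polynomial.aeval (X.sugawara b) Q v₀ with hv
  have hpv : p v = p v₀ := by
    rw [hv, map_smul, aeval_intertwine p (X.sugawara b) (X'.sugawara b)
      (X.sugawara_map b X' p hp)]
    have : Polynomial.aeval (X'.sugawara b) Q (p v₀) = Q.eval 0 • p v₀ := by
      conv_lhs => rw [← Polynomial.divX_mul_X_add Q]
      rw [map_add, map_mul, Polynomial.aeval_X, Polynomial.aeval_C, LinearMap.add_apply,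
        End.mul_apply, hTu, map_zero, zero_add, Module.algebraMap_end_apply,
        Polynomial.coeff_zero_eq_eval_zero]
    rw [this, smul_smul, inv_mul_cancel₀ hQd, one_smul]
  have hTa : Polynomial.aeval (X.sugawara b) (Polynomial.X ^ a : Polynomial ℂ) v = 0 := by
    rw [hv, map_smul, ← End.mul_apply, ← map_mul, ← hQ, hPv, smul_zero]
  have hv1 : v ∈ X.killed 1 := by
    intro n hn x
    lift n to ℕ using by omega
    have hn1 : 1 ≤ n := by exact_mod_cast hn
    obtain ⟨R, hR0, hRr, hRv⟩ := X.isGood_of_locallyNilpotent b hloc (X.mode n x v)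
    have h1 := X.sugawara_intertwine b n x (Polynomial.X ^ a) v
    rw [hTa, map_zero, Polynomial.X_pow_comp] at h1
    -- The vector `x_n v` is killed by `(T + s)^a` with `s = 2n(c + 1/2)` and by `R(T)`. By `hc`,
    -- `-s` is not a root of `R`, so a Bézout relation gives `x_n v = 0`.
    have hcop : IsCoprime ((Polynomial.X + Polynomial.C (2 * n * (c + 1 / 2) : ℂ)) ^ a) R := by
      refine IsCoprime.pow_left ?_
      have e : (Polynomial.X + Polynomial.C (2 * n * (c + 1 / 2) : ℂ))
          = Polynomial.X - Polynomial.C (-(2 * n * (c + 1 / 2))) := by simp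
      rw [e, (Polynomial.irreducible_X_sub_C _).coprime_iff_not_dvd, Polynomial.dvd_iff_isRoot]
      intro hroot
      obtain ⟨r, j, hr, hj⟩ := hRr _ hroot
      exact hc r j n hr hn1 hj.symm
    obtain ⟨A, B, hAB⟩ := hcop
    have := congrArg (fun F => Polynomial.aeval (X.sugawara b) F (X.mode n x v)) hAB
    simp only [map_add, map_mul, LinearMap.add_apply, End.mul_apply, hRv, map_zero, add_zero,
      map_one, End.one_apply] at this
    rw [← this]
    have h2 := h1.symm
    simp only [map_pow, map_add, map_mul] at h2
    simp only [map_pow, map_add, map_mul, h2, map_zero]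
  refine ⟨v, ?_, hpv⟩
  obtain ⟨W, hfd, hvW, hW1, hst⟩ := X.exists_zeroMode_stable b hloc hv1
  -- Intersecting with `ker T^a` makes the Casimir operator nilpotent on the whole space; stability
  -- holds since `T` commutes with zero modes.
  let W₀ : Submodule ℂ M := W ⊓ LinearMap.ker (X.sugawara b ^ a)
  have hst₀ : ∀ x, ∀ v ∈ W₀, X.mode 0 x v ∈ W₀ := by
    intro x w hw
    refine ⟨hst x w hw.1, ?_⟩
    have h1 := X.sugawara_intertwine b 0 x (Polynomial.X ^ a) w
    have h2 : (X.sugawara b ^ a) w = 0 := hw.2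
    simp only [Nat.cast_zero, mul_zero, zero_mul, map_zero, add_zero, Polynomial.X_pow_comp,
      map_pow, Polynomial.aeval_X, h2] at h1
    exact h1.symm
  have : FiniteDimensional ℂ W₀ := Submodule.finiteDimensional_of_le inf_le_left
  letI := X.zeroModeLieRingModule W₀ hst₀
  haveI := X.zeroModeLieModule W₀ hst₀
  have hnil : IsNilpotent (casimir W₀ b) := by
    refine ⟨a, ?_⟩
    ext w
    have := aeval_intertwine W₀.subtype (casimir W₀ b) (X.sugawara b)
      (X.casimir_coe b W₀ hst₀ (inf_le_left.trans hW1)) (Polynomial.X ^ a) w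
    rw [map_pow, Polynomial.aeval_X, map_pow, Polynomial.aeval_X] at this
    have h2 : (X.sugawara b ^ a) (w : M) = 0 := w.2.2
    exact this.trans h2
  have hvW₀ : v ∈ W₀ := ⟨hvW, by
    rw [map_pow, Polynomial.aeval_X] at hTa
    exact hTa⟩
  intro n hn x
  rcases hn.eq_or_lt with rfl | hlt
  · exact congrArg Subtype.val (lie_eq_zero_of_casimir_nilpotent b hnil x ⟨v, hvW₀⟩)
  · have h0 : (0 : ℤ) < n := by simpa using hlt
    exact hv1 n (by push_cast; omega) x

end ModeRep

/-! ### Unipotent one-parameter subgroups of the adjoint group -/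

section OneParameter

variable {𝔤 : Type u} [LieRing 𝔤] [LieAlgebra ℂ 𝔤]

lemma ad_tmul_pow {A : Type*} [CommRing A] [Algebra ℂ A] (a : A) (x : 𝔤) (n : ℕ) (f : A) (y : 𝔤) :
    (ad A (A ⊗[ℂ] 𝔤) (a ⊗ₜ x) ^ n) (f ⊗ₜ y) = (a ^ n * f) ⊗ₜ ((ad ℂ 𝔤 x ^ n) y) := by
  induction n with
  | zero => simp
  | succ n ih =>
    rw [pow_succ', End.mul_apply, ih, ad_apply, ExtendScalars.bracket_tmul, ← mul_assoc,
      ← pow_succ', pow_succ' (ad ℂ 𝔤 x), End.mul_apply, ad_apply]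

lemma ad_tmul_pow_eq_zero {A : Type*} [CommRing A] [Algebra ℂ A] (a : A) {x : 𝔤} {n : ℕ}
    (hx : ad ℂ 𝔤 x ^ n = 0) : ad A (A ⊗[ℂ] 𝔤) (a ⊗ₜ x) ^ n = 0 := by
  refine LinearMap.ext fun z => ?_
  induction z with
  | zero => simp
  | add z z' h h' => rw [map_add, h, h']; simp
  | tmul f y => rw [ad_tmul_pow, hx]; simp

/-- The rational structure on a complex vector space. -/
abbrev ratModule (V : Type*) [AddCommGroup V] [Module ℂ V] : Module ℚ V :=
  Module.compHom V (algebraMap ℚ ℂ)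

/-- Nilpotency of `ad x` passes to `ad (a ⊗ x)`, and the exponential of a nilpotent derivation is a
Lie automorphism. Keeping the factors `1/i!` in `ℂ` makes the formula compatible with base change.
-/
lemma exists_expAd {A : Type*} [CommRing A] [Algebra ℂ A] (a : A) {x : 𝔤} {n : ℕ}
    (hx : ad ℂ 𝔤 x ^ n = 0) :
    ∃ φ : (A ⊗[ℂ] 𝔤) ≃ₗ⁅A⁆ (A ⊗[ℂ] 𝔤), ∀ z,
      φ z = ∑ i ∈ Finset.range n, ((i.factorial : ℂ)⁻¹) • (ad A (A ⊗[ℂ] 𝔤) (a ⊗ₜ x) ^ i) z := by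
  let _ : LieAlgebra ℚ (A ⊗[ℂ] 𝔤) :=
    { toModule := ratModule (A ⊗[ℂ] 𝔤), lie_smul := fun q y z => lie_smul (q : ℂ) y z }
  have hc : (LieDerivation.ad A (A ⊗[ℂ] 𝔤) (a ⊗ₜ x)).toLinearMap = ad A (A ⊗[ℂ] 𝔤) (a ⊗ₜ x) :=
    LieDerivation.coe_ad_apply_eq_ad_apply _
  have h0 := ad_tmul_pow_eq_zero a hx
  rw [← hc] at h0
  have hn : IsNilpotent (LieDerivation.ad A (A ⊗[ℂ] 𝔤) (a ⊗ₜ x)).toLinearMap := ⟨n, h0⟩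
  refine ⟨LieDerivation.exp (LieDerivation.ad A (A ⊗[ℂ] 𝔤) (a ⊗ₜ x)) hn, fun z => ?_⟩
  rw [LieDerivation.exp_map_apply, IsNilpotent.exp_eq_sum h0, LinearMap.sum_apply, hc]
  refine Finset.sum_congr rfl fun i _ => ?_
  have hq : ∀ (q : ℚ) (z : A ⊗[ℂ] 𝔤), q • z = (q : ℂ) • z := fun _ _ => rfl
  rw [LinearMap.smul_apply, hq]
  push_cast
  rfl

/-- The automorphism `exp (a ad x)` of `𝔤 ⊗ A`. -/
def expAd (A : Type*) [CommRing A] [Algebra ℂ A] (x : 𝔤) (hx : IsNilpotent (ad ℂ 𝔤 x)) (a : A) :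
    (A ⊗[ℂ] 𝔤) ≃ₗ⁅A⁆ (A ⊗[ℂ] 𝔤) :=
  (exists_expAd a (pow_nilpotencyClass hx)).choose

variable {x : 𝔤} (hx : IsNilpotent (ad ℂ 𝔤 x))

lemma expAd_tmul {A : Type*} [CommRing A] [Algebra ℂ A] (a f : A) (y : 𝔤) :
    expAd A x hx a (f ⊗ₜ y)
      = ∑ i ∈ Finset.range (nilpotencyClass (ad ℂ 𝔤 x)), (a ^ i * f) ⊗ₜ (((i.factorial : ℂ)⁻¹) • (ad ℂ 𝔤 x ^ i) y) := by
  rw [expAd, (exists_expAd a (pow_nilpotencyClass hx)).choose_spec]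
  refine Finset.sum_congr rfl fun i _ => ?_
  rw [ad_tmul_pow, TensorProduct.tmul_smul]

lemma expAd_map {A B : Type*} [CommRing A] [Algebra ℂ A] [CommRing B] [Algebra ℂ B] (f : A →ₐ[ℂ] B)
    (a : A) (z : A ⊗[ℂ] 𝔤) :
    LinearMap.rTensor 𝔤 f.toLinearMap (expAd A x hx a z)
      = expAd B x hx (f a) (LinearMap.rTensor 𝔤 f.toLinearMap z) := by
  induction z with
  | zero => simp
  | add z z' h h' => simp only [map_add, h, h']
  | tmul g y => simp [expAd_tmul]

lemma expAd_add {A : Type*} [CommRing A] [Algebra ℂ A] (a a' : A) (z : A ⊗[ℂ] 𝔤) :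
    expAd A x hx (a + a') z = expAd A x hx a (expAd A x hx a' z) := by
  let _ : Module ℚ (End A (A ⊗[ℂ] 𝔤)) := ratModule _
  have hform : ∀ a : A, ((expAd A x hx a).toLinearEquiv : End A (A ⊗[ℂ] 𝔤))
      = IsNilpotent.exp (ad A (A ⊗[ℂ] 𝔤) (a ⊗ₜ x)) := by
    intro a
    rw [IsNilpotent.exp_eq_sum (ad_tmul_pow_eq_zero a (pow_nilpotencyClass hx))]
    ext z
    have := (exists_expAd a (pow_nilpotencyClass hx)).choose_spec (1 ⊗ₜ z)
    simp only [LinearMap.sum_apply, TensorProduct.AlgebraTensorModule.curry_apply,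
      TensorProduct.curry_apply, LinearMap.coe_restrictScalars]
    refine this.trans (Finset.sum_congr rfl fun i _ => ?_)
    have hq : ∀ (q : ℚ) (z : End A (A ⊗[ℂ] 𝔤)), q • z = (q : ℂ) • z := fun _ _ => rfl
    rw [hq, LinearMap.smul_apply]
    push_cast
    rfl
  have hcomm : Commute (ad A (A ⊗[ℂ] 𝔤) (a ⊗ₜ x)) (ad A (A ⊗[ℂ] 𝔤) (a' ⊗ₜ x)) := by
    refine LinearMap.ext fun z => ?_
    simp only [End.mul_apply, ad_apply]
    rw [leibniz_lie, ExtendScalars.bracket_tmul, lie_self, TensorProduct.tmul_zero, zero_lie,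
      zero_add]
  have h := IsNilpotent.exp_add_of_commute hcomm ⟨_, ad_tmul_pow_eq_zero a (pow_nilpotencyClass hx)⟩
    ⟨_, ad_tmul_pow_eq_zero a' (pow_nilpotencyClass hx)⟩
  rw [← map_add, ← TensorProduct.add_tmul, ← hform, ← hform, ← hform] at h
  exact congrArg (fun φ : End A (A ⊗[ℂ] 𝔤) => φ z) h

/-- At each geometric point the base change is a single generator `exp (ad (f a ⊗ x))` of the inner
automorphism group. -/
lemma expAd_mem {A : Type} [CommRing A] [Algebra ℂ A] (a : A) :
    (expAd A x hx a).toLinearEquiv ∈ adjointGroup 𝔤 A := by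
  refine ⟨fun y z => (expAd A x hx a).map_lie y z, fun K _ _ _ f => ?_⟩
  refine ⟨(expAd K x hx (f a)).toLinearEquiv, ?_, fun z => expAd_map hx f a z⟩
  refine Subgroup.subset_closure ⟨f a ⊗ₜ x, (nilpotencyClass (ad ℂ 𝔤 x)), ad_tmul_pow_eq_zero _ (pow_nilpotencyClass hx),
    fun y => ?_⟩
  refine ((exists_expAd (f a) (pow_nilpotencyClass hx)).choose_spec y).trans ?_
  refine Finset.sum_congr rfl fun i _ => ?_
  rw [← algebraMap_smul K ((i.factorial : ℂ)⁻¹)]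
  simp

/-- The point `exp (a ad x)` of the adjoint group. -/
def expPoint (A : Type) [CommRing A] [Algebra ℂ A] (a : A) : adjointGroup 𝔤 A :=
  ⟨(expAd A x hx a).toLinearEquiv, expAd_mem hx a⟩

lemma expPoint_apply {A : Type} [CommRing A] [Algebra ℂ A] (a : A) (z : A ⊗[ℂ] 𝔤) :
    (expPoint hx A a).1 z = expAd A x hx a z := rfl

lemma expPoint_add {A : Type} [CommRing A] [Algebra ℂ A] (a a' : A) :
    expPoint hx A (a + a') = expPoint hx A a * expPoint hx A a' :=
  Subtype.ext (LinearEquiv.ext fun z => expAd_add hx a a' z)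

lemma expPoint_zero {A : Type} [CommRing A] [Algebra ℂ A] : expPoint hx A 0 = 1 := by
  have := expPoint_add hx (0 : A) 0
  rwa [add_zero, left_eq_mul] at this

lemma expPoint_baseChange {A B : Type} [CommRing A] [Algebra ℂ A] [CommRing B] [Algebra ℂ B]
    (f : A →ₐ[ℂ] B) (a : A) :
    IsBaseChangeAlong f (expPoint hx A a).1.toLinearMap (expPoint hx B (f a)).1.toLinearMap :=
  fun z => expAd_map hx f a z

lemma expPoint_sq_zero {A : Type} [CommRing A] [Algebra ℂ A] {a : A} (ha : a * a = 0)
    (z : A ⊗[ℂ] 𝔤) : (expPoint hx A a).1 z = z + ⁅a ⊗ₜ[ℂ] x, z⁆ := by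
  rw [expPoint_apply]
  induction z with
  | zero => simp
  | add z z' h h' => rw [map_add, h, h', lie_add]; abel
  | tmul f y =>
    rw [expAd_tmul]
    have h2 : ∀ i, 2 ≤ i → a ^ i = 0 := fun i hi => by
      rw [← Nat.sub_add_cancel hi, pow_add, pow_two, ha, mul_zero]
    -- Two vanishing terms are appended so that the terms `i = 0, 1` are present whatever the
    -- nilpotency class.
    have h3 : ∑ i ∈ Finset.range (nilpotencyClass (ad ℂ 𝔤 x)),
        (a ^ i * f) ⊗ₜ[ℂ] (((i.factorial : ℂ)⁻¹) • (ad ℂ 𝔤 x ^ i) y)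
        = ∑ i ∈ Finset.range ((nilpotencyClass (ad ℂ 𝔤 x)) + 2),
          (a ^ i * f) ⊗ₜ[ℂ] (((i.factorial : ℂ)⁻¹) • (ad ℂ 𝔤 x ^ i) y) := by
      rw [Finset.sum_range_add]
      rw [left_eq_add]
      refine Finset.sum_eq_zero fun i _ => ?_
      rw [pow_add (ad ℂ 𝔤 x), (pow_nilpotencyClass hx), zero_mul]
      simp
    rw [h3, add_comm (nilpotencyClass (ad ℂ 𝔤 x)) 2, Finset.sum_range_add]
    rw [Finset.sum_eq_zero (s := Finset.range (nilpotencyClass (ad ℂ 𝔤 x))) fun i _ => by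
      rw [h2 _ (by omega), zero_mul, TensorProduct.zero_tmul]]
    simp [Finset.sum_range_succ]

end OneParameter

/-! ### Modes of a module over the affine algebra -/

/-- The Laurent monomial `t ^ n`. -/
def Laurent.tpow (n : ℤ) : Laurent := (HahnSeries.single n (1 : ℂ) : ℂ⸨X⸩)

lemma Laurent.coeff_tpow (n m : ℤ) : (Laurent.tpow n).coeff m = if m = n then 1 else 0 :=
  (HahnSeries.coeff_single (Γ := ℤ) (R := ℂ)).trans (by congr)

lemma Laurent.tpow_mul (m n : ℤ) : tpow m * tpow n = tpow (m + n) := by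
  change (HahnSeries.single m (1 : ℂ) : ℂ⸨X⸩) * HahnSeries.single n (1 : ℂ) = _
  rw [HahnSeries.single_mul_single, mul_one]; rfl

lemma Laurent.ext {f g : Laurent} (h : ∀ n, f.coeff n = g.coeff n) : f = g :=
  HahnSeries.ext (funext h)

lemma Laurent.ofPowerSeries_X_pow (k : ℕ) : ofPowerSeries (PowerSeries.X ^ k) = tpow k :=
  HahnSeries.ofPowerSeries_X_pow k

lemma Laurent.deriv_tpow (n : ℤ) : (tpow n).deriv = (n : ℂ) • tpow (n - 1) := by
  refine Laurent.ext fun m => ?_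
  rw [coeff_deriv, coeff_smul, coeff_tpow, coeff_tpow]
  by_cases h : m + 1 = n
  · rw [if_pos h, if_pos (by omega), ← h]; push_cast; ring
  · rw [if_neg h, if_neg (by omega)]; ring

lemma residueForm_tpow (m n : ℤ) :
    residueForm (Laurent.tpow m) (Laurent.tpow n) = if m + n = 0 then (n : ℂ) else 0 := by
  rw [residueForm_apply, Laurent.deriv_tpow, Algebra.mul_smul_comm, Laurent.coeff_smul,
    Laurent.tpow_mul, Laurent.coeff_tpow]
  by_cases h : m + n = 0
  · rw [if_pos h, if_pos (by omega), mul_one]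
  · rw [if_neg h, if_neg (by omega), mul_zero]

section Modes

variable {𝔤 : Type u} [LieRing 𝔤] [LieAlgebra ℂ 𝔤]

/-- The inclusion of the loop algebra in `𝔤̂_κ` as a linear map. -/
def Affine.ofLoop (κ : InvariantForm 𝔤) : Loop 𝔤 →ₗ[ℂ] Affine κ where
  toFun a := Affine.mk κ a 0
  map_add' a b := by
    simp only [Affine.mk, map_zero]
    rw [← LieAlgebra.of_add, Prod.mk_add_mk, add_zero]
  map_smul' c a := by
    simp only [Affine.mk, map_zero, RingHom.id_apply]
    rw [← LieAlgebra.of_smul, Prod.smul_mk, smul_zero]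

lemma Affine.mk_eq (κ : InvariantForm 𝔤) (a : Loop 𝔤) (s : ℂ) :
    Affine.mk κ a s = Affine.ofLoop κ a + s • Affine.one κ := by
  change Affine.mk κ a s = Affine.mk κ a 0 + s • Affine.mk κ 0 1
  simp only [Affine.mk, map_zero]
  rw [← LieAlgebra.of_smul, ← LieAlgebra.of_add, Prod.smul_mk, Prod.mk_add_mk, smul_zero, add_zero,
    zero_add, ← map_smul, smul_eq_mul, mul_one]

lemma Affine.eq_mk (κ : InvariantForm 𝔤) (a : Affine κ) : ∃ b s, a = Affine.mk κ b s :=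
  ⟨a.carrier.1, TrivialLieModule.equiv ℂ (Loop 𝔤) ℂ a.carrier.2, rfl⟩

lemma Affine.ofArc_eq (κ : InvariantForm 𝔤) (ξ : Arc 𝔤) :
    Affine.ofArc κ ξ = Affine.ofLoop κ (arcToLoop ξ) := rfl

variable (κ : InvariantForm 𝔤) (M : Type w) [AddCommGroup M] [Module ℂ M]
  [LieRingModule (Affine κ) M] [LieModule ℂ (Affine κ) M]

/-- The action of the loop algebra (up to the cocycle) on a module over `𝔤̂_κ`. -/
def loopAct : Loop 𝔤 →ₗ[ℂ] End ℂ M :=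
  (LieModule.toEnd ℂ (Affine κ) M : Affine κ →ₗ[ℂ] End ℂ M) ∘ₗ Affine.ofLoop κ

variable {M}

lemma loopAct_apply (a : Loop 𝔤) (v : M) : loopAct κ M a v = ⁅Affine.ofLoop κ a, v⁆ := rfl

variable (h1 : ∀ m : M, ⁅Affine.one κ, m⁆ = m)

include h1 in
lemma loopAct_comm (a b : Loop 𝔤) (v : M) :
    loopAct κ M a (loopAct κ M b v) - loopAct κ M b (loopAct κ M a v)
      = loopAct κ M ⁅a, b⁆ v + cocycleForm κ a b • v := by
  simp only [loopAct_apply]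
  rw [← lie_lie]
  change ⁅⁅Affine.mk κ a 0, Affine.mk κ b 0⁆, v⁆ = _
  rw [Affine.mk_lie_mk, Affine.mk_eq, add_lie, smul_lie, h1]

lemma loopAct_tmul_killed {N : ℕ} {v : M}
    (hv : ∀ ξ : Arc 𝔤, ⁅Affine.ofArc κ ((PowerSeries.X ^ N : ℂ⟦X⟧) • ξ), v⁆ = 0)
    (f : ℂ⟦X⟧) (x : 𝔤) :
    loopAct κ M (Laurent.ofPowerSeries (PowerSeries.X ^ N * f) ⊗ₜ x) v = 0 := by
  rw [loopAct_apply]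
  have := hv (f ⊗ₜ x)
  rwa [TensorProduct.smul_tmul', smul_eq_mul, Affine.ofArc_eq] at this

lemma loopAct_tpow_killed {N : ℕ} {v : M}
    (hv : ∀ ξ : Arc 𝔤, ⁅Affine.ofArc κ ((PowerSeries.X ^ N : ℂ⟦X⟧) • ξ), v⁆ = 0)
    (n : ℤ) (hn : N ≤ n) (x : 𝔤) : loopAct κ M (Laurent.tpow n ⊗ₜ x) v = 0 := by
  have := loopAct_tmul_killed κ hv (PowerSeries.X ^ (n - N).toNat) x
  rwa [← pow_add, Laurent.ofPowerSeries_X_pow, show ((N + (n - N).toNat : ℕ) : ℤ) = n by omega]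
    at this

/-- A discrete module over the affine algebra at the level `c` times the Killing form, in terms of
modes. -/
def modeRep {c : ℂ} (hκ : κ.form = c • killingForm ℂ 𝔤)
    (hdisc : ∀ m : M, ∃ N : ℕ, ∀ ξ : Arc 𝔤,
      ⁅Affine.ofArc κ ((PowerSeries.X ^ N : ℂ⟦X⟧) • ξ), m⁆ = 0) : ModeRep 𝔤 c M where
  mode n := loopAct κ M ∘ₗ TensorProduct.mk ℂ Laurent 𝔤 (Laurent.tpow n)
  comm m n x y := by
    refine LinearMap.ext fun v => ?_
    have := loopAct_comm κ h1 (Laurent.tpow m ⊗ₜ x) (Laurent.tpow n ⊗ₜ y) v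
    rw [ExtendScalars.bracket_tmul, Laurent.tpow_mul, cocycleForm_tmul, residueForm_tpow] at this
    simp only [LinearMap.sub_apply, LinearMap.add_apply, End.mul_apply, LinearMap.comp_apply,
      TensorProduct.mk_apply, LinearMap.smul_apply, End.one_apply]
    rw [this, hκ]
    congr 2
    -- The sign of the cocycle matches: `-Res t^m d(t^n) = -n = m` when `m + n = 0`.
    by_cases h : m + n = 0
    · have hn : n = -m := by omega
      simp [hn]; ring
    · simp [h]
  smooth v := by
    obtain ⟨N, hN⟩ := hdisc v
    exact ⟨N, fun n hn x => loopAct_tpow_killed κ hN n hn x⟩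

lemma modeRep_mode {c : ℂ} (hκ : κ.form = c • killingForm ℂ 𝔤)
    (hdisc : ∀ m : M, ∃ N : ℕ, ∀ ξ : Arc 𝔤,
      ⁅Affine.ofArc κ ((PowerSeries.X ^ N : ℂ⟦X⟧) • ξ), m⁆ = 0) (n : ℤ) (x : 𝔤) (v : M) :
    (modeRep κ h1 hκ hdisc).mode n x v = loopAct κ M (Laurent.tpow n ⊗ₜ x) v := rfl

lemma powerSeries_trunc_split (f : ℂ⟦X⟧) (N : ℕ) :
    ∃ g : ℂ⟦X⟧, f = PowerSeries.X ^ N * g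
      + ∑ k ∈ Finset.range N, PowerSeries.coeff k f • PowerSeries.X ^ k := by
  refine ⟨PowerSeries.mk fun i => PowerSeries.coeff (i + N) f, ?_⟩
  ext n
  simp only [map_add, map_sum, map_smul, smul_eq_mul, PowerSeries.coeff_X_pow, mul_ite, mul_one,
    mul_zero, Finset.sum_ite_eq, Finset.mem_range, PowerSeries.coeff_X_pow_mul',
    PowerSeries.coeff_mk]
  by_cases h : N ≤ n
  · rw [if_pos h, if_neg (by omega), Nat.sub_add_cancel h, add_zero]
  · rw [if_neg h, if_pos (by omega), zero_add]

/-- A vector annihilated by all the modes `x ⊗ t ^ n`, `n ≥ 0`, is annihilated by the arcs. -/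
lemma ofArc_lie_eq_zero {v : M} (hdisc : ∃ N : ℕ, ∀ ξ : Arc 𝔤,
      ⁅Affine.ofArc κ ((PowerSeries.X ^ N : ℂ⟦X⟧) • ξ), v⁆ = 0)
    (hv : ∀ (n : ℕ) (x : 𝔤), loopAct κ M (Laurent.tpow n ⊗ₜ x) v = 0) (ξ : Arc 𝔤) :
    ⁅Affine.ofArc κ ξ, v⁆ = 0 := by
  obtain ⟨N, hN⟩ := hdisc
  rw [Affine.ofArc_eq, ← loopAct_apply]
  induction ξ using TensorProduct.induction_on with
  | zero => simp
  | add ξ ξ' h h' => rw [map_add, map_add, LinearMap.add_apply, h, h', add_zero]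
  | tmul f x =>
    change loopAct κ M (Laurent.ofPowerSeries f ⊗ₜ x) v = 0
    obtain ⟨g, hg⟩ := powerSeries_trunc_split f N
    rw [hg, map_add, TensorProduct.add_tmul, map_add, LinearMap.add_apply,
      loopAct_tmul_killed κ hN, zero_add, map_sum, TensorProduct.sum_tmul, map_sum,
      LinearMap.sum_apply]
    refine Finset.sum_eq_zero fun k _ => ?_
    rw [map_smul, Laurent.ofPowerSeries_X_pow, ← TensorProduct.smul_tmul', map_smul,
      LinearMap.smul_apply, hv, smul_zero]

end Modes

/-! ### Integrable modules are locally nilpotent for the nilpotent directions -/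

section LocallyNilpotent

variable {M : Type w} [AddCommGroup M] [Module ℂ M]

/-- The contraction of `R ⊗ M` with a linear functional on `R`. -/
def contract {R : Type*} [CommRing R] [Algebra ℂ R] (g : R →ₗ[ℂ] ℂ) : R ⊗[ℂ] M →ₗ[ℂ] M :=
  TensorProduct.lid ℂ M ∘ₗ LinearMap.rTensor M g

lemma contract_tmul {R : Type*} [CommRing R] [Algebra ℂ R] (g : R →ₗ[ℂ] ℂ) (r : R) (m : M) :
    contract g (r ⊗ₜ m) = g r • m := by simp [contract]

lemma contract_rTensor {R S : Type*} [CommRing R] [Algebra ℂ R] [CommRing S] [Algebra ℂ S]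
    (g : S →ₗ[ℂ] ℂ) (f : R →ₗ[ℂ] S) (z : R ⊗[ℂ] M) :
    contract g (LinearMap.rTensor M f z) = contract (g ∘ₗ f) z := by
  simp [contract, ← LinearMap.rTensor_comp_apply]

variable {𝔤 : Type u} [LieRing 𝔤] [LieAlgebra ℂ 𝔤] {x : 𝔤} (hx : IsNilpotent (ad ℂ 𝔤 x))

lemma extend_smul_lie {A : Type*} [CommRing A] [Algebra ℂ A] (a : A) (y z : A ⊗[ℂ] 𝔤) :
    ⁅a • y, z⁆ = a • ⁅y, z⁆ :=
  LieModule.smul_lie (R := A) a y z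

lemma extend_lie_smul {A : Type*} [CommRing A] [Algebra ℂ A] (a : A) (y z : A ⊗[ℂ] 𝔤) :
    ⁅y, a • z⁆ = a • ⁅y, z⁆ :=
  LieModule.lie_smul (R := A) a y z

/-- The homomorphism `P ↦ P + ε P'`. -/
def polynomialDual : Polynomial ℂ →ₐ[ℂ] DualNumber (Polynomial ℂ) :=
  Polynomial.aeval (TrivSqZeroExt.inl Polynomial.X + DualNumber.eps)

lemma polynomialDual_X :
    polynomialDual Polynomial.X = TrivSqZeroExt.inl Polynomial.X + DualNumber.eps :=
  Polynomial.aeval_X _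

lemma polynomialDual_apply (P : Polynomial ℂ) :
    polynomialDual P = TrivSqZeroExt.inl P + TrivSqZeroExt.inr (Polynomial.derivative P) := by
  induction P using Polynomial.induction_on' with
  | add P Q hP hQ => rw [map_add, hP, hQ, map_add]; ext <;> simp
  | monomial n c =>
    rw [← Polynomial.C_mul_X_pow_eq_monomial]
    induction n with
    | zero =>
      rw [pow_zero, mul_one, ← Polynomial.algebraMap_eq, AlgHom.commutes]
      ext <;> simp [TrivSqZeroExt.algebraMap_eq_inl']
    | succ n ih =>
      rw [pow_succ, ← mul_assoc, map_mul, ih, polynomialDual_X]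
      have h : Polynomial.derivative (Polynomial.C c * Polynomial.X ^ n * Polynomial.X)
          = Polynomial.derivative (Polynomial.C c * Polynomial.X ^ n) * Polynomial.X
            + Polynomial.C c * Polynomial.X ^ n := by
        rw [Polynomial.derivative_mul, Polynomial.derivative_X, mul_one]
      rw [h]
      generalize Polynomial.derivative (Polynomial.C c * Polynomial.X ^ n) = P'
      generalize Polynomial.C c * Polynomial.X ^ n = P
      apply TrivSqZeroExt.ext
      · rw [TrivSqZeroExt.fst_mul]; simp
      · rw [TrivSqZeroExt.snd_mul]; simp [mul_comm, add_comm]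

lemma expPoint_isTangent (k : ℕ) :
    IsTangentPoint ((PowerSeries.X ^ k : ℂ⟦X⟧) ⊗ₜ[ℂ] x)
      (expPoint hx ℂ[ε]⟦X⟧ (PowerSeries.C DualNumber.eps * PowerSeries.X ^ k)) := by
  intro y
  have h : ((PowerSeries.C DualNumber.eps * PowerSeries.X ^ k : ℂ[ε]⟦X⟧)
      * (PowerSeries.C DualNumber.eps * PowerSeries.X ^ k)) = 0 := by
    have : (PowerSeries.C DualNumber.eps * PowerSeries.C DualNumber.eps : ℂ[ε]⟦X⟧) = 0 := by
      rw [← map_mul, DualNumber.eps_mul_eps, map_zero]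
    calc _ = (PowerSeries.C DualNumber.eps * PowerSeries.C DualNumber.eps : ℂ[ε]⟦X⟧)
          * (PowerSeries.X ^ k * PowerSeries.X ^ k) := by ring
      _ = 0 := by rw [this, zero_mul]
  have e : (PowerSeries.C DualNumber.eps * PowerSeries.X ^ k : ℂ[ε]⟦X⟧) ⊗ₜ[ℂ] x
      = (PowerSeries.C DualNumber.eps : ℂ[ε]⟦X⟧) • LinearMap.rTensor 𝔤
        (PowerSeries.mapAlgHom (Algebra.ofId ℂ ℂ[ε])).toLinearMap
          ((PowerSeries.X ^ k : ℂ⟦X⟧) ⊗ₜ[ℂ] x) := by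
    rw [LinearMap.rTensor_tmul, TensorProduct.smul_tmul',
      AlgHom.toLinearMap_apply, map_pow, PowerSeries.mapAlgHom_apply, PowerSeries.map_X,
      smul_eq_mul]
  rw [expPoint_sq_zero hx h, e]
  rw [extend_smul_lie]

variable (κ : InvariantForm 𝔤) [LieRingModule (Affine κ) M] [LieModule ℂ (Affine κ) M]

lemma expPoint_C_baseChange {R S : Type} [CommRing R] [Algebra ℂ R] [CommRing S] [Algebra ℂ S]
    (f : R →ₐ[ℂ] S) (r : R) (k : ℕ) :
    IsBaseChangeAlong (PowerSeries.mapAlgHom f)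
      (expPoint hx R⟦X⟧ (PowerSeries.C r * PowerSeries.X ^ k)).1.toLinearMap
      (expPoint hx S⟦X⟧ (PowerSeries.C (f r) * PowerSeries.X ^ k)).1.toLinearMap := by
  have := expPoint_baseChange hx (PowerSeries.mapAlgHom f) (PowerSeries.C r * PowerSeries.X ^ k)
  rwa [map_mul, map_pow, PowerSeries.mapAlgHom_apply, PowerSeries.mapAlgHom_apply,
    PowerSeries.map_X, PowerSeries.map_C] at this

-- Let `u(r)` be the action of `exp (r t^k ad x)`. The orbit `u(s)(1 ⊗ v)` over `ℂ[s]` is a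
-- polynomial in `s` with coefficients in `M`, and the differential of the action makes it solve `w'
-- = Y w` with `w(0) = v`. Hence `Y^i v = i! φ i`, which vanishes for `i` large.
include hx in
lemma locallyNilpotent_of_isIntegrable (hM : IsIntegrable κ M) (k : ℕ) (v : M) :
    ∃ N : ℕ, (loopAct κ M (Laurent.tpow k ⊗ₜ x) ^ N) v = 0 := by
  obtain ⟨a, ha⟩ := hM.exponentiates
  set Y := loopAct κ M (Laurent.tpow k ⊗ₜ x) with hY
  let u : ∀ (R : Type) [CommRing R] [Algebra ℂ R], R → End R (R ⊗[ℂ] M) := fun R _ _ r =>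
    a.act R (expPoint hx R⟦X⟧ (PowerSeries.C r * PowerSeries.X ^ k))
  have hnat : ∀ {R S : Type} [CommRing R] [Algebra ℂ R] [CommRing S] [Algebra ℂ S]
      (f : R →ₐ[ℂ] S) (r : R) (z : R ⊗[ℂ] M),
      LinearMap.rTensor M f.toLinearMap (u R r z) = u S (f r) (LinearMap.rTensor M f.toLinearMap z) :=
    fun f r z => a.natural f _ _ (expPoint_C_baseChange hx f r k) z
  have hadd : ∀ (R : Type) [CommRing R] [Algebra ℂ R] (r r' : R) (z : R ⊗[ℂ] M),
      u R (r + r') z = u R r (u R r' z) := by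
    intro R _ _ r r' z
    simp only [u]
    rw [map_add, add_mul, expPoint_add, map_mul]
    rfl
  have hzero : ∀ z : ℂ ⊗[ℂ] M, u ℂ 0 z = z := by
    intro z
    simp only [u]
    rw [map_zero, zero_mul, expPoint_zero, map_one]
    rfl
  have htan : ∀ m : M, u ℂ[ε] DualNumber.eps (1 ⊗ₜ m) = 1 ⊗ₜ m + DualNumber.eps ⊗ₜ Y m := by
    intro m
    have := ha _ _ (expPoint_isTangent hx k) m
    rw [Affine.ofArc_eq, ← loopAct_apply] at this
    refine this.trans ?_
    rw [hY, ← Laurent.ofPowerSeries_X_pow]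
    rfl
  -- the orbit map and its Taylor coefficients
  set w : Polynomial ℂ ⊗[ℂ] M := u (Polynomial ℂ) Polynomial.X (1 ⊗ₜ v) with hw
  let φ : ℕ → M := fun i => contract (Polynomial.lcoeff ℂ i) w
  let j : Polynomial ℂ →ₐ[ℂ] DualNumber (Polynomial ℂ) :=
    TrivSqZeroExt.inlAlgHom ℂ (Polynomial ℂ) (Polynomial ℂ)
  have hj : ∀ P, j P = TrivSqZeroExt.inl P := fun _ => rfl
  let e : ℂ[ε] →ₐ[ℂ] DualNumber (Polynomial ℂ) := DualNumber.lift
    ⟨(Algebra.ofId ℂ (DualNumber (Polynomial ℂ)), DualNumber.eps),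
      DualNumber.eps_mul_eps, fun _ => Commute.all _ _⟩
  have heps : ∀ (r : DualNumber (Polynomial ℂ)) (m : M), u (DualNumber (Polynomial ℂ)) DualNumber.eps (r ⊗ₜ m)
      = r ⊗ₜ m + (r * DualNumber.eps) ⊗ₜ Y m := by
    intro r m
    have h := hnat e DualNumber.eps (1 ⊗ₜ m)
    have he : e DualNumber.eps = DualNumber.eps := DualNumber.lift_apply_eps _
    rw [htan, he, map_add, LinearMap.rTensor_tmul, LinearMap.rTensor_tmul, AlgHom.toLinearMap_apply,
      AlgHom.toLinearMap_apply, map_one, he] at h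
    have h' := congrArg (fun z => r • z) h
    simp only [smul_add, TensorProduct.smul_tmul', smul_eq_mul, mul_one] at h'
    rw [h', ← map_smul, TensorProduct.smul_tmul', smul_eq_mul, mul_one]
  -- This is `u(s + ε) = u(ε) u(s)` over `ℂ[s][ε]`: `polynomialDual` is the substitution `s ↦ s +
  -- ε`. The `ε`-part gives the recursion for the Taylor coefficients.
  have key : LinearMap.rTensor M polynomialDual.toLinearMap w
      = u (DualNumber (Polynomial ℂ)) DualNumber.eps (LinearMap.rTensor M j.toLinearMap w) := by
    rw [hw, hnat, hnat, LinearMap.rTensor_tmul, LinearMap.rTensor_tmul, AlgHom.toLinearMap_apply,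
      AlgHom.toLinearMap_apply, map_one, map_one, ← hadd, add_comm]
    rw [polynomialDual_X, hj]
  let g : ℕ → (DualNumber (Polynomial ℂ) →ₗ[ℂ] ℂ) := fun i => Polynomial.lcoeff ℂ i ∘ₗ
    (TrivSqZeroExt.sndHom (Polynomial ℂ) (Polynomial ℂ)).restrictScalars ℂ
  have hg : ∀ i s, g i s = (TrivSqZeroExt.snd s).coeff i := fun _ _ => rfl
  have hrec : ∀ i : ℕ, ((i : ℂ) + 1) • φ (i + 1) = Y (φ i) := by
    intro i
    have h := congrArg (contract (g i)) key
    rw [contract_rTensor] at h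
    have h1 : contract (g i ∘ₗ polynomialDual.toLinearMap) w = ((i : ℂ) + 1) • φ (i + 1) := by
      simp only [φ]
      generalize w = z
      induction z using TensorProduct.induction_on with
      | zero => simp
      | add z z' h h' => simp only [map_add, smul_add, h, h']
      | tmul P m =>
        rw [contract_tmul, contract_tmul, LinearMap.comp_apply, hg, AlgHom.toLinearMap_apply,
          polynomialDual_apply, TrivSqZeroExt.snd_add, TrivSqZeroExt.snd_inl,
          TrivSqZeroExt.snd_inr, zero_add, Polynomial.coeff_derivative, Polynomial.lcoeff_apply, smul_smul, mul_comm]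
    have h2 : contract (g i) (u (DualNumber (Polynomial ℂ)) DualNumber.eps (LinearMap.rTensor M j.toLinearMap w))
        = Y (φ i) := by
      simp only [φ]
      generalize w = z
      induction z using TensorProduct.induction_on with
      | zero => simp
      | add z z' h h' => simp only [map_add, h, h']
      | tmul P m =>
        rw [LinearMap.rTensor_tmul, heps, map_add, contract_tmul, contract_tmul, contract_tmul, hg,
          hg, map_smul, Polynomial.lcoeff_apply, AlgHom.toLinearMap_apply]
        rw [hj, TrivSqZeroExt.snd_mul, TrivSqZeroExt.snd_inl, DualNumber.snd_eps, DualNumber.fst_eps]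
        simp
    rw [← h1, h, h2]
  have h0 : φ 0 = v := by
    have h := hnat (Polynomial.aeval (0 : ℂ)) Polynomial.X (1 ⊗ₜ v)
    rw [Polynomial.aeval_X, hzero, LinearMap.rTensor_tmul, AlgHom.toLinearMap_apply, map_one] at h
    have h' := congrArg (contract LinearMap.id) h
    rw [contract_rTensor, contract_tmul, LinearMap.id_apply, one_smul, LinearMap.id_comp] at h'
    rw [← h']
    refine congrArg (fun g => contract g w) (LinearMap.ext fun P => ?_)
    rw [Polynomial.lcoeff_apply, Polynomial.coeff_zero_eq_aeval_zero]
    rfl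
  have hpow : ∀ i : ℕ, (Y ^ i) v = (i.factorial : ℂ) • φ i := by
    intro i
    induction i with
    | zero => simp [h0]
    | succ i ih =>
      rw [pow_succ', End.mul_apply, ih, map_smul, ← hrec, smul_smul, Nat.factorial_succ]
      congr 1
      push_cast
      ring
  -- An element of `ℂ[s] ⊗ M` is a finite sum of tensors, so it has bounded degree in `s`.
  have hfin : ∀ z : Polynomial ℂ ⊗[ℂ] M, ∃ N, ∀ i, N ≤ i → contract (Polynomial.lcoeff ℂ i) z = 0 := by
    intro z
    induction z with
    | zero => exact ⟨0, fun i _ => map_zero _⟩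
    | add z z' h h' =>
      obtain ⟨N, hN⟩ := h
      obtain ⟨N', hN'⟩ := h'
      exact ⟨N + N', fun i hi => by rw [map_add, hN i (by omega), hN' i (by omega), add_zero]⟩
    | tmul P m =>
      refine ⟨P.natDegree + 1, fun i hi => ?_⟩
      rw [contract_tmul, Polynomial.lcoeff_apply, Polynomial.coeff_eq_zero_of_natDegree_lt (by omega),
        zero_smul]
  obtain ⟨N, hN⟩ := hfin w
  exact ⟨N, by rw [hpow]; exact (congrArg _ (hN N le_rfl)).trans (smul_zero _)⟩

end LocallyNilpotent

/-! ### The universal property of the vacuum Weyl module -/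

section Vacuum

variable {𝔤 : Type u} [LieRing 𝔤] [LieAlgebra ℂ 𝔤] (κ : InvariantForm 𝔤)

/-- The vacuum vector. -/
def vac : VacuumWeyl κ := (vacuumIdeal κ).mkQ 1

lemma smul_vac (s : UniversalEnvelopingAlgebra ℂ (Affine κ)) :
    s • vac κ = (vacuumIdeal κ).mkQ s := by
  have h := map_smul (vacuumIdeal κ).mkQ s 1
  rw [smul_eq_mul, mul_one] at h
  exact h.symm

lemma exists_smul_vac (v : VacuumWeyl κ) :
    ∃ s : UniversalEnvelopingAlgebra ℂ (Affine κ), v = s • vac κ := by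
  obtain ⟨s, hs⟩ := (vacuumIdeal κ).mkQ_surjective v
  exact ⟨s, by rw [smul_vac, hs]⟩

lemma smul_vac_eq_zero {s : UniversalEnvelopingAlgebra ℂ (Affine κ)} (hs : s ∈ vacuumIdeal κ) :
    s • vac κ = 0 := by
  rw [smul_vac]
  exact (Submodule.Quotient.mk_eq_zero _).2 hs

lemma ofArc_lie_vac (ξ : Arc 𝔤) : ⁅Affine.ofArc κ ξ, vac κ⁆ = 0 :=
  smul_vac_eq_zero κ (Submodule.subset_span (Or.inl ⟨ξ, rfl⟩))

lemma one_lie_vac : ⁅Affine.one κ, vac κ⁆ = vac κ := by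
  have := smul_vac_eq_zero κ (Submodule.subset_span (Or.inr rfl))
  rwa [sub_smul, one_smul, sub_eq_zero] at this

/-- The universal property maps the enveloping algebra into `S`; composed with the inclusion, this
is the identity on generators, hence everywhere. -/
lemma enveloping_induction {L : Type*} [LieRing L] [LieAlgebra ℂ L]
    (S : Subalgebra ℂ (UniversalEnvelopingAlgebra ℂ L))
    (hS : ∀ a, UniversalEnvelopingAlgebra.ι ℂ a ∈ S) : S = ⊤ := by
  let := LieRing.ofAssociativeRing (A := S)
  let := LieRing.ofAssociativeRing (A := UniversalEnvelopingAlgebra ℂ L)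
  let F : L →ₗ⁅ℂ⁆ S :=
    { toFun a := ⟨UniversalEnvelopingAlgebra.ι ℂ a, hS a⟩
      map_add' a b := Subtype.ext (map_add _ a b)
      map_smul' c a := Subtype.ext (map_smul _ c a)
      map_lie' := Subtype.ext (LieHom.map_lie _ _ _) }
  have h : S.val.comp (UniversalEnvelopingAlgebra.lift ℂ F) = AlgHom.id ℂ _ := by
    apply UniversalEnvelopingAlgebra.hom_ext
    ext a
    change ((UniversalEnvelopingAlgebra.lift ℂ F (UniversalEnvelopingAlgebra.ι ℂ a) : S) :
      UniversalEnvelopingAlgebra ℂ L) = UniversalEnvelopingAlgebra.ι ℂ a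
    rw [UniversalEnvelopingAlgebra.lift_ι_apply]
    rfl
  rw [eq_top_iff]
  intro s _
  have := congrArg (fun g => g s) h
  change ((UniversalEnvelopingAlgebra.lift ℂ F s : S) : UniversalEnvelopingAlgebra ℂ L) = s at this
  rw [← this]
  exact Subtype.prop _

lemma vacuumWeyl_induction (W : Submodule ℂ (VacuumWeyl κ)) (hvac : vac κ ∈ W)
    (hlie : ∀ a : Affine κ, ∀ v ∈ W, ⁅a, v⁆ ∈ W) : W = ⊤ := by
  let S : Subalgebra ℂ (UniversalEnvelopingAlgebra ℂ (Affine κ)) :=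
    { carrier := {s | ∀ v ∈ W, s • v ∈ W}
      mul_mem' := fun {s t} hs ht v hv => by rw [mul_smul]; exact hs _ (ht v hv)
      add_mem' := fun {s t} hs ht v hv => by rw [add_smul]; exact W.add_mem (hs v hv) (ht v hv)
      algebraMap_mem' := fun c v hv => by rw [algebraMap_smul]; exact W.smul_mem c hv }
  have hS : S = ⊤ := enveloping_induction S hlie
  rw [eq_top_iff]
  intro v _
  obtain ⟨s, rfl⟩ := exists_smul_vac κ v
  have hs : s ∈ S := hS ▸ Algebra.mem_top
  exact hs _ hvac

variable {M : Type w} [AddCommGroup M] [Module ℂ M]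

/-- The action is a map `F` and not an instance, so that the same statement serves ordinary modules
and the twisted actions on `R ⊗ V`. -/
lemma exists_vacuumWeyl_lift (F : Affine κ →ₗ[ℂ] End ℂ M)
    (hF : ∀ a b, F ⁅a, b⁆ = F a * F b - F b * F a) {m : M}
    (harc : ∀ ξ, F (Affine.ofArc κ ξ) m = 0) (hone : F (Affine.one κ) m = m) :
    ∃ h : VacuumWeyl κ →ₗ[ℂ] M, h (vac κ) = m ∧ ∀ a v, h ⁅a, v⁆ = F a (h v) := by
  let := LieRing.ofAssociativeRing (A := End ℂ M)
  let F' : Affine κ →ₗ⁅ℂ⁆ End ℂ M := { F with map_lie' := fun {a b} => hF a b }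
  let Φ := UniversalEnvelopingAlgebra.lift ℂ F'
  have hΦ : ∀ a, Φ (UniversalEnvelopingAlgebra.ι ℂ a) = F a := fun a =>
    UniversalEnvelopingAlgebra.lift_ι_apply ℂ F' a
  let _ : Module (UniversalEnvelopingAlgebra ℂ (Affine κ)) M := Module.compHom M Φ.toRingHom
  have hsm : ∀ (s : UniversalEnvelopingAlgebra ℂ (Affine κ)) (x : M), s • x = Φ s x :=
    fun _ _ => rfl
  have hle : vacuumIdeal κ ≤ LinearMap.ker
      (LinearMap.toSpanSingleton (UniversalEnvelopingAlgebra ℂ (Affine κ)) M m) := by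
    refine Submodule.span_le.2 ?_
    rintro _ (⟨ξ, rfl⟩ | rfl)
    · rw [SetLike.mem_coe, LinearMap.mem_ker, LinearMap.toSpanSingleton_apply, hsm, hΦ, harc]
    · rw [SetLike.mem_coe, LinearMap.mem_ker, LinearMap.toSpanSingleton_apply, hsm, map_sub, hΦ,
        map_one, LinearMap.sub_apply, hone, End.one_apply, sub_self]
  let H : VacuumWeyl κ →ₗ[UniversalEnvelopingAlgebra ℂ (Affine κ)] M :=
    (vacuumIdeal κ).liftQ _ hle
  refine ⟨{ toFun := H, map_add' := map_add H, map_smul' := fun c v => ?_ }, ?_, fun a v => ?_⟩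
  · rw [← algebraMap_smul (UniversalEnvelopingAlgebra ℂ (Affine κ)) c v, map_smul, hsm,
      AlgHom.commutes]
    rfl
  · exact ((vacuumIdeal κ).liftQ_apply (h := hle) _ _).trans
      (one_smul (UniversalEnvelopingAlgebra ℂ (Affine κ)) m)
  · change H (UniversalEnvelopingAlgebra.ι ℂ a • v) = F a (H v)
    rw [map_smul, hsm, hΦ]

lemma vacuumWeyl_hom_ext (F : Affine κ → M → M) {h h' : VacuumWeyl κ →ₗ[ℂ] M}
    (hh : ∀ a v, h ⁅a, v⁆ = F a (h v)) (hh' : ∀ a v, h' ⁅a, v⁆ = F a (h' v))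
    (hvac : h (vac κ) = h' (vac κ)) : h = h' := by
  have := vacuumWeyl_induction κ (LinearMap.eqLocus h h') hvac fun a v hv => by
    rw [LinearMap.mem_eqLocus] at hv ⊢
    rw [hh, hh', hv]
  exact LinearMap.ext fun v => (this ▸ Submodule.mem_top : v ∈ LinearMap.eqLocus h h')

/-! ### Lifting morphisms from the vacuum Weyl module -/

/-- At a positive level the left side is nonnegative and the right side negative. At an irrational
level equality would give `c + 1/2 = -r / (2(j + k))`, a rational number. -/
lemma level_condition (hκ : κ.IsPositive ∨ κ.IsIrrational) :
    ∃ c : ℂ, κ.form = c • killingForm ℂ 𝔤 ∧ ∀ (r : ℚ) (j k : ℕ), 0 ≤ r → 1 ≤ k →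
      (r : ℂ) + 2 * j * (c + 1 / 2) ≠ -(2 * k * (c + 1 / 2)) := by
  obtain ⟨c, hc, q, hq, hcq⟩ | ⟨c, hc, hirr⟩ := hκ
  · refine ⟨c, hc, fun r j k hr hk h => ?_⟩
    rw [hcq] at h
    have h' : r + 2 * j * q = -(2 * k * q) := by exact_mod_cast h
    have hk' : (1 : ℚ) ≤ k := by exact_mod_cast hk
    have hj' : (0 : ℚ) ≤ j := by positivity
    have : 0 < 2 * k * q := by positivity
    have : 0 ≤ 2 * j * q := by positivity
    linarith
  · refine ⟨c, hc, fun r j k _ hk h => hirr (-(r / (2 * (j + k))) - 1 / 2) ?_⟩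
    have hk' : ((j : ℂ) + k) ≠ 0 := by
      have : j + k ≠ 0 := by omega
      exact_mod_cast this
    push_cast
    field_simp
    linear_combination h

theorem vacuumWeyl_lifting [FiniteDimensional ℂ 𝔤] [IsSimple ℂ 𝔤]
    (hκ : κ.IsPositive ∨ κ.IsIrrational) (M N : Type w)
    [AddCommGroup M] [Module ℂ M] [LieRingModule (Affine κ) M]
    [LieModule ℂ (Affine κ) M] [AddCommGroup N] [Module ℂ N] [LieRingModule (Affine κ) N]
    [LieModule ℂ (Affine κ) N] (hM : IsIntegrable κ M) (hN : IsIntegrable κ N)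
    (p : M →ₗ⁅ℂ, Affine κ⁆ N) (hp : Function.Surjective p)
    (f : VacuumWeyl κ →ₗ⁅ℂ, Affine κ⁆ N) : ∃ h : VacuumWeyl κ →ₗ⁅ℂ, Affine κ⁆ M, p.comp h = f := by
  obtain ⟨c, hform, hc⟩ := level_condition κ hκ
  obtain ⟨d, b, hb⟩ := exists_basis_adNilpotent 𝔤
  have hu : f (vac κ) ∈ (modeRep κ hN.one_lie hform hN.discrete).killed 0 := by
    intro n hn x
    obtain ⟨k, rfl⟩ := Int.eq_ofNat_of_zero_le hn
    rw [modeRep_mode, ← Laurent.ofPowerSeries_X_pow, loopAct_apply]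
    have : f ⁅Affine.ofArc κ ((PowerSeries.X ^ k) ⊗ₜ x), vac κ⁆ = 0 := by
      rw [ofArc_lie_vac, map_zero]
    rwa [LieModuleHom.map_lie] at this
  obtain ⟨m, hm, hpm⟩ := (modeRep κ hM.one_lie hform hM.discrete).exists_vacuum_lift b
    (fun i k v => locallyNilpotent_of_isIntegrable (hb i) κ hM k v) hc
    (modeRep κ hN.one_lie hform hN.discrete) (p : M →ₗ[ℂ] N)
    (fun n x v => p.map_lie _ _) hp hu
  have hmarc : ∀ ξ : Arc 𝔤, ⁅Affine.ofArc κ ξ, m⁆ = 0 :=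
    ofArc_lie_eq_zero κ (hM.discrete m) fun n x => hm n (by positivity) x
  obtain ⟨h, hvac, hlie⟩ := exists_vacuumWeyl_lift κ
    (LieModule.toEnd ℂ (Affine κ) M : Affine κ →ₗ[ℂ] End ℂ M)
    (fun a b => LinearMap.ext fun v => lie_lie a b v) hmarc (hM.one_lie m)
  let h' : VacuumWeyl κ →ₗ⁅ℂ, Affine κ⁆ M := { h with map_lie' := fun {a v} => hlie a v }
  refine ⟨h', ?_⟩
  have := vacuumWeyl_hom_ext κ (fun a v => ⁅a, v⁆)
    (h := (p.comp h' : VacuumWeyl κ →ₗ[ℂ] N)) (h' := (f : VacuumWeyl κ →ₗ[ℂ] N))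
    (fun a v => (p.comp h').map_lie a v) (fun a v => f.map_lie a v)
    ((congrArg p hvac).trans hpm)
  exact LieModuleHom.ext fun v => congrArg (fun g => g v) this

end Vacuum

/-! ### Extension of scalars -/

section Extend

variable {𝔤 : Type u} [LieRing 𝔤] [LieAlgebra ℂ 𝔤] {V : Type v} [AddCommGroup V] [Module ℂ V]
  {A B C : Type*} [CommRing A] [Algebra ℂ A] [CommRing B] [Algebra ℂ B] [CommRing C] [Algebra ℂ C]

lemma rTensor_algHom_smul (f : A →ₐ[ℂ] B) (a : A) (z : A ⊗[ℂ] V) :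
    LinearMap.rTensor V f.toLinearMap (a • z) = f a • LinearMap.rTensor V f.toLinearMap z := by
  induction z using TensorProduct.induction_on with
  | zero => simp
  | add z z' h h' => simp only [smul_add, map_add, h, h']
  | tmul b v => simp [TensorProduct.smul_tmul']

lemma rTensor_algHom_lie (f : A →ₐ[ℂ] B) (z z' : A ⊗[ℂ] 𝔤) :
    LinearMap.rTensor 𝔤 f.toLinearMap ⁅z, z'⁆
      = ⁅LinearMap.rTensor 𝔤 f.toLinearMap z, LinearMap.rTensor 𝔤 f.toLinearMap z'⁆ :=
  (ExtendScalars.map f (LieHom.id : 𝔤 →ₗ⁅ℂ⁆ 𝔤)).map_lie z z'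

lemma rTensor_algHom_comp (f : A →ₐ[ℂ] B) (g : B →ₐ[ℂ] C) (z : A ⊗[ℂ] V) :
    LinearMap.rTensor V g.toLinearMap (LinearMap.rTensor V f.toLinearMap z)
      = LinearMap.rTensor V (g.comp f).toLinearMap z := by
  rw [← LinearMap.rTensor_comp_apply]; rfl

lemma extendScalars_induction {p : A ⊗[ℂ] V → Prop} (h1 : ∀ x, p (1 ⊗ₜ x))
    (hadd : ∀ z z', p z → p z' → p (z + z')) (hsmul : ∀ (a : A) z, p z → p (a • z)) (z : A ⊗[ℂ] V) :
    p z := by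
  induction z using TensorProduct.induction_on with
  | zero => simpa using hsmul 0 _ (h1 0)
  | add z z' h h' => exact hadd _ _ h h'
  | tmul a x => simpa [TensorProduct.smul_tmul'] using hsmul a _ (h1 x)

/-- The base change of an endomorphism. -/
def extendEnd (f : A →ₐ[ℂ] B) (φ : A ⊗[ℂ] V →ₗ[A] A ⊗[ℂ] V) : B ⊗[ℂ] V →ₗ[B] B ⊗[ℂ] V :=
  LinearMap.liftBaseChange B (LinearMap.rTensor V f.toLinearMap ∘ₗ φ.restrictScalars ℂ ∘ₗ
    TensorProduct.mk ℂ A V 1)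

lemma extendEnd_one_tmul (f : A →ₐ[ℂ] B) (φ : A ⊗[ℂ] V →ₗ[A] A ⊗[ℂ] V) (x : V) :
    extendEnd f φ (1 ⊗ₜ x) = LinearMap.rTensor V f.toLinearMap (φ (1 ⊗ₜ x)) :=
  LinearMap.liftBaseChange_one_tmul (A := B) _ x

lemma extendEnd_rTensor (f : A →ₐ[ℂ] B) (φ : A ⊗[ℂ] V →ₗ[A] A ⊗[ℂ] V) (z : A ⊗[ℂ] V) :
    extendEnd f φ (LinearMap.rTensor V f.toLinearMap z)
      = LinearMap.rTensor V f.toLinearMap (φ z) := by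
  induction z using extendScalars_induction with
  | h1 x => rw [← extendEnd_one_tmul, LinearMap.rTensor_tmul, AlgHom.toLinearMap_apply, map_one]
  | hadd z z' h h' => simp only [map_add, h, h']
  | hsmul a z h => rw [rTensor_algHom_smul, map_smul, map_smul, rTensor_algHom_smul, h]

lemma extendEnd_comp (f : A →ₐ[ℂ] B) (φ ψ : A ⊗[ℂ] V →ₗ[A] A ⊗[ℂ] V) (z : B ⊗[ℂ] V) :
    extendEnd f (φ ∘ₗ ψ) z = extendEnd f φ (extendEnd f ψ z) := by
  induction z using extendScalars_induction with
  | h1 x => rw [extendEnd_one_tmul, extendEnd_one_tmul, extendEnd_rTensor, LinearMap.comp_apply]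
  | hadd z z' h h' => simp only [map_add, h, h']
  | hsmul a z h => simp only [map_smul, h]

lemma extendEnd_id (f : A →ₐ[ℂ] B) (z : B ⊗[ℂ] V) :
    extendEnd f (LinearMap.id : A ⊗[ℂ] V →ₗ[A] A ⊗[ℂ] V) z = z := by
  induction z using extendScalars_induction with
  | h1 x => rw [extendEnd_one_tmul, LinearMap.id_apply, LinearMap.rTensor_tmul,
      AlgHom.toLinearMap_apply, map_one]
  | hadd z z' h h' => simp only [map_add, h, h']
  | hsmul a z h => simp only [map_smul, h]

lemma extendEnd_lie (f : A →ₐ[ℂ] B) (φ : A ⊗[ℂ] 𝔤 →ₗ[A] A ⊗[ℂ] 𝔤)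
    (hφ : ∀ z z', φ ⁅z, z'⁆ = ⁅φ z, φ z'⁆) (z z' : B ⊗[ℂ] 𝔤) :
    extendEnd f φ ⁅z, z'⁆ = ⁅extendEnd f φ z, extendEnd f φ z'⁆ := by
  induction z using extendScalars_induction with
  | h1 x =>
    induction z' using extendScalars_induction with
    | h1 y =>
      rw [ExtendScalars.bracket_tmul, one_mul, extendEnd_one_tmul, extendEnd_one_tmul,
        extendEnd_one_tmul, ← rTensor_algHom_lie, ← hφ, ExtendScalars.bracket_tmul, one_mul]
    | hadd z z' h h' => simp only [map_add, lie_add, h, h']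
    | hsmul a z h => rw [extend_lie_smul, map_smul, map_smul, extend_lie_smul, h]
  | hadd z z' h h' => simp only [map_add, add_lie, h, h']
  | hsmul a z h => rw [extend_smul_lie, map_smul, map_smul, extend_smul_lie, h]

end Extend

/-! ### Laurent series over a ring -/

/-- The algebra `R((t))`. -/
def LaurentOver (R : Type) [CommRing R] : Type := HahnSeries ℤ R

namespace LaurentOver

variable {R S : Type} [CommRing R] [CommRing S]

instance : CommRing (LaurentOver R) := inferInstanceAs (CommRing (HahnSeries ℤ R))

instance (k : Type*) [CommSemiring k] [Algebra k R] : Algebra k (LaurentOver R) :=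
  (HahnSeries.instAlgebra : Algebra k (HahnSeries ℤ R))

variable [Algebra ℂ R] [Algebra ℂ S]

instance : IsScalarTower ℂ R (LaurentOver R) := IsScalarTower.of_algebraMap_eq fun _ => rfl

/-- The coefficient of `t ^ n`. -/
def coeff (n : ℤ) : LaurentOver R →ₗ[R] R where
  toFun f := HahnSeries.coeff (show HahnSeries ℤ R from f) n
  map_add' _ _ := rfl
  map_smul' _ _ := rfl

lemma ext {f g : LaurentOver R} (h : ∀ n, coeff n f = coeff n g) : f = g :=
  HahnSeries.ext (funext h)

/-- The monomial `t ^ n`. -/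
def tpow (n : ℤ) : LaurentOver R := (HahnSeries.single n (1 : R) : HahnSeries ℤ R)

lemma coeff_tpow (n m : ℤ) : coeff m (tpow n : LaurentOver R) = if m = n then 1 else 0 :=
  (HahnSeries.coeff_single (Γ := ℤ) (R := R)).trans (by congr)

lemma tpow_mul (m n : ℤ) : (tpow m * tpow n : LaurentOver R) = tpow (m + n) := by
  change (HahnSeries.single m (1 : R) : HahnSeries ℤ R) * HahnSeries.single n (1 : R) = _
  rw [HahnSeries.single_mul_single, mul_one]; rfl

lemma tpow_zero : (tpow 0 : LaurentOver R) = 1 := rfl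

lemma coeff_tpow_mul (n m : ℤ) (f : LaurentOver R) : coeff m (tpow n * f) = coeff (m - n) f := by
  have h := HahnSeries.coeff_single_mul_add (r := (1 : R)) (x := (show HahnSeries ℤ R from f))
    (a := m - n) (b := n)
  rw [sub_add_cancel, one_mul] at h
  exact h

/-- The inclusion of `R[[t]]`. -/
def ofPS : R⟦X⟧ →ₐ[ℂ] LaurentOver R where
  toRingHom := HahnSeries.ofPowerSeries ℤ R
  commutes' c := by
    rw [PowerSeries.algebraMap_apply]
    exact HahnSeries.ofPowerSeries_C (algebraMap ℂ R c)

lemma coeff_ofPS_of_neg (f : R⟦X⟧) {n : ℤ} (hn : n < 0) : coeff n (ofPS f) = 0 := by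
  change HahnSeries.coeff (HahnSeries.ofPowerSeries ℤ R f) n = 0
  rw [HahnSeries.ofPowerSeries_apply]
  refine HahnSeries.embDomain_of_notMem_range ?_
  rintro ⟨k, hk⟩
  simp at hk
  omega

lemma coeff_ofPS (f : R⟦X⟧) (n : ℕ) : coeff n (ofPS f) = PowerSeries.coeff n f :=
  HahnSeries.ofPowerSeries_apply_coeff f n

/-- The effect of a homomorphism on coefficients. -/
def map (f : R →ₐ[ℂ] S) : LaurentOver R →ₐ[ℂ] LaurentOver S where
  toFun g := HahnSeries.map (show HahnSeries ℤ R from g) f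
  map_one' := HahnSeries.map_one (f : R →+* S).toMonoidWithZeroHom
  map_mul' g h := HahnSeries.map_mul ((f : R →+* S) : R →ₙ+* S)
  map_zero' := HahnSeries.map_zero ((f : R →+* S) : ZeroHom R S)
  map_add' g h := HahnSeries.map_add ((f : R →+* S) : R →+ S)
  commutes' c := by
    refine (HahnSeries.map_C (algebraMap ℂ R c) (f : R →+* S)).trans ?_
    exact congrArg _ (f.commutes c)

lemma coeff_map (f : R →ₐ[ℂ] S) (g : LaurentOver R) (n : ℤ) : coeff n (map f g) = f (coeff n g) :=
  rfl

lemma map_tpow (f : R →ₐ[ℂ] S) (n : ℤ) : map f (tpow n) = tpow n := by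
  refine ext fun m => ?_
  rw [coeff_map, coeff_tpow, coeff_tpow]
  split_ifs <;> simp

lemma map_ofPS (f : R →ₐ[ℂ] S) : (map f).comp ofPS = ofPS.comp (PowerSeries.mapAlgHom f) := by
  refine AlgHom.ext fun g => ext fun n => ?_
  rw [AlgHom.comp_apply, AlgHom.comp_apply, coeff_map]
  obtain hn | hn := lt_or_ge n 0
  · rw [coeff_ofPS_of_neg _ hn, coeff_ofPS_of_neg _ hn, map_zero]
  · obtain ⟨k, rfl⟩ := Int.eq_ofNat_of_zero_le hn
    rw [coeff_ofPS, coeff_ofPS, PowerSeries.mapAlgHom_apply, PowerSeries.coeff_map]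
    rfl

variable (R) in
/-- The extension of scalars `ℂ((t)) → R((t))`. -/
def ofLaurent : Laurent →ₐ[ℂ] LaurentOver R :=
  (map (Algebra.ofId ℂ R) : LaurentOver ℂ →ₐ[ℂ] LaurentOver R)

lemma coeff_ofLaurent (f : Laurent) (n : ℤ) :
    coeff n (ofLaurent R f) = algebraMap ℂ R (f.coeff n) := rfl

lemma ofLaurent_tpow (n : ℤ) : ofLaurent R (Laurent.tpow n) = tpow n :=
  map_tpow (Algebra.ofId ℂ R) n

lemma map_comp_ofLaurent (f : R →ₐ[ℂ] S) : (map f).comp (ofLaurent R) = ofLaurent S := by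
  refine AlgHom.ext fun g => ext fun n => ?_
  rw [AlgHom.comp_apply, coeff_map, coeff_ofLaurent, coeff_ofLaurent, AlgHom.commutes]

lemma ofLaurent_comp_ofPowerSeries :
    (ofLaurent R).comp Laurent.ofPowerSeries = ofPS.comp (PowerSeries.mapAlgHom (Algebra.ofId ℂ R)) :=
  map_ofPS (Algebra.ofId ℂ R)

/-- The Euler derivation `t d/dt`. -/
def euler : LaurentOver R →ₗ[R] LaurentOver R where
  toFun f := (⟨fun n => (n : R) * coeff n f,
    (HahnSeries.isPWO_support (show HahnSeries ℤ R from f)).mono fun n hn h => hn (by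
      change (n : R) * HahnSeries.coeff (show HahnSeries ℤ R from f) n = 0
      rw [h, mul_zero])⟩ : HahnSeries ℤ R)
  map_add' f g := ext fun n => mul_add _ _ _
  map_smul' r f := ext fun n => mul_left_comm _ _ _

lemma coeff_euler (f : LaurentOver R) (n : ℤ) : coeff n (euler f) = n * coeff n f := rfl

lemma euler_mul (f g : LaurentOver R) : euler (f * g) = euler f * g + f * euler g := by
  refine ext fun n => ?_
  have supp (k : LaurentOver R) : HahnSeries.support (show HahnSeries ℤ R from euler k) ⊆
      HahnSeries.support (show HahnSeries ℤ R from k) := by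
    intro m hm hk
    refine hm ?_
    change (m : R) * HahnSeries.coeff (show HahnSeries ℤ R from k) m = 0
    rw [hk, mul_zero]
  have hf := HahnSeries.isPWO_support (show HahnSeries ℤ R from f)
  have hg := HahnSeries.isPWO_support (show HahnSeries ℤ R from g)
  have h1 : coeff n (f * g) = _ := HahnSeries.coeff_mul (x := (show HahnSeries ℤ R from f))
    (y := (show HahnSeries ℤ R from g)) (a := n)
  have h2 : coeff n (euler f * g) = _ := HahnSeries.coeff_mul_left'
    (x := (show HahnSeries ℤ R from euler f)) (y := (show HahnSeries ℤ R from g)) (a := n)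
    hf (supp f)
  have h3 : coeff n (f * euler g) = _ := HahnSeries.coeff_mul_right'
    (x := (show HahnSeries ℤ R from f)) (y := (show HahnSeries ℤ R from euler g)) (a := n)
    hg (supp g)
  rw [map_add, coeff_euler, h1, h2, h3, ← Finset.sum_add_distrib, Finset.mul_sum]
  refine Finset.sum_congr rfl fun ij hij => ?_
  rw [Finset.mem_antidiagonal] at hij
  change _ = (ij.1 : R) * HahnSeries.coeff (show HahnSeries ℤ R from f) ij.1 * _ + _ *
    ((ij.2 : R) * HahnSeries.coeff (show HahnSeries ℤ R from g) ij.2)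
  rw [← hij.2.2]
  push_cast
  ring

lemma euler_tpow (n : ℤ) : euler (tpow n : LaurentOver R) = (n : R) • tpow n := by
  refine ext fun m => ?_
  rw [coeff_euler, map_smul, coeff_tpow, smul_eq_mul]
  split_ifs with h
  · rw [h]
  · simp

lemma map_euler (f : R →ₐ[ℂ] S) (g : LaurentOver R) : map f (euler g) = euler (map f g) := by
  refine ext fun n => ?_
  rw [coeff_map, coeff_euler, coeff_euler, coeff_map, map_mul, map_intCast]

/-- The order of vanishing at `t = 0` is at least `N`. -/
def OrderGE (N : ℤ) (f : LaurentOver R) : Prop := ∀ n, n < N → coeff n f = 0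

lemma OrderGE.mul {M N : ℤ} {f g : LaurentOver R} (hf : OrderGE M f) (hg : OrderGE N g) :
    OrderGE (M + N) (f * g) := by
  intro n hn
  have h : coeff n (f * g) = _ := HahnSeries.coeff_mul (x := (show HahnSeries ℤ R from f))
    (y := (show HahnSeries ℤ R from g)) (a := n)
  rw [h]
  refine Finset.sum_eq_zero fun ij hij => ?_
  rw [Finset.mem_antidiagonal] at hij
  obtain h | h : ij.1 < M ∨ ij.2 < N := by omega
  · exact mul_eq_zero_of_left (hf _ h) _
  · exact mul_eq_zero_of_right _ (hg _ h)

lemma OrderGE.mono {M N : ℤ} (h : M ≤ N) {f : LaurentOver R} (hf : OrderGE N f) : OrderGE M f :=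
  fun n hn => hf n (by omega)

lemma OrderGE.euler {N : ℤ} {f : LaurentOver R} (hf : OrderGE N f) : OrderGE N (euler f) :=
  fun n hn => by rw [coeff_euler, hf n hn, mul_zero]

/-- The operator `t d/dt` kills constant terms. This gain of one order is what makes the anomaly
vanish on power series. -/
lemma OrderGE.euler_zero {f : LaurentOver R} (hf : OrderGE 0 f) :
    OrderGE 1 (LaurentOver.euler f) := by
  intro n hn
  rw [coeff_euler]
  obtain h | rfl : n < 0 ∨ n = 0 := by omega
  · rw [hf n h, mul_zero]
  · simp

lemma orderGE_ofPS (f : R⟦X⟧) : OrderGE 0 (ofPS f) := fun _ hn => coeff_ofPS_of_neg f hn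

lemma orderGE_tpow (n : ℤ) : OrderGE n (tpow n : LaurentOver R) := fun m hm => by
  rw [coeff_tpow, if_neg (by omega)]

lemma orderGE_one : OrderGE 0 (1 : LaurentOver R) := orderGE_tpow 0

lemma exists_orderGE (f : LaurentOver R) : ∃ N, OrderGE N f :=
  ⟨HahnSeries.order (show HahnSeries ℤ R from f), fun _ hn =>
    HahnSeries.coeff_eq_zero_of_lt_order hn⟩

lemma orderGE_sub_sum {A : ℤ} {f : LaurentOver R} (hf : OrderGE A f) (N : ℤ) :
    OrderGE N (f - ∑ n ∈ Finset.Ico A N, coeff n f • tpow n) := by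
  intro n hn
  rw [map_sub, map_sum, sub_eq_zero]
  simp only [map_smul, coeff_tpow, smul_eq_mul, mul_ite, mul_one, mul_zero, Finset.sum_ite_eq,
    Finset.mem_Ico]
  split_ifs with h
  · rfl
  · exact hf n (by omega)

end LaurentOver

/-! ### The loop algebra over a ring -/

open LaurentOver

section LoopOver

variable (𝔤 : Type u) [LieRing 𝔤] [LieAlgebra ℂ 𝔤] (R : Type) [CommRing R] [Algebra ℂ R]

/-- The loop algebra `𝔤 ⊗ R((t))`. -/
abbrev LoopOver : Type u := LaurentOver R ⊗[ℂ] 𝔤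

/-- The subspace `t ^ N 𝔤 ⊗ R[[t]]` of the loop algebra. -/
def tail (N : ℤ) : Submodule R (LoopOver 𝔤 R) :=
  Submodule.span R {a | ∃ (f : LaurentOver R) (x : 𝔤), OrderGE N f ∧ a = f ⊗ₜ x}

/-- The span of the monomials `x ⊗ t ^ n` in the loop algebra. -/
def monomials : Submodule R (LoopOver 𝔤 R) :=
  Submodule.span R (Set.range fun p : ℤ × 𝔤 => (tpow p.1 : LaurentOver R) ⊗ₜ p.2)

variable {𝔤 R}

lemma loopOver_smul (r : R) (a : LoopOver 𝔤 R) :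
    r • a = algebraMap R (LaurentOver R) r • a := (algebraMap_smul _ r a).symm

lemma loopOver_smul_lie (r : R) (a b : LoopOver 𝔤 R) : ⁅r • a, b⁆ = r • ⁅a, b⁆ := by
  rw [loopOver_smul, extend_smul_lie, ← loopOver_smul]

lemma loopOver_lie_smul (r : R) (a b : LoopOver 𝔤 R) : ⁅a, r • b⁆ = r • ⁅a, b⁆ := by
  rw [loopOver_smul, extend_lie_smul, ← loopOver_smul]

lemma tmul_mem_tail {N : ℤ} {f : LaurentOver R} (hf : OrderGE N f) (x : 𝔤) :
    f ⊗ₜ x ∈ tail 𝔤 R N := Submodule.subset_span ⟨f, x, hf, rfl⟩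

lemma tail_mono {M N : ℤ} (h : M ≤ N) : tail 𝔤 R N ≤ tail 𝔤 R M :=
  Submodule.span_mono fun _ ⟨f, x, hf, ha⟩ => ⟨f, x, hf.mono h, ha⟩

lemma tail_le {N : ℤ} {W : Submodule R (LoopOver 𝔤 R)}
    (h : ∀ f x, OrderGE N f → f ⊗ₜ x ∈ W) : tail 𝔤 R N ≤ W :=
  Submodule.span_le.2 fun _ ⟨f, x, hf, ha⟩ => ha ▸ h f x hf

lemma smul_mem_tail {M N : ℤ} {f : LaurentOver R} (hf : OrderGE M f) {a : LoopOver 𝔤 R}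
    (ha : a ∈ tail 𝔤 R N) : f • a ∈ tail 𝔤 R (M + N) := by
  have : tail 𝔤 R N ≤ (tail 𝔤 R (M + N)).comap
      ((LinearMap.lsmul (LaurentOver R) (LoopOver 𝔤 R) f).restrictScalars R) :=
    tail_le fun g x hg => by
      rw [Submodule.mem_comap]
      change f • (g ⊗ₜ[ℂ] x) ∈ _
      rw [TensorProduct.smul_tmul', smul_eq_mul]
      exact tmul_mem_tail (hf.mul hg) x
  exact this ha

lemma lie_mem_tail {M N : ℤ} {a b : LoopOver 𝔤 R} (ha : a ∈ tail 𝔤 R M) (hb : b ∈ tail 𝔤 R N) :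
    ⁅a, b⁆ ∈ tail 𝔤 R (M + N) := by
  induction ha using Submodule.span_induction with
  | mem a h =>
    obtain ⟨f, x, hf, rfl⟩ := h
    induction hb using Submodule.span_induction with
    | mem b h =>
      obtain ⟨g, y, hg, rfl⟩ := h
      rw [ExtendScalars.bracket_tmul]
      exact tmul_mem_tail (hf.mul hg) _
    | zero => rw [lie_zero]; exact Submodule.zero_mem _
    | add b b' _ _ h h' => rw [lie_add]; exact Submodule.add_mem _ h h'
    | smul r b _ h => rw [loopOver_lie_smul]; exact Submodule.smul_mem _ _ h
  | zero => rw [zero_lie]; exact Submodule.zero_mem _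
  | add a a' _ _ h h' => rw [add_lie]; exact Submodule.add_mem _ h h'
  | smul r a _ h => rw [loopOver_smul_lie]; exact Submodule.smul_mem _ _ h

lemma exists_mem_tail (a : LoopOver 𝔤 R) : ∃ N, a ∈ tail 𝔤 R N := by
  induction a using TensorProduct.induction_on with
  | zero => exact ⟨0, Submodule.zero_mem _⟩
  | add a a' h h' =>
    obtain ⟨N, hN⟩ := h
    obtain ⟨N', hN'⟩ := h'
    exact ⟨min N N', Submodule.add_mem _ (tail_mono (min_le_left _ _) hN)
      (tail_mono (min_le_right _ _) hN')⟩
  | tmul f x =>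
    obtain ⟨N, hN⟩ := exists_orderGE f
    exact ⟨N, tmul_mem_tail hN x⟩

lemma rTensor_ofPS_mem_tail (z : R⟦X⟧ ⊗[ℂ] 𝔤) :
    LinearMap.rTensor 𝔤 (ofPS (R := R)).toLinearMap z ∈ tail 𝔤 R 0 := by
  induction z using TensorProduct.induction_on with
  | zero => rw [map_zero]; exact Submodule.zero_mem _
  | add a a' h h' => rw [map_add]; exact Submodule.add_mem _ h h'
  | tmul f x => exact tmul_mem_tail (orderGE_ofPS f) x

/-- Density of Laurent polynomial loops: identities continuous in the loop variable need only be
checked on monomials. -/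
lemma exists_monomials_sub_mem_tail (a : LoopOver 𝔤 R) (N : ℤ) :
    ∃ a' ∈ monomials 𝔤 R, a - a' ∈ tail 𝔤 R N := by
  induction a using TensorProduct.induction_on with
  | zero => exact ⟨0, Submodule.zero_mem _, by rw [sub_zero]; exact Submodule.zero_mem _⟩
  | add a b h h' =>
    obtain ⟨a', ha, ha'⟩ := h
    obtain ⟨b', hb, hb'⟩ := h'
    refine ⟨a' + b', Submodule.add_mem _ ha hb, ?_⟩
    rw [add_sub_add_comm]
    exact Submodule.add_mem _ ha' hb'
  | tmul f x =>
    obtain ⟨A, hA⟩ := exists_orderGE f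
    refine ⟨(∑ n ∈ Finset.Ico A N, coeff n f • tpow n) ⊗ₜ x, ?_, ?_⟩
    · rw [TensorProduct.sum_tmul]
      refine Submodule.sum_mem _ fun n _ => ?_
      rw [← TensorProduct.smul_tmul']
      exact Submodule.smul_mem _ _ (Submodule.subset_span ⟨(n, x), rfl⟩)
    · rw [← TensorProduct.sub_tmul]
      exact tmul_mem_tail (orderGE_sub_sum hA N) x

variable (𝔤 R) in
/-- The Euler derivation of the loop algebra. -/
def eulerLoop : LoopOver 𝔤 R →ₗ[R] LoopOver 𝔤 R :=
  TensorProduct.AlgebraTensorModule.map euler LinearMap.id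

lemma eulerLoop_tmul (f : LaurentOver R) (x : 𝔤) : eulerLoop 𝔤 R (f ⊗ₜ x) = euler f ⊗ₜ x := rfl

lemma eulerLoop_smul (f : LaurentOver R) (a : LoopOver 𝔤 R) :
    eulerLoop 𝔤 R (f • a) = euler f • a + f • eulerLoop 𝔤 R a := by
  induction a using TensorProduct.induction_on with
  | zero => simp
  | add a b h h' => simp only [smul_add, map_add, h, h']; abel
  | tmul g x =>
    simp only [TensorProduct.smul_tmul', eulerLoop_tmul, smul_eq_mul, euler_mul,
      TensorProduct.add_tmul]

lemma eulerLoop_lie (a b : LoopOver 𝔤 R) :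
    eulerLoop 𝔤 R ⁅a, b⁆ = ⁅eulerLoop 𝔤 R a, b⁆ + ⁅a, eulerLoop 𝔤 R b⁆ := by
  induction a using TensorProduct.induction_on with
  | zero => simp
  | add a a' h h' => simp only [add_lie, map_add, h, h']; abel
  | tmul f x =>
    induction b using TensorProduct.induction_on with
    | zero => simp
    | add a a' h h' => simp only [lie_add, map_add, h, h']; abel
    | tmul g y =>
      simp only [ExtendScalars.bracket_tmul, eulerLoop_tmul, euler_mul, TensorProduct.add_tmul]

lemma eulerLoop_mem_tail_one {a : LoopOver 𝔤 R} (ha : a ∈ tail 𝔤 R 0) :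
    eulerLoop 𝔤 R a ∈ tail 𝔤 R 1 := by
  have : tail 𝔤 R 0 ≤ (tail 𝔤 R 1).comap (eulerLoop 𝔤 R) :=
    tail_le fun f x hf => tmul_mem_tail hf.euler_zero x
  exact this ha

lemma eulerLoop_one_tmul (x : 𝔤) : eulerLoop 𝔤 R (1 ⊗ₜ x) = 0 := by
  rw [eulerLoop_tmul, ← tpow_zero, euler_tpow]
  simp

/-! ### The cocycle over a ring -/

variable [FiniteDimensional ℂ 𝔤]

lemma killingForm_tmul (f g : LaurentOver R) (x y : 𝔤) :
    killingForm (LaurentOver R) (LoopOver 𝔤 R) (f ⊗ₜ x) (g ⊗ₜ y)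
      = killingForm ℂ 𝔤 x y • (f * g) := by
  have h := LieModule.traceForm_baseChange (R := ℂ) (L := 𝔤) (M := 𝔤) (LaurentOver R)
  exact congrArg (fun B : LinearMap.BilinForm (LaurentOver R) (LoopOver 𝔤 R) =>
    B (f ⊗ₜ x) (g ⊗ₜ y)) h

/-- The cocycle `-c K(x, y) Res f dg`. -/
def loopCocycle (𝔤 : Type u) [LieRing 𝔤] [LieAlgebra ℂ 𝔤] (R : Type) [CommRing R] [Algebra ℂ R]
    (c : ℂ) : LinearMap.BilinForm R (LoopOver 𝔤 R) :=
  LinearMap.mk₂ R (fun a b => -(c • coeff 0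
    (killingForm (LaurentOver R) (LoopOver 𝔤 R) a (eulerLoop 𝔤 R b))))
    (fun a a' b => by simp only [map_add, LinearMap.add_apply, smul_add, neg_add])
    (fun r a b => by
      rw [loopOver_smul, map_smul, LinearMap.smul_apply, algebraMap_smul, map_smul, smul_neg,
        smul_comm])
    (fun a b b' => by simp only [map_add, smul_add, neg_add])
    (fun r a b => by
      rw [map_smul, loopOver_smul, map_smul, algebraMap_smul, map_smul, smul_neg, smul_comm])

lemma loopCocycle_apply (c : ℂ) (a b : LoopOver 𝔤 R) : loopCocycle 𝔤 R c a b = -(c • coeff 0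
    (killingForm (LaurentOver R) (LoopOver 𝔤 R) a (eulerLoop 𝔤 R b))) := rfl

lemma loopCocycle_tmul (c : ℂ) (f g : LaurentOver R) (x y : 𝔤) :
    loopCocycle 𝔤 R c (f ⊗ₜ x) (g ⊗ₜ y)
      = -((c * killingForm ℂ 𝔤 x y) • coeff 0 (f * euler g)) := by
  rw [loopCocycle_apply, eulerLoop_tmul, killingForm_tmul, mul_smul,
    LinearMap.map_smul_of_tower]

lemma loopCocycle_skew (c : ℂ) (a b : LoopOver 𝔤 R) :
    loopCocycle 𝔤 R c a b = -loopCocycle 𝔤 R c b a := by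
  induction a using TensorProduct.induction_on with
  | zero => simp
  | add a a' h h' => simp only [map_add, LinearMap.add_apply, h, h']; ring
  | tmul f x =>
    induction b using TensorProduct.induction_on with
    | zero => simp
    | add a a' h h' => simp only [map_add, LinearMap.add_apply, h, h']; ring
    | tmul g y =>
      rw [loopCocycle_tmul, loopCocycle_tmul, LieModule.traceForm_comm ℂ 𝔤 𝔤 x y, ← smul_neg,
        ← smul_neg, ← smul_neg]
      congr 1
      have h : coeff 0 (euler (f * g)) = 0 := by rw [coeff_euler]; simp
      rw [euler_mul, map_add, mul_comm] at h
      linear_combination -h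

lemma loopCocycle_eq_zero (c : ℂ) {M N : ℤ} (h : 0 < M + N) {a b : LoopOver 𝔤 R}
    (ha : a ∈ tail 𝔤 R M) (hb : b ∈ tail 𝔤 R N) : loopCocycle 𝔤 R c a b = 0 := by
  induction ha using Submodule.span_induction with
  | mem a h =>
    obtain ⟨f, x, hf, rfl⟩ := h
    induction hb using Submodule.span_induction with
    | mem b h =>
      obtain ⟨g, y, hg, rfl⟩ := h
      rw [loopCocycle_tmul, hf.mul hg.euler 0 (by omega), smul_zero, neg_zero]
    | zero => rw [map_zero]
    | add b b' _ _ h h' => rw [map_add, h, h', add_zero]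
    | smul r b _ h => rw [map_smul, h, smul_zero]
  | zero => rw [map_zero, LinearMap.zero_apply]
  | add a a' _ _ h h' => rw [map_add, LinearMap.add_apply, h, h', add_zero]
  | smul r a _ h => rw [map_smul, LinearMap.smul_apply, h, smul_zero]

lemma map_loopCocycle {S : Type} [CommRing S] [Algebra ℂ S] (f : R →ₐ[ℂ] S) (c : ℂ)
    (a b : LoopOver 𝔤 R) :
    f (loopCocycle 𝔤 R c a b) = loopCocycle 𝔤 S c (LinearMap.rTensor 𝔤 (map f).toLinearMap a)
      (LinearMap.rTensor 𝔤 (map f).toLinearMap b) := by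
  induction a using TensorProduct.induction_on with
  | zero => simp
  | add a a' h h' => simp only [map_add, LinearMap.add_apply, h, h']
  | tmul g x =>
    induction b using TensorProduct.induction_on with
    | zero => simp
    | add a a' h h' => simp only [map_add, h, h']
    | tmul g' y =>
      rw [LinearMap.rTensor_tmul, LinearMap.rTensor_tmul, loopCocycle_tmul, loopCocycle_tmul,
        AlgHom.toLinearMap_apply, AlgHom.toLinearMap_apply, map_neg, map_smul, ← map_euler,
        ← map_mul, coeff_map]

variable (𝔤 R) in
/-- The homomorphism `𝔤 ⊗ ℂ((t)) → 𝔤 ⊗ R((t))`. -/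
def ofLoop : Loop 𝔤 →ₗ[ℂ] LoopOver 𝔤 R := LinearMap.rTensor 𝔤 (ofLaurent R).toLinearMap

lemma ofLoop_tmul (f : Laurent) (x : 𝔤) : ofLoop 𝔤 R (f ⊗ₜ x) = ofLaurent R f ⊗ₜ x := rfl

lemma ofLoop_lie (a b : Loop 𝔤) : ofLoop 𝔤 R ⁅a, b⁆ = ⁅ofLoop 𝔤 R a, ofLoop 𝔤 R b⁆ :=
  rTensor_algHom_lie _ a b

lemma rTensor_ofLoop {S : Type} [CommRing S] [Algebra ℂ S] (f : R →ₐ[ℂ] S) (a : Loop 𝔤) :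
    LinearMap.rTensor 𝔤 (map f).toLinearMap (ofLoop 𝔤 R a) = ofLoop 𝔤 S a := by
  rw [ofLoop, rTensor_algHom_comp, map_comp_ofLaurent]; rfl

lemma ofLoop_arcToLoop (ξ : Arc 𝔤) : ofLoop 𝔤 R (arcToLoop ξ)
    = LinearMap.rTensor 𝔤 (ofPS (R := R)).toLinearMap
      (LinearMap.rTensor 𝔤 (PowerSeries.mapAlgHom (Algebra.ofId ℂ R)).toLinearMap ξ) := by
  rw [ofLoop, arcToLoop, rTensor_algHom_comp, rTensor_algHom_comp, ofLaurent_comp_ofPowerSeries]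

lemma euler_ofLaurent (g : Laurent) :
    euler (ofLaurent R g) = ofLaurent R (Laurent.tpow 1 * g.deriv) := by
  refine LaurentOver.ext fun n => ?_
  rw [coeff_euler, coeff_ofLaurent, coeff_ofLaurent]
  have h : (Laurent.tpow 1 * g.deriv).coeff n = (n : ℂ) * g.coeff n := euler_coeff g n
  rw [h, map_mul, map_intCast]

lemma loopCocycle_ofLoop {κ : InvariantForm 𝔤} {c : ℂ} (hκ : κ.form = c • killingForm ℂ 𝔤)
    (a b : Loop 𝔤) :
    loopCocycle 𝔤 R c (ofLoop 𝔤 R a) (ofLoop 𝔤 R b) = algebraMap ℂ R (cocycleForm κ a b) := by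
  induction a using TensorProduct.induction_on with
  | zero => simp
  | add a a' h h' => simp only [map_add, LinearMap.add_apply, h, h']
  | tmul f x =>
    induction b using TensorProduct.induction_on with
    | zero => simp
    | add a a' h h' => simp only [map_add, h, h']
    | tmul g y =>
      have h : (f * (Laurent.tpow 1 * g.deriv)).coeff 0 = residueForm f g := by
        rw [residueForm_apply, mul_left_comm]
        exact (HahnSeries.coeff_single_mul_add (r := (1 : ℂ))
          (x := (show HahnSeries ℤ ℂ from f * g.deriv)) (a := -1) (b := 1)).trans (one_mul _)
      rw [ofLoop_tmul, ofLoop_tmul, loopCocycle_tmul, cocycleForm_tmul, euler_ofLaurent, ← map_mul,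
        coeff_ofLaurent, h, hκ, LinearMap.smul_apply, LinearMap.smul_apply, map_neg, map_mul,
        Algebra.smul_def, smul_eq_mul]

end LoopOver

/-! ### The action of the arc group on the loop algebra -/

open LaurentOver

section LoopAut

variable {𝔤 : Type u} [LieRing 𝔤] [LieAlgebra ℂ 𝔤] {R : Type} [CommRing R] [Algebra ℂ R]

lemma extendEnd_symm {A B : Type*} [CommRing A] [Algebra ℂ A] [CommRing B] [Algebra ℂ B]
    (f : A →ₐ[ℂ] B) (e : (A ⊗[ℂ] 𝔤) ≃ₗ[A] (A ⊗[ℂ] 𝔤)) (z : B ⊗[ℂ] 𝔤) :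
    extendEnd f e.symm.toLinearMap (extendEnd f e.toLinearMap z) = z := by
  rw [← extendEnd_comp, show e.symm.toLinearMap ∘ₗ e.toLinearMap = LinearMap.id from
    LinearMap.ext e.symm_apply_apply, extendEnd_id]

lemma adjointGroup_lie {A : Type} [CommRing A] [Algebra ℂ A] (γ : adjointGroup 𝔤 A)
    (y z : A ⊗[ℂ] 𝔤) : γ.1 ⁅y, z⁆ = ⁅γ.1 y, γ.1 z⁆ := γ.2.1 y z

/-- The automorphism of `𝔤 ⊗ R((t))` defined by a point of `G(R[[t]])`, as a linear map. -/
def loopEquiv (γ : arcGroup 𝔤 R) : LoopOver 𝔤 R ≃ₗ[LaurentOver R] LoopOver 𝔤 R :=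
  LinearEquiv.ofLinearMap (extendEnd (ofPS (R := R)) γ.1.toLinearMap)
    (extendEnd (ofPS (R := R)) γ.1.symm.toLinearMap)
    (LinearMap.ext fun a => extendEnd_symm (ofPS (R := R)) γ.1.symm a)
    (LinearMap.ext fun a => extendEnd_symm (ofPS (R := R)) γ.1 a)

lemma loopEquiv_apply (γ : arcGroup 𝔤 R) (a : LoopOver 𝔤 R) :
    loopEquiv γ a = extendEnd (ofPS (R := R)) γ.1.toLinearMap a := rfl

lemma loopEquiv_lie (γ : arcGroup 𝔤 R) (a b : LoopOver 𝔤 R) :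
    loopEquiv γ ⁅a, b⁆ = ⁅loopEquiv γ a, loopEquiv γ b⁆ :=
  extendEnd_lie (ofPS (R := R)) γ.1.toLinearMap (adjointGroup_lie γ) a b

/-- The automorphism of `𝔤 ⊗ R((t))` defined by a point of `G(R[[t]])`. -/
def loopAut (γ : arcGroup 𝔤 R) : LoopOver 𝔤 R ≃ₗ⁅LaurentOver R⁆ LoopOver 𝔤 R :=
  { loopEquiv γ with map_lie' := fun {a b} => loopEquiv_lie γ a b }

lemma loopAut_apply (γ : arcGroup 𝔤 R) (a : LoopOver 𝔤 R) :
    loopAut γ a = extendEnd (ofPS (R := R)) γ.1.toLinearMap a := loopEquiv_apply γ a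

lemma loopAut_symm (γ : arcGroup 𝔤 R) (a : LoopOver 𝔤 R) :
    (loopAut γ).symm a = loopAut γ⁻¹ a := rfl

lemma loopAut_mul (γ γ' : arcGroup 𝔤 R) (a : LoopOver 𝔤 R) :
    loopAut (γ * γ') a = loopAut γ (loopAut γ' a) :=
  extendEnd_comp (ofPS (R := R)) γ.1.toLinearMap γ'.1.toLinearMap a

lemma loopAut_one (a : LoopOver 𝔤 R) : loopAut (1 : arcGroup 𝔤 R) a = a :=
  extendEnd_id (ofPS (R := R)) a

lemma loopAut_rTensor (γ : arcGroup 𝔤 R) (z : R⟦X⟧ ⊗[ℂ] 𝔤) :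
    loopAut γ (LinearMap.rTensor 𝔤 (ofPS (R := R)).toLinearMap z)
      = LinearMap.rTensor 𝔤 (ofPS (R := R)).toLinearMap (γ.1 z) :=
  extendEnd_rTensor (ofPS (R := R)) γ.1.toLinearMap z

lemma loopAut_one_tmul_mem (γ : arcGroup 𝔤 R) (x : 𝔤) : loopAut γ (1 ⊗ₜ x) ∈ tail 𝔤 R 0 := by
  rw [loopAut_apply, extendEnd_one_tmul]
  exact rTensor_ofPS_mem_tail _

lemma mem_tail_of_linear (T : End (LaurentOver R) (LoopOver 𝔤 R)) {k : ℤ}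
    (hT : ∀ x : 𝔤, T (1 ⊗ₜ x) ∈ tail 𝔤 R k) {N : ℤ} {a : LoopOver 𝔤 R} (ha : a ∈ tail 𝔤 R N) :
    T a ∈ tail 𝔤 R (N + k) := by
  have : tail 𝔤 R N ≤ (tail 𝔤 R (N + k)).comap (T.restrictScalars R) := tail_le fun f x hf => by
    rw [Submodule.mem_comap]
    change T (f ⊗ₜ[ℂ] x) ∈ _
    rw [← mul_one f, ← smul_eq_mul, ← TensorProduct.smul_tmul', map_smul]
    exact smul_mem_tail hf (hT x)
  exact this ha

lemma loopAut_mem_tail (γ : arcGroup 𝔤 R) {N : ℤ} {a : LoopOver 𝔤 R} (ha : a ∈ tail 𝔤 R N) :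
    loopAut γ a ∈ tail 𝔤 R N := by
  have := mem_tail_of_linear (loopAut γ).toLinearEquiv.toLinearMap (loopAut_one_tmul_mem γ) ha
  rwa [add_zero] at this

lemma loopAut_natural {S : Type} [CommRing S] [Algebra ℂ S] {f : R →ₐ[ℂ] S}
    {γ : arcGroup 𝔤 R} {γ' : arcGroup 𝔤 S}
    (h : IsBaseChangeAlong (PowerSeries.mapAlgHom f) γ.1.toLinearMap γ'.1.toLinearMap)
    (a : LoopOver 𝔤 R) :
    LinearMap.rTensor 𝔤 (map f).toLinearMap (loopAut γ a)
      = loopAut γ' (LinearMap.rTensor 𝔤 (map f).toLinearMap a) := by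
  induction a using extendScalars_induction with
  | h1 x =>
    rw [LinearMap.rTensor_tmul, AlgHom.toLinearMap_apply, map_one, loopAut_apply, loopAut_apply,
      extendEnd_one_tmul, extendEnd_one_tmul, rTensor_algHom_comp, map_ofPS, ← rTensor_algHom_comp,
      h, LinearMap.rTensor_tmul, AlgHom.toLinearMap_apply, map_one]
  | hadd a b h h' => simp only [map_add, h, h']
  | hsmul g a h => rw [map_smul, rTensor_algHom_smul, rTensor_algHom_smul, map_smul, h]

/-- The logarithmic derivative `γ⁻¹ ∂ γ - ∂` of a point of `G(R[[t]])`. -/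
def logDeriv (γ : arcGroup 𝔤 R) : End (LaurentOver R) (LoopOver 𝔤 R) where
  toFun a := (loopAut γ).symm (eulerLoop 𝔤 R (loopAut γ a)) - eulerLoop 𝔤 R a
  map_add' a b := by simp only [map_add]; abel
  map_smul' f a := by
    rw [map_smul, eulerLoop_smul, eulerLoop_smul, map_add, map_smul, map_smul,
      LieEquiv.symm_apply_apply, RingHom.id_apply, smul_sub]
    abel

lemma logDeriv_apply (γ : arcGroup 𝔤 R) (a : LoopOver 𝔤 R) : logDeriv γ a
    = (loopAut γ).symm (eulerLoop 𝔤 R (loopAut γ a)) - eulerLoop 𝔤 R a := rfl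

lemma logDeriv_lie (γ : arcGroup 𝔤 R) (a b : LoopOver 𝔤 R) :
    logDeriv γ ⁅a, b⁆ = ⁅logDeriv γ a, b⁆ + ⁅a, logDeriv γ b⁆ := by
  simp only [logDeriv_apply, LieEquiv.map_lie, eulerLoop_lie, map_add, LieEquiv.symm_apply_apply,
    sub_lie, lie_sub]
  abel

/-- By `R((t))`-linearity it suffices to test constants `1 ⊗ x`. The Euler derivation kills these
and raises the order of their image under `γ` from `0` to `1`. -/
lemma logDeriv_mem_tail (γ : arcGroup 𝔤 R) {N : ℤ} {a : LoopOver 𝔤 R} (ha : a ∈ tail 𝔤 R N) :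
    logDeriv γ a ∈ tail 𝔤 R (N + 1) := by
  refine mem_tail_of_linear _ (fun x => ?_) ha
  rw [logDeriv_apply, eulerLoop_one_tmul, sub_zero, loopAut_symm]
  exact loopAut_mem_tail _ (eulerLoop_mem_tail_one (loopAut_one_tmul_mem γ x))

variable [FiniteDimensional ℂ 𝔤]

/-- For a derivation `D`, `ad (D b)` is the commutator of `D` and `ad b`; cyclicity of the trace
moves the commutator onto `ad a` and `ad b`. The trace formula makes it unnecessary to know that `D`
is inner. -/
lemma killingForm_logDeriv (γ : arcGroup 𝔤 R) (a b : LoopOver 𝔤 R) :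
    killingForm (LaurentOver R) (LoopOver 𝔤 R) a (logDeriv γ b)
      = -LinearMap.trace (LaurentOver R) (LoopOver 𝔤 R)
        (logDeriv γ * ad (LaurentOver R) (LoopOver 𝔤 R) ⁅a, b⁆) := by
  have h : ad (LaurentOver R) (LoopOver 𝔤 R) (logDeriv γ b)
      = logDeriv γ * ad (LaurentOver R) (LoopOver 𝔤 R) b
        - ad (LaurentOver R) (LoopOver 𝔤 R) b * logDeriv γ := by
    refine LinearMap.ext fun z => ?_
    simp only [LinearMap.sub_apply, End.mul_apply, ad_apply, logDeriv_lie]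
    abel
  have h' : ad (LaurentOver R) (LoopOver 𝔤 R) ⁅a, b⁆
      = ad (LaurentOver R) (LoopOver 𝔤 R) a * ad (LaurentOver R) (LoopOver 𝔤 R) b
        - ad (LaurentOver R) (LoopOver 𝔤 R) b * ad (LaurentOver R) (LoopOver 𝔤 R) a := by
    refine LinearMap.ext fun z => ?_
    simp only [LinearMap.sub_apply, End.mul_apply, ad_apply, lie_lie]
  rw [killingForm_apply_apply, ← End.mul_eq_comp, h, h', mul_sub, mul_sub, map_sub, map_sub, neg_sub]
  congr 1
  · rw [← mul_assoc, ← LinearMap.trace_mul_cycle, mul_assoc]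
  · rw [← mul_assoc, LinearMap.trace_mul_comm]

/-- The anomaly of a point of `G(R[[t]])`. -/
def anomaly (c : ℂ) (γ : arcGroup 𝔤 R) : LoopOver 𝔤 R →ₗ[R] R :=
  c • (coeff 0 ∘ₗ ((LinearMap.trace (LaurentOver R) (LoopOver 𝔤 R)) ∘ₗ
    LinearMap.mulLeft (LaurentOver R) (logDeriv γ) ∘ₗ
      (ad (LaurentOver R) (LoopOver 𝔤 R) : _ →ₗ[LaurentOver R] _)).restrictScalars R)

lemma anomaly_apply (c : ℂ) (γ : arcGroup 𝔤 R) (a : LoopOver 𝔤 R) : anomaly c γ a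
    = c • coeff 0 (LinearMap.trace (LaurentOver R) (LoopOver 𝔤 R)
      (logDeriv γ * ad (LaurentOver R) (LoopOver 𝔤 R) a)) := rfl

/-- The Killing form over `R((t))` is invariant under every `R((t))`-linear Lie automorphism, so
only the failure of `γ` to commute with the Euler derivation contributes. By `killingForm_logDeriv`
that contribution depends on `⁅a, b⁆` alone. -/
lemma loopCocycle_loopAut (c : ℂ) (γ : arcGroup 𝔤 R) (a b : LoopOver 𝔤 R) :
    loopCocycle 𝔤 R c (loopAut γ a) (loopAut γ b)
      = loopCocycle 𝔤 R c a b + anomaly c γ ⁅a, b⁆ := by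
  have h : eulerLoop 𝔤 R (loopAut γ b) = loopAut γ (logDeriv γ b + eulerLoop 𝔤 R b) := by
    rw [logDeriv_apply, sub_add_cancel, LieEquiv.apply_symm_apply]
  rw [loopCocycle_apply, h, killingForm_of_equiv_apply, map_add, killingForm_logDeriv,
    loopCocycle_apply, anomaly_apply, map_add, map_neg, smul_add, smul_neg]
  ring

lemma coeff_trace_eq_zero (T : End (LaurentOver R) (LoopOver 𝔤 R)) {k : ℤ}
    (hT : ∀ x : 𝔤, T (1 ⊗ₜ x) ∈ tail 𝔤 R k) {n : ℤ} (hn : n < k) :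
    coeff n (LinearMap.trace (LaurentOver R) (LoopOver 𝔤 R) T) = 0 := by
  let b := (finBasis ℂ 𝔤).baseChange (LaurentOver R)
  rw [LinearMap.trace_eq_matrix_trace _ b, Matrix.trace, map_sum]
  refine Finset.sum_eq_zero fun i _ => ?_
  rw [Matrix.diag_apply, LinearMap.toMatrix_apply, Basis.baseChange_apply]
  have : tail 𝔤 R k ≤ LinearMap.ker (coeff n ∘ₗ (b.coord i).restrictScalars R) :=
    tail_le fun f x hf => by
      rw [LinearMap.mem_ker, LinearMap.comp_apply, LinearMap.restrictScalars_apply,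
        Basis.coord_apply, Basis.baseChange_repr_tmul, LinearMap.map_smul_of_tower, hf n hn,
        smul_zero]
  exact this (hT _)

/-- For `a` without pole, `ad a` preserves the order while the logarithmic derivative raises it by
one, so the trace has no constant term. -/
lemma anomaly_eq_zero (c : ℂ) (γ : arcGroup 𝔤 R) {a : LoopOver 𝔤 R} (ha : a ∈ tail 𝔤 R 0) :
    anomaly c γ a = 0 := by
  rw [anomaly_apply, coeff_trace_eq_zero (k := 1), smul_zero]
  · intro x
    have := logDeriv_mem_tail γ (lie_mem_tail ha (tmul_mem_tail orderGE_one x))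
    exact this
  · exact zero_lt_one

variable [IsSimple ℂ 𝔤]

/-- The loop algebra is perfect: `𝔤` is spanned by brackets, and `f ⊗ [x, y] = [f ⊗ x, 1 ⊗ y]`. -/
lemma loop_hom_ext {W : Type*} [AddCommGroup W] [Module ℂ W] {l l' : Loop 𝔤 →ₗ[ℂ] W}
    (h : ∀ a b : Loop 𝔤, l ⁅a, b⁆ = l' ⁅a, b⁆) : l = l' := by
  refine TensorProduct.ext' fun f x => ?_
  have hx : x ∈ Submodule.span ℂ {z : 𝔤 | ∃ x y : 𝔤, ⁅x, y⁆ = z} :=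
    lie_eq_span_brackets 𝔤 ▸ Submodule.mem_top
  induction hx using Submodule.span_induction with
  | mem z hz =>
    obtain ⟨x, y, rfl⟩ := hz
    have := h (f ⊗ₜ x) (1 ⊗ₜ y)
    rwa [ExtendScalars.bracket_tmul, mul_one] at this
  | zero => rw [TensorProduct.tmul_zero, map_zero, map_zero]
  | add x y _ _ hx hy => rw [TensorProduct.tmul_add, map_add, map_add, hx, hy]
  | smul c x _ hx => rw [TensorProduct.tmul_smul, map_smul, map_smul, hx]

lemma anomaly_unique {c : ℂ} {γ : arcGroup 𝔤 R} (l : Loop 𝔤 →ₗ[ℂ] R)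
    (h : ∀ a b : Loop 𝔤, loopCocycle 𝔤 R c (loopAut γ (ofLoop 𝔤 R a)) (loopAut γ (ofLoop 𝔤 R b))
      = loopCocycle 𝔤 R c (ofLoop 𝔤 R a) (ofLoop 𝔤 R b) + l ⁅a, b⁆) (a : Loop 𝔤) :
    anomaly c γ (ofLoop 𝔤 R a) = l a := by
  have : (anomaly c γ).restrictScalars ℂ ∘ₗ ofLoop 𝔤 R = l := loop_hom_ext fun a b => by
    have := h a b
    rw [loopCocycle_loopAut, add_right_inj, ← ofLoop_lie] at this
    exact this
  exact congrArg (fun g => g a) this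

/-- Applying `γ'` and then `γ` to the cocycle shows that the right side also measures the change
under `γ γ'`; uniqueness identifies it with the anomaly. -/
lemma anomaly_mul (c : ℂ) (γ γ' : arcGroup 𝔤 R) (a : Loop 𝔤) :
    anomaly c (γ * γ') (ofLoop 𝔤 R a)
      = anomaly c γ (loopAut γ' (ofLoop 𝔤 R a)) + anomaly c γ' (ofLoop 𝔤 R a) := by
  refine anomaly_unique ((anomaly c γ).restrictScalars ℂ ∘ₗ
    ((loopAut γ').toLinearEquiv.toLinearMap.restrictScalars ℂ) ∘ₗ ofLoop 𝔤 R
      + (anomaly c γ').restrictScalars ℂ ∘ₗ ofLoop 𝔤 R) (fun a b => ?_) a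
  rw [loopAut_mul, loopAut_mul, loopCocycle_loopAut, loopCocycle_loopAut, ← LieEquiv.map_lie,
    ← ofLoop_lie]
  simp only [LinearMap.add_apply, LinearMap.comp_apply, LinearMap.restrictScalars_apply]
  rw [add_assoc, add_comm (anomaly c γ' _)]
  rfl

lemma anomaly_one (c : ℂ) (a : Loop 𝔤) : anomaly c (1 : arcGroup 𝔤 R) (ofLoop 𝔤 R a) = 0 := by
  refine anomaly_unique 0 (fun a b => ?_) a
  rw [loopAut_one, loopAut_one, LinearMap.zero_apply, add_zero]

lemma anomaly_natural {S : Type} [CommRing S] [Algebra ℂ S] {f : R →ₐ[ℂ] S}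
    {γ : arcGroup 𝔤 R} {γ' : arcGroup 𝔤 S}
    (h : IsBaseChangeAlong (PowerSeries.mapAlgHom f) γ.1.toLinearMap γ'.1.toLinearMap)
    (c : ℂ) (a : Loop 𝔤) :
    anomaly c γ' (ofLoop 𝔤 S a) = f (anomaly c γ (ofLoop 𝔤 R a)) := by
  refine anomaly_unique (f.toLinearMap ∘ₗ (anomaly c γ).restrictScalars ℂ ∘ₗ ofLoop 𝔤 R)
    (fun a b => ?_) a
  rw [← rTensor_ofLoop f a, ← rTensor_ofLoop f b, ← loopAut_natural h, ← loopAut_natural h,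
    ← map_loopCocycle, loopCocycle_loopAut, map_add, ← map_loopCocycle, ← ofLoop_lie]
  rfl

end LoopAut

/-! ### The action of the loop algebra over a ring on a discrete module -/

open LaurentOver

section LoopOp

variable {𝔤 : Type u} [LieRing 𝔤] [LieAlgebra ℂ 𝔤] {c : ℂ} {M : Type w} [AddCommGroup M]
  [Module ℂ M] (X : ModeRep 𝔤 c M) {R : Type} [CommRing R] [Algebra ℂ R]

lemma tensor_neg_smul (r : R) (w : R ⊗[ℂ] M) : (-r) • w = -(r • w) :=
  neg_smul r w

lemma end_smul_sub (r : R) (f g : End R (R ⊗[ℂ] M)) : r • (f - g) = r • f - r • g :=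
  smul_sub r f g

namespace ModeRep

lemma support_finite (f : LaurentOver R) (x : 𝔤) (v : M) :
    (Function.support fun n : ℤ => coeff n f ⊗ₜ[ℂ] X.mode n x v).Finite := by
  obtain ⟨A, hA⟩ := exists_orderGE f
  obtain ⟨N, hN⟩ := X.smooth v
  refine (Set.finite_Ico A (N : ℤ)).subset fun n hn => ?_
  by_contra h
  rw [Set.mem_Ico, not_and_or, not_le, not_lt] at h
  refine hn ?_
  obtain h | h := h
  · simp only [hA n h, TensorProduct.zero_tmul]
  · simp only [hN n h, TensorProduct.tmul_zero]

/-- The action of `x ⊗ f` as a map `M → R ⊗ M`. -/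
def modeSum (f : LaurentOver R) (x : 𝔤) : M →ₗ[ℂ] R ⊗[ℂ] M where
  toFun v := ∑ᶠ n : ℤ, coeff n f ⊗ₜ[ℂ] X.mode n x v
  map_add' v v' := by
    rw [← finsum_add_distrib (X.support_finite f x v) (X.support_finite f x v')]
    simp only [map_add, TensorProduct.tmul_add]
  map_smul' r v := by
    rw [RingHom.id_apply, smul_finsum' r (X.support_finite f x v)]
    simp only [map_smul, TensorProduct.tmul_smul]

lemma modeSum_apply (f : LaurentOver R) (x : 𝔤) (v : M) :
    X.modeSum f x v = ∑ᶠ n : ℤ, coeff n f ⊗ₜ[ℂ] X.mode n x v := rfl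

/-- The action of `𝔤 ⊗ R((t))` (up to the cocycle) on `R ⊗ M`. -/
def op : LoopOver 𝔤 R →ₗ[R] End R (R ⊗[ℂ] M) :=
  TensorProduct.AlgebraTensorModule.lift <| LinearMap.mk₂' R ℂ
    (fun f x => LinearMap.liftBaseChange R (X.modeSum f x))
    (fun f g x => by
      rw [← map_add]
      congr 1
      ext v
      rw [LinearMap.add_apply, modeSum_apply, modeSum_apply, modeSum_apply,
        ← finsum_add_distrib (X.support_finite f x v) (X.support_finite g x v)]
      simp only [map_add, TensorProduct.add_tmul])
    (fun r f x => by
      rw [← map_smul]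
      congr 1
      ext v
      rw [LinearMap.smul_apply, modeSum_apply, modeSum_apply,
        smul_finsum' r (X.support_finite f x v)]
      simp only [map_smul, TensorProduct.smul_tmul'])
    (fun f x y => by
      rw [← map_add]
      congr 1
      ext v
      rw [LinearMap.add_apply, modeSum_apply, modeSum_apply, modeSum_apply,
        ← finsum_add_distrib (X.support_finite f x v) (X.support_finite f y v)]
      simp only [map_add, LinearMap.add_apply, TensorProduct.tmul_add])
    (fun r f x => by
      refine TensorProduct.AlgebraTensorModule.curry_injective ?_
      ext v
      change (1 : R) • X.modeSum f (r • x) v = r • ((1 : R) • X.modeSum f x v)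
      rw [one_smul, one_smul, modeSum_apply, modeSum_apply,
        smul_finsum' r (X.support_finite f x v)]
      simp only [map_smul, LinearMap.smul_apply, TensorProduct.tmul_smul])

lemma op_tmul (f : LaurentOver R) (x : 𝔤) (r : R) (v : M) :
    X.op (f ⊗ₜ x) (r ⊗ₜ v) = r • ∑ᶠ n : ℤ, coeff n f ⊗ₜ[ℂ] X.mode n x v := rfl

lemma op_tpow (n : ℤ) (x : 𝔤) (r : R) (v : M) :
    X.op ((tpow n : LaurentOver R) ⊗ₜ x) (r ⊗ₜ v) = r ⊗ₜ X.mode n x v := by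
  rw [op_tmul, finsum_eq_single _ n fun m hm => by
    rw [coeff_tpow, if_neg hm, TensorProduct.zero_tmul], coeff_tpow, if_pos rfl,
    TensorProduct.smul_tmul', smul_eq_mul, mul_one]

lemma exists_op_eq_zero (w : R ⊗[ℂ] M) : ∃ N : ℕ, ∀ a ∈ tail 𝔤 R N, X.op a w = 0 := by
  induction w using TensorProduct.induction_on with
  | zero => exact ⟨0, fun a _ => map_zero _⟩
  | add w w' h h' =>
    obtain ⟨N, hN⟩ := h
    obtain ⟨N', hN'⟩ := h'
    refine ⟨max N N', fun a ha => ?_⟩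
    rw [map_add, hN a (tail_mono (by exact_mod_cast le_max_left N N') ha),
      hN' a (tail_mono (by exact_mod_cast le_max_right N N') ha), add_zero]
  | tmul r v =>
    obtain ⟨N, hN⟩ := X.smooth v
    refine ⟨N, fun a ha => ?_⟩
    have : tail 𝔤 R N ≤ LinearMap.ker (X.op.flip (r ⊗ₜ v) : LoopOver 𝔤 R →ₗ[R] R ⊗[ℂ] M) :=
      tail_le fun f x hf => by
        rw [LinearMap.mem_ker, LinearMap.flip_apply, op_tmul, finsum_eq_zero_of_forall_eq_zero,
          smul_zero]
        intro n
        obtain h | h := lt_or_ge n (N : ℤ)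
        · rw [hf n h, TensorProduct.zero_tmul]
        · rw [hN n h, TensorProduct.tmul_zero]
    exact this ha

variable [FiniteDimensional ℂ 𝔤]

/-- The failure of the commutation relation. -/
def opDefect : LoopOver 𝔤 R →ₗ[R] LoopOver 𝔤 R →ₗ[R] End R (R ⊗[ℂ] M) :=
  LinearMap.mk₂ R (fun a b => X.op a * X.op b - X.op b * X.op a - X.op ⁅a, b⁆
      - loopCocycle 𝔤 R c a b • 1)
    (fun a a' b => by
      simp only [map_add, add_lie, add_mul, mul_add, add_smul, LinearMap.add_apply]; abel)
    (fun r a b => by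
      simp only [map_smul, loopOver_smul_lie, LinearMap.smul_apply, smul_mul_assoc, mul_smul_comm,
        end_smul_sub, smul_assoc])
    (fun a b b' => by
      simp only [map_add, lie_add, add_mul, mul_add, add_smul]; abel)
    (fun r a b => by
      simp only [map_smul, loopOver_lie_smul, smul_mul_assoc, mul_smul_comm,
        end_smul_sub, smul_assoc])

lemma opDefect_apply (a b : LoopOver 𝔤 R) (w : R ⊗[ℂ] M) :
    X.opDefect a b w = X.op a (X.op b w) - X.op b (X.op a w) - X.op ⁅a, b⁆ w
      - loopCocycle 𝔤 R c a b • w := rfl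

lemma opDefect_skew (a b : LoopOver 𝔤 R) (w : R ⊗[ℂ] M) :
    X.opDefect a b w = -X.opDefect b a w := by
  rw [opDefect_apply, opDefect_apply, ← lie_skew a b, map_neg, LinearMap.neg_apply,
    loopCocycle_skew c a b, tensor_neg_smul]
  abel

lemma exists_opDefect_eq_zero (a : LoopOver 𝔤 R) (w : R ⊗[ℂ] M) :
    ∃ N : ℤ, ∀ b ∈ tail 𝔤 R N, X.opDefect a b w = 0 := by
  obtain ⟨A, hA⟩ := exists_mem_tail a
  obtain ⟨N₁, h₁⟩ := X.exists_op_eq_zero w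
  obtain ⟨N₂, h₂⟩ := X.exists_op_eq_zero (X.op a w)
  -- Here `N₁`, `N₂` handle the two products, `|A|` compensates the pole of `a` in the bracket, and
  -- the final `1` gives the strict inequality under which the cocycle vanishes.
  refine ⟨N₁ + N₂ + |A| + 1, fun b hb => ?_⟩
  have hA1 := neg_abs_le A
  have hA2 := abs_nonneg A
  rw [opDefect_apply, h₁ b (tail_mono (by omega) hb), h₂ b (tail_mono (by omega) hb),
    h₁ _ (tail_mono (by omega) (lie_mem_tail hA hb)),
    loopCocycle_eq_zero c (by omega) hA hb]
  simp

lemma opDefect_monomials {a b : LoopOver 𝔤 R} (ha : a ∈ monomials 𝔤 R) (hb : b ∈ monomials 𝔤 R)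
    (w : R ⊗[ℂ] M) : X.opDefect a b w = 0 := by
  induction ha using Submodule.span_induction with
  | mem a h =>
    obtain ⟨⟨m, x⟩, rfl⟩ := h
    induction hb using Submodule.span_induction with
    | mem b h =>
      obtain ⟨⟨n, y⟩, rfl⟩ := h
      induction w using TensorProduct.induction_on with
      | zero => rw [map_zero]
      | add w w' h h' => rw [map_add, h, h', add_zero]
      | tmul r v =>
        have h := congrArg (fun g => r ⊗ₜ[ℂ] g v) (X.comm m n x y)
        simp only [LinearMap.sub_apply, LinearMap.add_apply, End.mul_apply, LinearMap.smul_apply,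
          End.one_apply, TensorProduct.tmul_sub, TensorProduct.tmul_add,
          TensorProduct.tmul_smul] at h
        rw [opDefect_apply, op_tpow, op_tpow, op_tpow, op_tpow, ExtendScalars.bracket_tmul,
          tpow_mul, op_tpow, loopCocycle_tmul, euler_tpow, mul_smul_comm, tpow_mul, map_smul,
          coeff_tpow, h, add_sub_cancel_left, sub_eq_zero]
        by_cases hmn : m + n = 0
        · obtain rfl : n = -m := by omega
          rw [if_pos hmn, if_pos hmn.symm, smul_eq_mul, mul_one, ← smul_neg, ← Int.cast_neg, neg_neg,
            ← algebraMap_smul R (_ : ℂ) (r ⊗ₜ[ℂ] v), map_mul, map_intCast, Algebra.smul_def,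
            mul_comm]
        · rw [if_neg hmn, if_neg (Ne.symm hmn)]; simp
    | zero => rw [map_zero, LinearMap.zero_apply]
    | add b b' _ _ h h' => rw [map_add, LinearMap.add_apply, h, h', add_zero]
    | smul r b _ h => rw [map_smul, LinearMap.smul_apply, h, smul_zero]
  | zero => rw [map_zero, LinearMap.zero_apply, LinearMap.zero_apply]
  | add a a' _ _ h h' =>
    rw [map_add, LinearMap.add_apply, LinearMap.add_apply, h, h', add_zero]
  | smul r a _ h => rw [map_smul, LinearMap.smul_apply, LinearMap.smul_apply, h, smul_zero]

/-- For fixed `a` and `w` the defect vanishes on `b` of high order, so `b` may be replaced by a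
combination of monomials. Skew symmetry then exchanges the arguments and the same approximation
treats `a`. -/
lemma opDefect_eq_zero (a b : LoopOver 𝔤 R) (w : R ⊗[ℂ] M) : X.opDefect a b w = 0 := by
  have key : ∀ a ∈ monomials 𝔤 R, ∀ b, X.opDefect a b w = 0 := by
    intro a ha b
    obtain ⟨N, hN⟩ := X.exists_opDefect_eq_zero a w
    obtain ⟨b', hb', h⟩ := exists_monomials_sub_mem_tail b N
    rw [← sub_add_cancel b b', map_add, LinearMap.add_apply, hN _ h,
      X.opDefect_monomials ha hb', add_zero]
  obtain ⟨N, hN⟩ := X.exists_opDefect_eq_zero a w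
  obtain ⟨b', hb', h⟩ := exists_monomials_sub_mem_tail b N
  rw [← sub_add_cancel b b', map_add, LinearMap.add_apply, hN _ h, opDefect_skew, key b' hb',
    neg_zero, add_zero]

lemma op_comm (a b : LoopOver 𝔤 R) : X.op a * X.op b - X.op b * X.op a
      = X.op ⁅a, b⁆ + loopCocycle 𝔤 R c a b • 1 := by
  refine LinearMap.ext fun w => ?_
  have h := X.opDefect_eq_zero a b w
  rw [opDefect_apply, sub_sub, sub_eq_zero] at h
  exact h

omit [FiniteDimensional ℂ 𝔤] in
lemma op_natural {S : Type} [CommRing S] [Algebra ℂ S] (f : R →ₐ[ℂ] S) (a : LoopOver 𝔤 R)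
    (w : R ⊗[ℂ] M) :
    LinearMap.rTensor M f.toLinearMap (X.op a w)
      = X.op (LinearMap.rTensor 𝔤 (map f).toLinearMap a) (LinearMap.rTensor M f.toLinearMap w) := by
  induction a using TensorProduct.induction_on with
  | zero => simp
  | add a a' h h' => simp only [map_add, LinearMap.add_apply, h, h']
  | tmul g x =>
    induction w using TensorProduct.induction_on with
    | zero => simp
    | add w w' h h' => simp only [map_add, h, h']
    | tmul r v =>
      rw [op_tmul, rTensor_algHom_smul, LinearMap.rTensor_tmul, LinearMap.rTensor_tmul, op_tmul,
        AlgHom.toLinearMap_apply]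
      congr 1
      refine ((LinearMap.rTensor M f.toLinearMap).toAddMonoidHom.map_finsum
        (X.support_finite g x v)).trans ?_
      refine finsum_congr fun n => ?_
      rfl

end ModeRep

end LoopOp

/-! ### The vacuum Weyl module is discrete -/

open LaurentOver

section Discrete

variable {𝔤 : Type u} [LieRing 𝔤] [LieAlgebra ℂ 𝔤] (κ : InvariantForm 𝔤)

lemma Laurent.exists_eq_tpow_mul {f : Laurent} {N : ℤ} (hf : ∀ n, n < N → f.coeff n = 0) :
    ∃ g : ℂ⟦X⟧, f = tpow N * ofPowerSeries g := by
  refine ⟨PowerSeries.mk fun i => f.coeff (N + i), Laurent.ext fun n => ?_⟩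
  have h := coeff_tpow_mul N n (ofPS (R := ℂ) (PowerSeries.mk fun i => f.coeff (N + i)))
  refine Eq.trans ?_ h.symm
  obtain hn | hn := lt_or_ge n N
  · rw [hf n hn, coeff_ofPS_of_neg _ (by omega)]
  · rw [show n - N = ((n - N).toNat : ℤ) by omega, coeff_ofPS, PowerSeries.coeff_mk,
      Int.toNat_of_nonneg (by omega), add_sub_cancel]

lemma Laurent.exists_pole (f : Laurent) :
    ∃ (m : ℕ) (g : ℂ⟦X⟧), f = tpow (-m : ℤ) * ofPowerSeries g := by
  obtain ⟨A, hA⟩ := exists_orderGE (R := ℂ) f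
  obtain ⟨g, hg⟩ := Laurent.exists_eq_tpow_mul (f := f) (N := -((-A).toNat : ℤ))
    fun n hn => hA n (by omega)
  exact ⟨_, g, hg⟩

lemma arcToLoop_X_pow_smul (m : ℕ) (ξ : Arc 𝔤) :
    arcToLoop ((PowerSeries.X ^ m : ℂ⟦X⟧) • ξ) = Laurent.tpow m • arcToLoop ξ := by
  rw [arcToLoop, rTensor_algHom_smul, Laurent.ofPowerSeries_X_pow]

lemma loop_exists_pole (a : Loop 𝔤) :
    ∃ (m : ℕ) (η : Arc 𝔤), a = Laurent.tpow (-m : ℤ) • arcToLoop η := by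
  induction a using TensorProduct.induction_on with
  | zero => exact ⟨0, 0, by simp⟩
  | tmul f x =>
    obtain ⟨m, g, rfl⟩ := Laurent.exists_pole f
    refine ⟨m, g ⊗ₜ x, ?_⟩
    change _ = _ • (Laurent.ofPowerSeries g ⊗ₜ[ℂ] x)
    rw [TensorProduct.smul_tmul', smul_eq_mul]
  | add a b ha hb =>
    obtain ⟨m, η, rfl⟩ := ha
    obtain ⟨n, θ, rfl⟩ := hb
    refine ⟨m + n, (PowerSeries.X ^ n : ℂ⟦X⟧) • η + (PowerSeries.X ^ m : ℂ⟦X⟧) • θ, ?_⟩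
    rw [map_add, arcToLoop_X_pow_smul, arcToLoop_X_pow_smul, smul_add, smul_smul, smul_smul,
      Laurent.tpow_mul, Laurent.tpow_mul]
    congr 3 <;> push_cast <;> ring

lemma vacuumWeyl_one_lie (v : VacuumWeyl κ) : ⁅Affine.one κ, v⁆ = v := by
  have h := vacuumWeyl_induction κ (LinearMap.eqLocus
    (LieModule.toEnd ℂ (Affine κ) (VacuumWeyl κ) (Affine.one κ)) LinearMap.id) (one_lie_vac κ)
    fun a v hv => by
      have hv' : ⁅Affine.one κ, v⁆ = v := hv
      change ⁅Affine.one κ, ⁅a, v⁆⁆ = ⁅a, v⁆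
      obtain ⟨b, s, rfl⟩ := Affine.eq_mk κ a
      have h0 : ⁅Affine.one κ, Affine.mk κ b s⁆ = 0 := by
        rw [Affine.one, Affine.mk_lie_mk, zero_lie, map_zero, LinearMap.zero_apply, Affine.mk_eq,
          map_zero, zero_smul, add_zero]
      rw [leibniz_lie, h0, zero_lie, zero_add, hv']
  have : v ∈ LinearMap.eqLocus (LieModule.toEnd ℂ (Affine κ) (VacuumWeyl κ) (Affine.one κ))
    LinearMap.id := h ▸ Submodule.mem_top
  exact this

variable [FiniteDimensional ℂ 𝔤] {c : ℂ} (hκ : κ.form = c • killingForm ℂ 𝔤)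

lemma ofLoop_arcToLoop_mem_tail {R : Type} [CommRing R] [Algebra ℂ R] (N : ℕ) (ξ : Arc 𝔤) :
    ofLoop 𝔤 R (arcToLoop ((PowerSeries.X ^ N : ℂ⟦X⟧) • ξ)) ∈ tail 𝔤 R N := by
  rw [arcToLoop_X_pow_smul, ofLoop, rTensor_algHom_smul, ofLaurent_tpow]
  have h := rTensor_ofPS_mem_tail
    (LinearMap.rTensor 𝔤 (PowerSeries.mapAlgHom (Algebra.ofId ℂ R)).toLinearMap ξ)
  rw [← ofLoop_arcToLoop] at h
  have := smul_mem_tail (orderGE_tpow (N : ℤ)) h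
  rwa [add_zero] at this

-- The vectors with a bound `N` form a submodule containing the vacuum. An element with pole of
-- order `m` raises the bound by a controlled amount, so the submodule is everything.
include hκ in
lemma vacuumWeyl_discrete (v : VacuumWeyl κ) : ∃ N : ℕ, ∀ ξ : Arc 𝔤,
    ⁅Affine.ofArc κ ((PowerSeries.X ^ N : ℂ⟦X⟧) • ξ), v⁆ = 0 := by
  have hmono : ∀ {N N' : ℕ} {v : VacuumWeyl κ}, N ≤ N' →
      (∀ ξ : Arc 𝔤, ⁅Affine.ofArc κ ((PowerSeries.X ^ N : ℂ⟦X⟧) • ξ), v⁆ = 0) →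
      ∀ ξ : Arc 𝔤, ⁅Affine.ofArc κ ((PowerSeries.X ^ N' : ℂ⟦X⟧) • ξ), v⁆ = 0 := by
    intro N N' v h hN ξ
    rw [← Nat.add_sub_cancel' h, pow_add, mul_smul]
    exact hN _
  let W : Submodule ℂ (VacuumWeyl κ) :=
    { carrier := {v | ∃ N : ℕ, ∀ ξ : Arc 𝔤,
        ⁅Affine.ofArc κ ((PowerSeries.X ^ N : ℂ⟦X⟧) • ξ), v⁆ = 0}
      zero_mem' := ⟨0, fun ξ => lie_zero _⟩
      add_mem' := by
        rintro v v' ⟨N, hN⟩ ⟨N', hN'⟩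
        refine ⟨max N N', fun ξ => ?_⟩
        rw [lie_add, hmono (le_max_left _ _) hN, hmono (le_max_right _ _) hN', add_zero]
      smul_mem' := by
        rintro r v ⟨N, hN⟩
        exact ⟨N, fun ξ => by rw [lie_smul, hN, smul_zero]⟩ }
  have hW : W = ⊤ := vacuumWeyl_induction κ W ⟨0, fun ξ => ofArc_lie_vac κ _⟩ fun a v hv => by
    obtain ⟨N, hN⟩ := hv
    obtain ⟨b, s, rfl⟩ := Affine.eq_mk κ a
    obtain ⟨m, η, rfl⟩ := loop_exists_pole b
    -- Order `N + m` would suffice for the bracket; the extra `1` makes the cocycle vanish even when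
    -- `N = 0`.
    refine ⟨N + m + 1, fun ξ => ?_⟩
    have h0 : ⁅Affine.ofArc κ ((PowerSeries.X ^ (N + m + 1) : ℂ⟦X⟧) • ξ), v⁆ = 0 :=
      hmono (by omega) hN ξ
    have h1 : ⁅arcToLoop ((PowerSeries.X ^ (N + m + 1) : ℂ⟦X⟧) • ξ),
        Laurent.tpow (-m : ℤ) • arcToLoop η⁆
          = arcToLoop ((PowerSeries.X ^ N : ℂ⟦X⟧) • (PowerSeries.X : ℂ⟦X⟧) • ⁅ξ, η⁆) := by
      have h : arcToLoop ⁅ξ, η⁆ = ⁅arcToLoop ξ, arcToLoop η⁆ := rTensor_algHom_lie _ ξ η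
      rw [extend_lie_smul, arcToLoop_X_pow_smul, extend_smul_lie, smul_smul, Laurent.tpow_mul, ← h,
        smul_smul, ← pow_succ, arcToLoop_X_pow_smul]
      congr 2
      push_cast
      ring
    have h2 : cocycleForm κ (arcToLoop ((PowerSeries.X ^ (N + m + 1) : ℂ⟦X⟧) • ξ))
        (Laurent.tpow (-m : ℤ) • arcToLoop η) = 0 := by
      have h := loopCocycle_ofLoop (R := ℂ) hκ
        (arcToLoop ((PowerSeries.X ^ (N + m + 1) : ℂ⟦X⟧) • ξ))
        (Laurent.tpow (-m : ℤ) • arcToLoop η)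
      rw [loopCocycle_eq_zero c (M := (N + m + 1 : ℕ)) (N := -m) (by push_cast; omega)
        (ofLoop_arcToLoop_mem_tail _ ξ)] at h
      · exact h.symm
      · have h3 := ofLoop_arcToLoop_mem_tail (R := ℂ) 0 η
        rw [pow_zero, one_smul] at h3
        rw [ofLoop, rTensor_algHom_smul, ofLaurent_tpow]
        have := smul_mem_tail (orderGE_tpow (-m : ℤ)) h3
        rwa [Nat.cast_zero, add_zero] at this
    rw [leibniz_lie, h0, lie_zero, add_zero, Affine.ofArc, Affine.mk_lie_mk, h1, h2]
    exact hN _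
  exact (hW ▸ Submodule.mem_top : v ∈ W)

end Discrete

/-! ### Compatibility of the extended action with the original one -/

section OpOfLoop

variable {𝔤 : Type u} [LieRing 𝔤] [LieAlgebra ℂ 𝔤] [FiniteDimensional ℂ 𝔤] (κ : InvariantForm 𝔤)
  {M : Type w} [AddCommGroup M] [Module ℂ M] [LieRingModule (Affine κ) M] [LieModule ℂ (Affine κ) M]
  (h1 : ∀ m : M, ⁅Affine.one κ, m⁆ = m) {c : ℂ} (hκ : κ.form = c • killingForm ℂ 𝔤)
  (hdisc : ∀ m : M, ∃ N : ℕ, ∀ ξ : Arc 𝔤,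
      ⁅Affine.ofArc κ ((PowerSeries.X ^ N : ℂ⟦X⟧) • ξ), m⁆ = 0)
  {R : Type} [CommRing R] [Algebra ℂ R]

/-- The original action on an infinite Laurent series is not by definition a sum of modes. The
series is cut at an order beyond which both actions kill the vector, leaving a finite sum of
monomials. -/
lemma op_ofLoop (a : Loop 𝔤) (r : R) (v : M) :
    (modeRep κ h1 hκ hdisc).op (ofLoop 𝔤 R a) (r ⊗ₜ v) = r ⊗ₜ loopAct κ M a v := by
  induction a using TensorProduct.induction_on with
  | zero => simp
  | add a b ha hb =>
    simp only [map_add, LinearMap.add_apply, TensorProduct.tmul_add, ha, hb]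
  | tmul f x =>
    obtain ⟨N, hN⟩ := hdisc v
    obtain ⟨N', hN'⟩ := (modeRep κ h1 hκ hdisc).exists_op_eq_zero (r ⊗ₜ[ℂ] v : R ⊗[ℂ] M)
    obtain ⟨A, hA⟩ := exists_orderGE (R := ℂ) f
    set g : Laurent := ∑ n ∈ Finset.Ico A (N + N' : ℤ), f.coeff n • Laurent.tpow n with hg
    have hfg : OrderGE (R := ℂ) (N + N' : ℤ) (f - g) := orderGE_sub_sum (R := ℂ) hA (N + N' : ℤ)
    have e : f ⊗ₜ[ℂ] x = (f - g) ⊗ₜ[ℂ] x + g ⊗ₜ[ℂ] x := by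
      rw [← TensorProduct.add_tmul, sub_add_cancel]
    have e1 : loopAct κ M ((f - g) ⊗ₜ[ℂ] x) v = 0 := by
      obtain ⟨h, hh⟩ := Laurent.exists_eq_tpow_mul (f := f - g) (N := N) (hfg.mono (by omega))
      rw [hh, ← Laurent.ofPowerSeries_X_pow, ← map_mul]
      exact loopAct_tmul_killed κ hN h x
    have e2 : (modeRep κ h1 hκ hdisc).op (ofLoop 𝔤 R ((f - g) ⊗ₜ[ℂ] x)) (r ⊗ₜ[ℂ] v) = 0 := by
      refine hN' _ ?_
      rw [ofLoop_tmul]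
      refine tmul_mem_tail (fun n hn => ?_) x
      rw [coeff_ofLaurent]
      have : (f - g).coeff n = 0 := hfg n (by omega)
      rw [this, map_zero]
    have e3 : (modeRep κ h1 hκ hdisc).op (ofLoop 𝔤 R (g ⊗ₜ[ℂ] x)) (r ⊗ₜ[ℂ] v)
        = r ⊗ₜ loopAct κ M (g ⊗ₜ[ℂ] x) v := by
      rw [hg, TensorProduct.sum_tmul]
      simp only [map_sum, LinearMap.sum_apply, TensorProduct.tmul_sum]
      refine Finset.sum_congr rfl fun n _ => ?_
      rw [← TensorProduct.smul_tmul', map_smul, LinearMap.map_smul_of_tower,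
        LinearMap.smul_apply, map_smul, LinearMap.smul_apply, TensorProduct.tmul_smul, ofLoop_tmul,
        ofLaurent_tpow, ModeRep.op_tpow, modeRep_mode]
    rw [e, map_add, map_add, map_add, LinearMap.add_apply, LinearMap.add_apply, e1, e2, e3,
      TensorProduct.tmul_add, TensorProduct.tmul_zero]

end OpOfLoop

/-! ### The action of the arc group on the vacuum Weyl module -/

open LaurentOver

section Action

variable {𝔤 : Type u} [LieRing 𝔤] [LieAlgebra ℂ 𝔤]

/-- The loop algebra component of an element of `𝔤̂_κ`. -/
def Affine.loop (κ : InvariantForm 𝔤) : Affine κ →ₗ[ℂ] Loop 𝔤 where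
  toFun a := a.carrier.1
  map_add' _ _ := rfl
  map_smul' _ _ := rfl

/-- The central component of an element of `𝔤̂_κ`. -/
def Affine.central (κ : InvariantForm 𝔤) : Affine κ →ₗ[ℂ] ℂ where
  toFun a := TrivialLieModule.equiv ℂ (Loop 𝔤) ℂ a.carrier.2
  map_add' _ _ := rfl
  map_smul' _ _ := rfl

lemma Affine.loop_mk (κ : InvariantForm 𝔤) (a : Loop 𝔤) (s : ℂ) :
    Affine.loop κ (Affine.mk κ a s) = a := rfl

lemma Affine.central_mk (κ : InvariantForm 𝔤) (a : Loop 𝔤) (s : ℂ) :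
    Affine.central κ (Affine.mk κ a s) = s := rfl

lemma vacuumWeyl_mk_lie (κ : InvariantForm 𝔤) (a : Loop 𝔤) (s : ℂ) (v : VacuumWeyl κ) :
    ⁅Affine.mk κ a s, v⁆ = loopAct κ (VacuumWeyl κ) a v + s • v := by
  rw [Affine.mk_eq, add_lie, smul_lie, vacuumWeyl_one_lie, loopAct_apply]

lemma vacuumWeyl_loop_ext (κ : InvariantForm 𝔤) {W : Type w} [AddCommGroup W] [Module ℂ W]
    (F : Loop 𝔤 → W → W) {h h' : VacuumWeyl κ →ₗ[ℂ] W}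
    (hh : ∀ a v, h (loopAct κ _ a v) = F a (h v)) (hh' : ∀ a v, h' (loopAct κ _ a v) = F a (h' v))
    (hvac : h (vac κ) = h' (vac κ)) : h = h' := by
  refine vacuumWeyl_hom_ext κ (fun a w => F (Affine.loop κ a) w + Affine.central κ a • w)
    (fun a v => ?_) (fun a v => ?_) hvac
  · obtain ⟨b, s, rfl⟩ := Affine.eq_mk κ a
    rw [vacuumWeyl_mk_lie, map_add, hh, map_smul, Affine.loop_mk, Affine.central_mk]
  · obtain ⟨b, s, rfl⟩ := Affine.eq_mk κ a
    rw [vacuumWeyl_mk_lie, map_add, hh', map_smul, Affine.loop_mk, Affine.central_mk]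

variable [FiniteDimensional ℂ 𝔤] {κ : InvariantForm 𝔤} {c : ℂ}
  (hκ : κ.form = c • killingForm ℂ 𝔤)

/-- The modes of the vacuum Weyl module. -/
def vacRep : ModeRep 𝔤 c (VacuumWeyl κ) :=
  modeRep κ (vacuumWeyl_one_lie κ) hκ (vacuumWeyl_discrete κ hκ)

variable {R : Type} [CommRing R] [Algebra ℂ R]

lemma vacRep_op_ofLoop (a : Loop 𝔤) (r : R) (v : VacuumWeyl κ) :
    (vacRep hκ).op (ofLoop 𝔤 R a) (r ⊗ₜ v) = r ⊗ₜ loopAct κ _ a v :=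
  op_ofLoop κ _ hκ _ a r v

lemma vacRep_op_vac {a : LoopOver 𝔤 R} (ha : a ∈ tail 𝔤 R 0) (r : R) :
    (vacRep hκ).op a (r ⊗ₜ vac κ) = 0 := by
  have : tail 𝔤 R 0 ≤ LinearMap.ker ((vacRep hκ).op.flip (r ⊗ₜ vac κ) :
      LoopOver 𝔤 R →ₗ[R] R ⊗[ℂ] VacuumWeyl κ) := tail_le fun f x hf => by
    rw [LinearMap.mem_ker, LinearMap.flip_apply, ModeRep.op_tmul,
      finsum_eq_zero_of_forall_eq_zero, smul_zero]
    intro n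
    obtain h | h := lt_or_ge n 0
    · rw [hf n h, TensorProduct.zero_tmul]
    · obtain ⟨k, rfl⟩ := Int.eq_ofNat_of_zero_le h
      have h0 : ⁅Affine.ofArc κ ((PowerSeries.X ^ k : ℂ⟦X⟧) ⊗ₜ x), vac κ⁆ = 0 := ofArc_lie_vac κ _
      have h1 : (vacRep hκ).mode k x (vac κ) = 0 := by
        rw [vacRep, modeRep_mode, ← Laurent.ofPowerSeries_X_pow]
        exact h0
      rw [h1, TensorProduct.tmul_zero]
  exact this ha

/-- The action of the loop algebra on `R ⊗ V` twisted by a point of `G(R[[t]])`. -/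
def twist (γ : arcGroup 𝔤 R) : LoopOver 𝔤 R →ₗ[R] End R (R ⊗[ℂ] VacuumWeyl κ) :=
  (vacRep hκ).op ∘ₗ (loopAut γ).toLinearEquiv.toLinearMap.restrictScalars R
    + (anomaly c γ).smulRight 1

lemma twist_apply (γ : arcGroup 𝔤 R) (a : LoopOver 𝔤 R) (w : R ⊗[ℂ] VacuumWeyl κ) :
    twist hκ γ a w = (vacRep hκ).op (loopAut γ a) w + anomaly c γ a • w := rfl

/-- The change of the cocycle under `γ` is absorbed by the scalar term of the twist, so the
relations hold with the original cocycle. -/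
lemma twist_comm (γ : arcGroup 𝔤 R) (a b : LoopOver 𝔤 R) (w : R ⊗[ℂ] VacuumWeyl κ) :
    twist hκ γ a (twist hκ γ b w) - twist hκ γ b (twist hκ γ a w)
      = twist hκ γ ⁅a, b⁆ w + loopCocycle 𝔤 R c a b • w := by
  have h := congrArg (fun g => g w) ((vacRep hκ).op_comm (loopAut γ a) (loopAut γ b))
  simp only [LinearMap.sub_apply, End.mul_apply, LinearMap.add_apply, LinearMap.smul_apply,
    End.one_apply, loopCocycle_loopAut, add_smul, ← LieEquiv.map_lie] at h
  simp only [twist_apply, map_add, map_smul, smul_add]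
  rw [smul_comm (anomaly c γ a) (anomaly c γ b) w, ← sub_eq_zero]
  rw [← sub_eq_zero] at h
  rw [← h]
  abel

/-- The universal property is applied to `R ⊗ V` with the twisted action. The vacuum stays
annihilated because `γ` preserves power series loops and the anomaly vanishes on them. -/
lemma exists_orbit (γ : arcGroup 𝔤 R) : ∃ Φ : VacuumWeyl κ →ₗ[ℂ] R ⊗[ℂ] VacuumWeyl κ,
    Φ (vac κ) = 1 ⊗ₜ vac κ ∧
      ∀ a v, Φ (loopAct κ _ a v) = twist hκ γ (ofLoop 𝔤 R a) (Φ v) := by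
  let F₀ : Loop 𝔤 →ₗ[ℂ] End ℂ (R ⊗[ℂ] VacuumWeyl κ) :=
    { toFun a := (twist hκ γ (ofLoop 𝔤 R a)).restrictScalars ℂ
      map_add' a b := by rw [map_add, map_add]; rfl
      map_smul' r a := by rw [map_smul, LinearMap.map_smul_of_tower]; rfl }
  let F : Affine κ →ₗ[ℂ] End ℂ (R ⊗[ℂ] VacuumWeyl κ) :=
    F₀ ∘ₗ Affine.loop κ + (Affine.central κ).smulRight 1
  have hF : ∀ a s w, F (Affine.mk κ a s) w = twist hκ γ (ofLoop 𝔤 R a) w + s • w :=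
    fun _ _ _ => rfl
  obtain ⟨Φ, hvac, hΦ⟩ := exists_vacuumWeyl_lift κ F (m := (1 : R) ⊗ₜ[ℂ] vac κ)
    (fun a b => by
      obtain ⟨a, s, rfl⟩ := Affine.eq_mk κ a
      obtain ⟨b, r, rfl⟩ := Affine.eq_mk κ b
      refine LinearMap.ext fun w => ?_
      rw [Affine.mk_lie_mk, LinearMap.sub_apply, End.mul_apply, End.mul_apply]
      simp only [hF, map_add, LinearMap.map_smul_of_tower, smul_add]
      have h := twist_comm hκ γ (ofLoop 𝔤 R a) (ofLoop 𝔤 R b) w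
      rw [← ofLoop_lie, loopCocycle_ofLoop hκ, algebraMap_smul] at h
      rw [← h, smul_comm r s w]
      abel)
    (fun ξ => by
      change F (Affine.mk κ (arcToLoop ξ) 0) _ = 0
      have ht : ofLoop 𝔤 R (arcToLoop ξ) ∈ tail 𝔤 R 0 := by
        rw [ofLoop_arcToLoop]; exact rTensor_ofPS_mem_tail _
      rw [hF, zero_smul, add_zero, twist_apply, vacRep_op_vac hκ (loopAut_mem_tail γ ht),
        anomaly_eq_zero c γ ht, zero_smul, add_zero])
    (by
      change F (Affine.mk κ 0 1) _ = _
      rw [hF, map_zero, map_zero, LinearMap.zero_apply, zero_add, one_smul])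
  refine ⟨Φ, hvac, fun a v => ?_⟩
  have h := hΦ (Affine.mk κ a 0) v
  rwa [vacuumWeyl_mk_lie, zero_smul, add_zero, hF, zero_smul, add_zero] at h

/-- The orbit map of a point of `G(R[[t]])`. -/
def orbit (γ : arcGroup 𝔤 R) : VacuumWeyl κ →ₗ[ℂ] R ⊗[ℂ] VacuumWeyl κ :=
  (exists_orbit hκ γ).choose

lemma orbit_vac (γ : arcGroup 𝔤 R) : orbit hκ γ (vac κ) = 1 ⊗ₜ vac κ :=
  (exists_orbit hκ γ).choose_spec.1

lemma orbit_loopAct (γ : arcGroup 𝔤 R) (a : Loop 𝔤) (v : VacuumWeyl κ) :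
    orbit hκ γ (loopAct κ _ a v) = twist hκ γ (ofLoop 𝔤 R a) (orbit hκ γ v) :=
  (exists_orbit hκ γ).choose_spec.2 a v

lemma orbit_unique {γ : arcGroup 𝔤 R} (h : VacuumWeyl κ →ₗ[ℂ] R ⊗[ℂ] VacuumWeyl κ)
    (hvac : h (vac κ) = 1 ⊗ₜ vac κ)
    (hl : ∀ a v, h (loopAct κ _ a v) = twist hκ γ (ofLoop 𝔤 R a) (h v)) : orbit hκ γ = h :=
  vacuumWeyl_loop_ext κ (fun a w => twist hκ γ (ofLoop 𝔤 R a) w) (orbit_loopAct hκ γ) hl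
    ((orbit_vac hκ γ).trans hvac.symm)

/-- The action of a point of `G(R[[t]])` on `R ⊗ V`. -/
def arcAct (γ : arcGroup 𝔤 R) : End R (R ⊗[ℂ] VacuumWeyl κ) :=
  LinearMap.liftBaseChange R (orbit hκ γ)

lemma arcAct_tmul (γ : arcGroup 𝔤 R) (r : R) (v : VacuumWeyl κ) :
    arcAct hκ γ (r ⊗ₜ v) = r • orbit hκ γ v := rfl

lemma arcAct_one_tmul (γ : arcGroup 𝔤 R) (v : VacuumWeyl κ) :
    arcAct hκ γ (1 ⊗ₜ v) = orbit hκ γ v := by rw [arcAct_tmul, one_smul]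

lemma arcAct_ofLoop (γ : arcGroup 𝔤 R) (a : Loop 𝔤) (w : R ⊗[ℂ] VacuumWeyl κ) :
    arcAct hκ γ ((vacRep hκ).op (ofLoop 𝔤 R a) w) = twist hκ γ (ofLoop 𝔤 R a) (arcAct hκ γ w) := by
  induction w using TensorProduct.induction_on with
  | zero => simp
  | add w w' h h' => simp only [map_add, h, h']
  | tmul r v => rw [vacRep_op_ofLoop, arcAct_tmul, arcAct_tmul, orbit_loopAct, map_smul]

/-- Loops over `ℂ` do not suffice for composition, since `γ' a` has coefficients in `R`. The
relation extends by linearity to monomials over `R` and then by density. -/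
lemma arcAct_op (γ : arcGroup 𝔤 R) (a : LoopOver 𝔤 R) (w : R ⊗[ℂ] VacuumWeyl κ) :
    arcAct hκ γ ((vacRep hκ).op a w) = twist hκ γ a (arcAct hκ γ w) := by
  obtain ⟨N, hN⟩ := (vacRep hκ).exists_op_eq_zero w
  obtain ⟨N', hN'⟩ := (vacRep hκ).exists_op_eq_zero (arcAct hκ γ w)
  obtain ⟨a', ha', h⟩ := exists_monomials_sub_mem_tail a (N + N' : ℤ)
  have h1 : arcAct hκ γ ((vacRep hκ).op a' w) = twist hκ γ a' (arcAct hκ γ w) := by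
    clear h
    induction ha' using Submodule.span_induction with
    | mem a h =>
      obtain ⟨⟨n, x⟩, rfl⟩ := h
      have := arcAct_ofLoop hκ γ (Laurent.tpow n ⊗ₜ x) w
      rwa [ofLoop_tmul, ofLaurent_tpow] at this
    | zero => simp
    | add a b _ _ h h' => simp only [map_add, LinearMap.add_apply, h, h']
    | smul r a _ h => simp only [map_smul, LinearMap.smul_apply, h]
  rw [← sub_add_cancel a a', map_add, map_add, LinearMap.add_apply, LinearMap.add_apply, map_add, h1,
    hN _ (tail_mono (by omega) h), map_zero, twist_apply hκ γ (a - a'),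
    hN' _ (loopAut_mem_tail γ (tail_mono (by omega) h)),
    anomaly_eq_zero c γ (tail_mono (by omega) h), zero_smul, add_zero]

variable [IsSimple ℂ 𝔤]

/-- The composite fixes the vacuum and intertwines with the twist by `γ γ'`, thanks to
`anomaly_mul`; uniqueness of orbit maps concludes. -/
lemma arcAct_mul (γ γ' : arcGroup 𝔤 R) : arcAct hκ (γ * γ') = arcAct hκ γ * arcAct hκ γ' := by
  have h : orbit hκ (γ * γ') = (arcAct hκ γ).restrictScalars ℂ ∘ₗ orbit hκ γ' := by
    refine orbit_unique hκ _ ?_ fun a v => ?_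
    · rw [LinearMap.comp_apply, orbit_vac]
      exact (arcAct_one_tmul hκ γ _).trans (orbit_vac hκ γ)
    · simp only [LinearMap.comp_apply, LinearMap.restrictScalars_apply]
      rw [orbit_loopAct, twist_apply, map_add, map_smul, arcAct_op, twist_apply, twist_apply,
        loopAut_mul, anomaly_mul, add_smul, add_assoc]
  refine LinearMap.ext fun w => ?_
  induction w using extendScalars_induction with
  | h1 v =>
    rw [arcAct_one_tmul, h, End.mul_apply, arcAct_one_tmul]
    rfl
  | hadd w w' h h' => simp only [map_add, h, h']
  | hsmul r w h => simp only [map_smul, h]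

lemma arcAct_one : arcAct hκ (1 : arcGroup 𝔤 R) = 1 := by
  have h : orbit hκ (1 : arcGroup 𝔤 R) = TensorProduct.mk ℂ R (VacuumWeyl κ) 1 := by
    refine orbit_unique hκ _ rfl fun a v => ?_
    rw [twist_apply, loopAut_one, anomaly_one, zero_smul, add_zero, TensorProduct.mk_apply,
      TensorProduct.mk_apply, vacRep_op_ofLoop]
  refine LinearMap.ext fun w => ?_
  induction w using extendScalars_induction with
  | h1 v => rw [arcAct_one_tmul, h, End.one_apply, TensorProduct.mk_apply]
  | hadd w w' h h' => simp only [map_add, h, h']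
  | hsmul r w h => simp only [map_smul, h]

lemma arcAct_natural {S : Type} [CommRing S] [Algebra ℂ S] {f : R →ₐ[ℂ] S}
    {γ : arcGroup 𝔤 R} {γ' : arcGroup 𝔤 S}
    (h : IsBaseChangeAlong (PowerSeries.mapAlgHom f) γ.1.toLinearMap γ'.1.toLinearMap) :
    IsBaseChangeAlong f (arcAct hκ γ) (arcAct hκ γ') := by
  have h0 : orbit hκ γ' = LinearMap.rTensor _ f.toLinearMap ∘ₗ orbit hκ γ := by
    refine orbit_unique hκ _ ?_ fun a v => ?_
    · rw [LinearMap.comp_apply, orbit_vac, LinearMap.rTensor_tmul, AlgHom.toLinearMap_apply,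
        map_one]
    · rw [LinearMap.comp_apply, LinearMap.comp_apply, orbit_loopAct, twist_apply, twist_apply,
        map_add, rTensor_algHom_smul, ModeRep.op_natural, loopAut_natural h, rTensor_ofLoop,
        anomaly_natural h]
  intro w
  induction w using extendScalars_induction with
  | h1 v =>
    rw [arcAct_one_tmul, LinearMap.rTensor_tmul, AlgHom.toLinearMap_apply, map_one,
      arcAct_one_tmul, h0, LinearMap.comp_apply]
  | hadd w w' h h' => simp only [map_add, h, h']
  | hsmul r w h => rw [map_smul, rTensor_algHom_smul, rTensor_algHom_smul, map_smul, h]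

/-- The point `γ` of `G(R[[t]])` is `1 + e ad ξ`. -/
def IsInfinitesimal (ξ : Arc 𝔤) (e : R) (γ : arcGroup 𝔤 R) : Prop :=
  ∀ y : R⟦X⟧ ⊗[ℂ] 𝔤, γ.1 y = y + (PowerSeries.C e : R⟦X⟧) •
    ⁅LinearMap.rTensor 𝔤 (PowerSeries.mapAlgHom (Algebra.ofId ℂ R)).toLinearMap ξ, y⁆

lemma loopAut_tangent {ξ : Arc 𝔤} {e : R} {γ : arcGroup 𝔤 R}
    (h : IsInfinitesimal ξ e γ) (a : Loop 𝔤) :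
    loopAut γ (ofLoop 𝔤 R a) = ofLoop 𝔤 R a
      + e • ofLoop 𝔤 R ⁅arcToLoop ξ, a⁆ := by
  have hC : ofPS (PowerSeries.C e)
      = algebraMap R (LaurentOver R) e := HahnSeries.ofPowerSeries_C _
  have key : ∀ z : LoopOver 𝔤 R, loopAut γ z = z
      + e • ⁅ofLoop 𝔤 R (arcToLoop ξ), z⁆ := by
    intro z
    induction z using extendScalars_induction with
    | h1 x =>
      have hx : ((1 : LaurentOver R) ⊗ₜ[ℂ] x) = LinearMap.rTensor 𝔤
          (ofPS (R := R)).toLinearMap ((1 : R⟦X⟧) ⊗ₜ[ℂ] x) := by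
        rw [LinearMap.rTensor_tmul, AlgHom.toLinearMap_apply, map_one]
      rw [hx, loopAut_rTensor, h, map_add, rTensor_algHom_smul, rTensor_algHom_lie,
        ← ofLoop_arcToLoop, hC, algebraMap_smul]
    | hadd w w' h h' => rw [map_add, h, h', lie_add, smul_add]; abel
    | hsmul f w h =>
      rw [map_smul, h, extend_lie_smul, smul_add, smul_comm]
  rw [key, ofLoop_lie]

-- Expanding the cocycle at `γ a` and `γ b` to first order in `e`, the cocycle identity collects the
-- linear terms into the value at `(ξ, ⁅a, b⁆)`; `e² = 0` removes the rest.
include hκ in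
lemma anomaly_tangent {ξ : Arc 𝔤} {e : R} {γ : arcGroup 𝔤 R}
    (h : IsInfinitesimal ξ e γ) (he : e * e = 0)
    (a : Loop 𝔤) :
    anomaly c γ (ofLoop 𝔤 R a)
      = e * algebraMap ℂ R (cocycleForm κ (arcToLoop ξ) a) := by
  refine anomaly_unique (LinearMap.mulLeft ℂ e ∘ₗ Algebra.linearMap ℂ R ∘ₗ
    cocycleForm κ (arcToLoop ξ)) (fun a b => ?_) a
  simp only [LinearMap.comp_apply, LinearMap.mulLeft_apply, Algebra.linearMap_apply]
  rw [loopAut_tangent h, loopAut_tangent h, cocycleForm_cocycle]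
  simp only [map_add, map_smul, LinearMap.add_apply, LinearMap.smul_apply, smul_eq_mul,
    loopCocycle_ofLoop hκ]
  have hs := cocycleForm_skew κ (arcToLoop ξ) ⁅a, b⁆
  linear_combination (algebraMap ℂ R (cocycleForm κ ⁅arcToLoop ξ, a⁆ ⁅arcToLoop ξ, b⁆)) * he

/-- The first-order candidate fixes the vacuum and satisfies the twisted relation. The bracket with
`ξ` supplies the change of `a`, and its central term is exactly the anomaly. -/
lemma orbit_tangent {ξ : Arc 𝔤} {e : R} {γ : arcGroup 𝔤 R}
    (h : IsInfinitesimal ξ e γ)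
    (he : e * e = 0) (v : VacuumWeyl κ) : orbit hκ γ v
      = 1 ⊗ₜ v + e ⊗ₜ ⁅Affine.ofArc κ ξ, v⁆ := by
  have h0 : orbit hκ γ = TensorProduct.mk ℂ R (VacuumWeyl κ) 1
      + TensorProduct.mk ℂ R (VacuumWeyl κ) e ∘ₗ
        loopAct κ _ (arcToLoop ξ) := by
    refine orbit_unique hκ _ ?_ fun a v => ?_
    · have : loopAct κ (VacuumWeyl κ) (arcToLoop ξ) (vac κ) = 0 := ofArc_lie_vac κ ξ
      rw [LinearMap.add_apply, LinearMap.comp_apply, this, map_zero, add_zero,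
        TensorProduct.mk_apply]
    · simp only [LinearMap.add_apply, LinearMap.comp_apply, TensorProduct.mk_apply]
      rw [twist_apply, loopAut_tangent h, anomaly_tangent hκ h he]
      simp only [map_add, map_smul, LinearMap.add_apply, LinearMap.smul_apply, vacRep_op_ofLoop,
        smul_add, TensorProduct.smul_tmul', smul_eq_mul, mul_one, he, TensorProduct.zero_tmul,
        add_zero]
      have h1 := loopAct_comm κ (vacuumWeyl_one_lie κ) (arcToLoop ξ) a v
      rw [sub_eq_iff_eq_add] at h1
      rw [h1, mul_right_comm, he, zero_mul, TensorProduct.zero_tmul, add_zero, ← Algebra.commutes,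
        ← Algebra.smul_def, TensorProduct.tmul_add, TensorProduct.tmul_add, TensorProduct.tmul_smul,
        TensorProduct.smul_tmul']
      abel
  rw [h0]
  rfl

include hκ in
theorem vacuumWeyl_isIntegrable : IsIntegrable κ (VacuumWeyl κ) where
  one_lie := vacuumWeyl_one_lie κ
  discrete := vacuumWeyl_discrete κ hκ
  exponentiates := by
    refine ⟨⟨fun R _ _ => ⟨⟨arcAct hκ, arcAct_one hκ⟩, arcAct_mul hκ⟩,
      fun f γ δ h => arcAct_natural hκ h⟩, fun ξ γ h m => ?_⟩
    exact (arcAct_one_tmul hκ γ m).trans (orbit_tangent hκ h DualNumber.eps_mul_eps m)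

end Action

end AffineKM

end

theorem mainTheorem11 (𝔤 : Type u) [LieRing 𝔤] [LieAlgebra ℂ 𝔤] [FiniteDimensional ℂ 𝔤]
    [LieAlgebra.IsSimple ℂ 𝔤] (κ : AffineKM.InvariantForm 𝔤)
    (hκ : κ.IsPositive ∨ κ.IsIrrational) :
    AffineKM.IsProjectiveObject.{u, u, w} κ (AffineKM.VacuumWeyl κ) := by
  obtain ⟨c, hc, -⟩ := AffineKM.level_condition κ hκ
  exact ⟨AffineKM.vacuumWeyl_isIntegrable hc, fun M N _ _ _ _ _ _ _ _ hM hN p hp f =>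
    AffineKM.vacuumWeyl_lifting κ hκ M N hM hN p hp f⟩
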